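/- **Setting.** Let $\mathcal B\subset\mathbb S^3=\mathbb R^3\cup\{\infty\}$ be the Borromean rings, realized as the three ellipses $\{x_3=0,\ x_1^2/4+x_2^2=1\}$, $\{x_1=0,\ x_2^2/4+x_3^2=1\}$, $\{x_2=0,\ x_3^2/4+x_1^2=1\}$. Consider eight tetrahedra $T_0,\dots,T_7$ with vertices $0,1,2,3$ and the following face pairings, where $s(abc)\to t(def)$ identifies the face of $T_s$ with vertices $a,b,c$ with the face of $T_t$ with vertices $d,e,f$, in this order: * $0(012)\to2(013)$, $0(123)\to3(103)$, $1(013)\to2(213)$, $1(123)\to3(120)$, $4(013)\to5(321)$, $4(123)\to6(120)$, $5(012)\to7(021)$, $6(013)\to7(213)$ (inner pairings); * $3(123)\to4(201)$, $3(023)\to4(203)$, $0(013)\to5(302)$, $0(023)\to5(301)$, $1(012)\to6(123)$, $1(023)\to6(032)$, $2(012)\to7(301)$, $2(023)\to7(320)$ (outer pairings). For shape parameters $z_0,\dots,z_7$ put $v_t=\frac1{1-z_t}$, $w_t=\frac{z_t-1}{z_t}$; the complex dihedral angle of $T_t$ is $z_t$ along the edges $01,23$, is $v_t$ along $02,13$,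 and is $w_t$ along $03,12$. For a closed normal path $\alpha$ in the triangulation of a cusp by the vertex links, let $H(\alpha)=\prod_i c_i^{\epsilon_i}$, where the $c_i$ are the complex dihedral angles of the corners that $\alpha$ cuts off and $\epsilon_i=1$ or $-1$ as the corner is to the left or to the right of $\alpha$. A hyperbolic structure on a manifold is an atlas of charts in $\mathbb H^3$ whose transition maps are locally elements of $\mathrm{PSL}(2,\mathbb C)$; it is complete if the developing map is a covering map, equivalently if there is a surjective covering $p:\mathbb H^3\to M$ that in the charts is locally given by elements of $\mathrm{PSL}(2,\mathbb C)$. **Theorem.** Let $z_0=z_5=z_7=\frac{1+i}2$, $z_1=z_2=z_4=1+i$, $z_3=z_6=i$. 1. The triangulation is obtained from the Aitchison–Lumsden–Rubinstein decomposition of $\mathbb S^3\setminus\mathcal B$ into two octahedra: $T_0,\dots,T_3$ and $T_4,\dots,T_7$ subdivide one octahedron each, as the four tetrahedra around an axis, with the inner pairings inside them; the outer pairings glue each face of the first octahedron to the same face of the second by a rotation by $\pm2\pi/3$, the sign being given by the checkerboard colouring. 2. All $z_t$ have positive imaginary part. For each edge class of the triangulation, the product of the complex dihedral angles is $1$ and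 their arguments add up to $2\pi$. Explicitly, each of the following products is $1$, and the arguments of its factors add up to $2\pi$: $$\begin{gathered}z_0w_1z_2w_3z_4z_5v_6v_7,\quad v_4w_5z_6w_7,\quad w_0v_1v_2z_3,\quad v_0z_1w_2v_3w_4v_5w_6z_7,\\ v_1v_2v_6w_6z_7v_7,\quad w_0z_3z_4w_4z_5v_5,\quad z_0v_0z_2w_2w_5w_7,\quad z_1w_1v_3w_3v_4z_6.\end{gathered}$$ 3. $H(\alpha)=1$ for each closed normal path $\alpha$ on a cusp. Moreover, each of the following is equal to $1$: $$\begin{gathered}\frac{z_4}{v_5},\quad \frac{w_4w_1v_7v_0}{v_3w_6z_2z_5},\quad \frac{z_3}{v_4},\quad\frac{w_4w_1z_7z_0}{v_3v_6w_2z_5},\\ \frac{w_0v_2}{w_1v_6z_4w_3},\quad\frac{z_1w_6z_7w_2}{z_5z_0w_3z_4},\quad\frac{w_5v_4}{z_7w_2z_1w_6},\quad\frac{v_6z_4w_3w_1}{v_0v_5z_7w_2}.\end{gathered}$$ 4. Let $T_t$ be realized as the ideal tetrahedron in $\mathbb H^3$ with the ideal vertices $(\zeta_t(0),\zeta_t(1),\zeta_t(2),\zeta_t(3))$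 in $\partial\mathbb H^3=\mathbb C\cup\{\infty\}$ given by $$\begin{array}{ll}\zeta_0=(-i,\infty,0,1),&\zeta_1=(-1,\infty,i,0),\\ \zeta_2=(-i,\infty,-1,0),&\zeta_3=(0,\infty,i,1),\\ \zeta_4=(i,1,\infty,1+2i),&\zeta_5=(1+i,1+2i,1,i),\\ \zeta_6=(1+2i,1,\infty,2+i),&\zeta_7=(1+i,1,1+2i,2+i).\end{array}$$ Then some element of $\mathrm{PSL}(2,\mathbb C)$ takes $\zeta_t(0),\zeta_t(1),\zeta_t(2),\zeta_t(3)$ to $0,\infty,z_t,1$, and the faces identified by the inner pairings and by $3(123)\to4(201)$ coincide, vertex by vertex. 5. Let $X$ be the quotient of the disjoint union of these ideal tetrahedra (without their ideal vertices) by the isometries of faces that realize the pairings. There are a homeomorphism $h:X\to\mathbb S^3\setminus\mathcal B$, a complete hyperbolic structure on $\mathbb S^3\setminus\mathcal B$, and a covering $p:\mathbb H^3\to\mathbb S^3\setminus\mathcal B$ as in the definition of completeness, such that $p(x)=h([x])$ for every point $x$ of each of the tetrahedra, and such that the fibres of $p$ are the orbits of the subgroup of $\mathrm{PSL}(2,\mathbb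 C)$ generated by the face pairings. -/

import Mathlib

open Topology
open scoped MatrixGroups Matrix ComplexOrder

noncomputable section

namespace Borromean

/-! ### Hyperbolic 3-space and `(PSL(2, ℂ), ℍ³)`-structures -/

/-- Hyperbolic 3-space in the Hermitian model: the positive definite Hermitian `2 × 2` complex
matrices of determinant one.  This is a sheet of the hyperboloid `det = 1` in the Minkowski space
of Hermitian matrices with the Lorentzian form `-det`; its sphere at infinity is the set of rays
of rank one positive semidefinite matrices `v vᴴ`, that is, `ℂP¹ = ℂ ∪ {∞}`. -/
def H3 : Type := {X : Matrix (Fin 2) (Fin 2) ℂ // X.PosDef ∧ X.det = 1}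

instance : TopologicalSpace H3 :=
  inferInstanceAs (TopologicalSpace {X : Matrix (Fin 2) (Fin 2) ℂ // X.PosDef ∧ X.det = 1})

/-- The action of `SL(2, ℂ)` on `ℍ³` by `X ↦ g X gᴴ`.  It factors through `PSL(2, ℂ)`, which is in
this way the group of orientation preserving isometries of `ℍ³`. -/
instance : MulAction SL(2, ℂ) H3 where
  smul g X := ⟨g.1 * X.1 * g.1ᴴ, by
    constructor
    · apply X.2.1.mul_mul_conjTranspose_same
      apply Matrix.vecMul_injective_of_isUnit
      exact (Matrix.isUnit_iff_isUnit_det _).2 (by rw [g.2]; exact isUnit_one)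
    · rw [Matrix.det_mul, Matrix.det_mul, Matrix.det_conjTranspose, X.2.2, g.2]
      simp⟩
  one_smul X := Subtype.ext (by
    change (1 : SL(2, ℂ)).1 * X.1 * (1 : SL(2, ℂ)).1ᴴ = X.1
    simp)
  mul_smul g h X := Subtype.ext (by
    change (g * h).1 * X.1 * (g * h).1ᴴ = g.1 * (h.1 * X.1 * h.1ᴴ) * g.1ᴴ
    simp [Matrix.conjTranspose_mul, Matrix.mul_assoc])

theorem continuous_smul_H3 (g : SL(2, ℂ)) : Continuous (fun X : H3 => g • X) := by
  refine Continuous.subtype_mk (f := fun X : H3 => g.1 * X.1 * g.1ᴴ) ?_ _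
  have h : Continuous (fun X : H3 => X.1) := continuous_subtype_val
  exact (continuous_const.matrix_mul h).matrix_mul continuous_const

/-- The maps that locally are restrictions of elements of `PSL(2, ℂ)`. -/
def hyperbolicPregroupoid : Pregroupoid H3 where
  property f s := ∀ x ∈ s, ∃ g : SL(2, ℂ), ∀ᶠ y in 𝓝[s] x, f y = g • y
  comp := by
    intro f f' u v hf hf' hu hv huv x hx
    obtain ⟨g, hg⟩ := hf x hx.1
    obtain ⟨g', hg'⟩ := hf' (f x) hx.2
    refine ⟨g' * g, ?_⟩
    rw [hu.nhdsWithin_eq hx.1] at hg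
    rw [hv.nhdsWithin_eq hx.2] at hg'
    rw [huv.nhdsWithin_eq hx]
    have hfx : f x = g • x := hg.self_of_nhds
    have ht : Filter.Tendsto (fun y => g • y) (𝓝 x) (𝓝 (f x)) := by
      rw [hfx]; exact (continuous_smul_H3 g).continuousAt
    filter_upwards [hg, ht.eventually hg'] with y h1 h2
    simp only [Function.comp_apply]
    rw [h1, h2, mul_smul]
  id_mem := fun x _ => ⟨1, by simp⟩
  locality := by
    intro f u hu h x hx
    obtain ⟨v, hv, hxv, hp⟩ := h x hx
    obtain ⟨g, hg⟩ := hp x ⟨hx, hxv⟩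
    refine ⟨g, ?_⟩
    rw [(hu.inter hv).nhdsWithin_eq ⟨hx, hxv⟩] at hg
    rw [hu.nhdsWithin_eq hx]
    exact hg
  congr := by
    intro f f' u _ h hf x hx
    obtain ⟨g, hg⟩ := hf x hx
    refine ⟨g, ?_⟩
    filter_upwards [hg, self_mem_nhdsWithin] with y h1 h2
    rw [h y h2, h1]

/-- The pseudogroup of local homeomorphisms of `ℍ³` that locally are elements of `PSL(2, ℂ)`.
A (real) hyperbolic structure on `M` is an atlas of charts `M ⊇ U → ℍ³` whose transition maps
belong to this pseudogroup: `[ChartedSpace H3 M] [HasGroupoid M hyperbolicGroupoid]`. -/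
def hyperbolicGroupoid : StructureGroupoid H3 := hyperbolicPregroupoid.groupoid

/-- `p : ℍ³ → M` is a surjective covering map which in the charts of `M` is locally an element of
`PSL(2, ℂ)`.  For connected `M` such a `p` exists if and only if the developing map from the
universal cover of `M` to `ℍ³` is a covering map (`p` is then the universal covering composed with
the inverse of the developing map), that is, if and only if the hyperbolic structure of `M` is
complete. -/
structure IsHyperbolicUniversalCover {M : Type} [TopologicalSpace M] [ChartedSpace H3 M]
    (p : H3 → M) : Prop where
  isCoveringMap : IsCoveringMap p
  surjective : Function.Surjective p
  isLocalIsometry : ∀ x : H3, ∀ e ∈ atlas H3 M, p x ∈ e.source →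
    ∃ g : SL(2, ℂ), ∀ᶠ y in 𝓝 x, e (p y) = g • y

/-! ### Ideal polyhedra -/

/-- A vector of `ℂ²` that represents a point of `∂ℍ³ = ℂ ∪ {∞} = ℂP¹`. -/
def idealVector : OnePoint ℂ → Fin 2 → ℂ
  | none => ![1, 0]
  | some ζ => ![ζ, 1]

/-- The light-like Hermitian matrix `v vᴴ` that spans the ray of an ideal point. -/
def idealRay (ζ : OnePoint ℂ) : Matrix (Fin 2) (Fin 2) ℂ :=
  Matrix.vecMulVec (idealVector ζ) (star (idealVector ζ))

/-- The hyperbolic convex hull in `ℍ³` of finitely many ideal points: as in the projective model,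
the points of `ℍ³` in the convex cone spanned by the rays of the ideal points. -/
def idealHull {k : ℕ} (ζ : Fin k → OnePoint ℂ) : Set H3 :=
  {X | ∃ c : Fin k → ℝ, (∀ i, 0 ≤ c i) ∧ X.1 = ∑ i, (c i : ℂ) • idealRay (ζ i)}

/-- The Möbius action of `SL(2, ℂ)` on `∂ℍ³ = ℂ ∪ {∞}`. -/
def moebius (g : SL(2, ℂ)) (ζ : OnePoint ℂ) : OnePoint ℂ := (g : GL (Fin 2) ℂ) • ζ

/-- The ideal tetrahedron with the (ordered) vertices `ζ` has shape parameter `z` along its edge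
`01`: an orientation preserving isometry takes the vertices `0, 1, 2, 3` to `0, ∞, z, 1`. -/
def HasShape (ζ : Fin 4 → OnePoint ℂ) (z : ℂ) : Prop :=
  ∃ g : SL(2, ℂ), moebius g (ζ 0) = ((0 : ℂ) : OnePoint ℂ) ∧ moebius g (ζ 1) = OnePoint.infty ∧
    moebius g (ζ 2) = (z : OnePoint ℂ) ∧ moebius g (ζ 3) = ((1 : ℂ) : OnePoint ℂ)

/-! ### Gluings of tetrahedra -/

/-- The identification of a face of the tetrahedron `src` with a face of the tetrahedron `tgt`:
the vertex `srcFace k` goes to the vertex `tgtFace k`, for `k = 0, 1, 2`. -/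
structure FacePairing (n : ℕ) where
  src : Fin n
  srcFace : Fin 3 → Fin 4
  tgt : Fin n
  tgtFace : Fin 3 → Fin 4

/-- The inverse identification. -/
def FacePairing.reverse {n : ℕ} (P : FacePairing n) : FacePairing n :=
  ⟨P.tgt, P.tgtFace, P.src, P.srcFace⟩

section Gluing

variable {n : ℕ} (L : List (FacePairing n))

/-- Two edges of tetrahedra are identified by one of the face pairings. -/
def EdgeStep (e e' : Fin n × Sym2 (Fin 4)) : Prop :=
  ∃ P ∈ L, ∃ a b : Fin 3, a ≠ b ∧ e = (P.src, s(P.srcFace a, P.srcFace b)) ∧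
    e' = (P.tgt, s(P.tgtFace a, P.tgtFace b))

open Classical in
/-- The class of the edge `e` (a pair of a tetrahedron and of two of its vertices). -/
def edgeClass (e : Fin n × Sym2 (Fin 4)) : Finset (Fin n × Sym2 (Fin 4)) :=
  Finset.univ.filter (fun e' => Relation.EqvGen (EdgeStep L) e e')

/-- The second complex dihedral angle `v = 1 / (1 - z)`. -/
def vAngle (z : ℂ) : ℂ := 1 / (1 - z)

/-- The third complex dihedral angle `w = (z - 1) / z`. -/
def wAngle (z : ℂ) : ℂ := (z - 1) / z

/-- The complex dihedral angle of the tetrahedron `t` along an edge: `z` along `01` and `23`,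
`v` along `02` and `13`, `w` along `03` and `12`. -/
def edgeAngle (z : Fin n → ℂ) (e : Fin n × Sym2 (Fin 4)) : ℂ :=
  if e.2 = s(0, 1) ∨ e.2 = s(2, 3) then z e.1
  else if e.2 = s(0, 2) ∨ e.2 = s(1, 3) then vAngle (z e.1)
  else wAngle (z e.1)

/-- The gluing equations of a triangulation: for each edge class, the product of the complex
dihedral angles is `1` and their arguments add up to `2π`. -/
def EdgeGluingEquations (z : Fin n → ℂ) : Prop :=
  ∀ e : Fin n × Sym2 (Fin 4), ¬ e.2.IsDiag →
    ∏ e' ∈ edgeClass L e, edgeAngle z e' = 1 ∧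
    ∑ e' ∈ edgeClass L e, (edgeAngle z e').arg = 2 * Real.pi

/-- The passage of a normal path through a triangle of a cusp triangulation.  In `(t, σ)` the
triangle is the link of the vertex `σ 0` of the tetrahedron `t`; the path enters through the side
in the face opposite to `σ 1` and leaves through the side in the face opposite to `σ 2`, so it cuts
off the corner of the triangle that lies on the edge from `σ 0` to `σ 3`. -/
abbrev CuspStep (n : ℕ) : Type := Fin n × Equiv.Perm (Fin 4)

/-- The side through which the step `a` leaves is glued to the side through which `b` enters. -/
def CuspFollows (a b : CuspStep n) : Prop :=
  ∃ P : FacePairing n, (P ∈ L ∨ P.reverse ∈ L) ∧ P.src = a.1 ∧ P.tgt = b.1 ∧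
    (∀ k, P.srcFace k ≠ a.2 2) ∧ (∀ k, P.tgtFace k ≠ b.2 1) ∧
    ∃ k, P.srcFace k = a.2 0 ∧ P.tgtFace k = b.2 0

/-- The factor of a step in the holonomy: the complex dihedral angle of the corner that is cut off,
to the power `1` if the corner is to the left of the path (seen from the cusp), and `-1` if it is
to the right.  With the vertices `0, 1, 2, 3` at `0, ∞, z, 1` and `Im z > 0`, the corner is to the
left exactly if the permutation `σ` is odd. -/
def cuspFactor (z : Fin n → ℂ) (a : CuspStep n) : ℂ :=
  edgeAngle z (a.1, s(a.2 0, a.2 3)) ^ (-((Equiv.Perm.sign a.2 : ℤˣ) : ℤ))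

/-- The completeness equations: `H(α) = 1` for each closed normal path `α` on a cusp. -/
def CuspHolonomyEquations (z : Fin n → ℂ) : Prop :=
  ∀ (m : ℕ) (α : Fin (m + 1) → CuspStep n), (∀ k, CuspFollows L (α k) (α (k + 1))) →
    ∏ k, cuspFactor z (α k) = 1

variable (ζ : Fin n → Fin 4 → OnePoint ℂ)

/-- `g` realizes the face pairing `P` for tetrahedra with the ideal vertices `ζ`; there is exactly
one such element in `PSL(2, ℂ)` if the vertices of each tetrahedron are distinct. -/
def Realizes (P : FacePairing n) (g : SL(2, ℂ)) : Prop :=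
  ∀ k, moebius g (ζ P.src (P.srcFace k)) = ζ P.tgt (P.tgtFace k)

/-- Identification of points of the disjoint union of the ideal tetrahedra by a face pairing. -/
def GlueStep (a b : Σ t : Fin n, idealHull (ζ t)) : Prop :=
  ∃ P ∈ L, ∃ g : SL(2, ℂ), Realizes ζ P g ∧ a.1 = P.src ∧ b.1 = P.tgt ∧
    a.2.1 ∈ idealHull (fun k => ζ P.src (P.srcFace k)) ∧ b.2.1 = g • a.2.1

/-- The space obtained from the disjoint union of the ideal tetrahedra with the vertices `ζ` by
gluing their faces, with the quotient topology. -/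
def GluedSpace : Type := Quot (GlueStep L ζ)

instance : TopologicalSpace (GluedSpace L ζ) :=
  inferInstanceAs (TopologicalSpace (Quot (GlueStep L ζ)))

/-- The image in the glued space of a point of the tetrahedron `t`. -/
def gluedPoint (t : Fin n) (x : idealHull (ζ t)) : GluedSpace L ζ := Quot.mk _ ⟨t, x⟩

/-- The group generated by the isometries that realize the face pairings (the preimage in
`SL(2, ℂ)` of a subgroup of `PSL(2, ℂ)`). -/
def facePairingGroup : Subgroup SL(2, ℂ) :=
  Subgroup.closure {g | ∃ P ∈ L, Realizes ζ P g}

end Gluing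

/-! ### The triangulation of the complement of the Borromean rings -/

/-- The eight identifications of faces inside the two octahedra (the tetrahedra `0, 1, 2, 3` form
one of them, and the tetrahedra `4, 5, 6, 7` the other). -/
def innerPairings : List (FacePairing 8) :=
  [⟨0, ![0, 1, 2], 2, ![0, 1, 3]⟩, ⟨0, ![1, 2, 3], 3, ![1, 0, 3]⟩,
   ⟨1, ![0, 1, 3], 2, ![2, 1, 3]⟩, ⟨1, ![1, 2, 3], 3, ![1, 2, 0]⟩,
   ⟨4, ![0, 1, 3], 5, ![3, 2, 1]⟩, ⟨4, ![1, 2, 3], 6, ![1, 2, 0]⟩,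
   ⟨5, ![0, 1, 2], 7, ![0, 2, 1]⟩, ⟨6, ![0, 1, 3], 7, ![2, 1, 3]⟩]

/-- The eight identifications of the faces of the first octahedron with those of the second. -/
def outerPairings : List (FacePairing 8) :=
  [⟨3, ![1, 2, 3], 4, ![2, 0, 1]⟩, ⟨3, ![0, 2, 3], 4, ![2, 0, 3]⟩,
   ⟨0, ![0, 1, 3], 5, ![3, 0, 2]⟩, ⟨0, ![0, 2, 3], 5, ![3, 0, 1]⟩,
   ⟨1, ![0, 1, 2], 6, ![1, 2, 3]⟩, ⟨1, ![0, 2, 3], 6, ![0, 3, 2]⟩,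
   ⟨2, ![0, 1, 2], 7, ![3, 0, 1]⟩, ⟨2, ![0, 2, 3], 7, ![3, 2, 0]⟩]

/-- All the face pairings of the triangulation. -/
def pairings : List (FacePairing 8) := innerPairings ++ outerPairings

/-- The vertices of an octahedron: the pair `(k, ε)` stands for the vertex `± e k` on the axis `k`.
Each octahedron is one of the two balls bounded by the projection sphere of the alternating diagram
of the Borromean rings that consists of three great circles in the coordinate planes; its vertices
are the crossings. -/
abbrev OctVertex : Type := Fin 3 × Bool

/-- The vertices of the two octahedra at which the vertices of the tetrahedra are. -/
def octLabel : Fin 8 → Fin 4 → OctVertex :=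
  ![![(2, false), (0, false), (0, true), (1, true)],
    ![(1, false), (0, false), (2, true), (0, true)],
    ![(2, false), (0, false), (1, false), (0, true)],
    ![(0, true), (0, false), (2, true), (1, true)],
    ![(1, true), (0, false), (2, true), (0, true)],
    ![(2, false), (0, true), (0, false), (1, true)],
    ![(0, true), (0, false), (2, true), (1, false)],
    ![(2, false), (0, false), (0, true), (1, false)]]

/-- The set of octahedron vertices of a tetrahedron. -/
def octCell (t : Fin 8) : Finset OctVertex := Finset.univ.image (octLabel t)

/-- The triangulation comes from the Aitchison–Lumsden–Rubinstein decomposition.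
* Each of the two octahedra is cut into the four tetrahedra around the axis `0`, and the inner
  pairings are the identity of the octahedron.
* Each face `{(0, ε 0), (1, ε 1), (2, ε 2)}` of the first octahedron is glued to the same face of
  the second by a rotation by a third of a turn, the one that takes the vertex on the axis `k` to
  the vertex on the axis `k - 1`.  Seen from outside, its sense depends on the sign
  `ε 0 * ε 1 * ε 2`, which is the checkerboard colouring of the faces. -/
def IsOctahedralDecomposition : Prop :=
  (∀ b c : Bool,
    (∃! t : Fin 8, t < 4 ∧ octCell t = {(0, true), (0, false), (1, b), (2, c)}) ∧
    (∃! t : Fin 8, 4 ≤ t ∧ octCell t = {(0, true), (0, false), (1, b), (2, c)})) ∧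
  (∀ P ∈ innerPairings, (P.src < 4 ↔ P.tgt < 4) ∧
    ∀ k, octLabel P.src (P.srcFace k) = octLabel P.tgt (P.tgtFace k)) ∧
  (∀ ε : Fin 3 → Bool, ∃ P ∈ outerPairings, P.src < 4 ∧ 4 ≤ P.tgt ∧
    ∀ j : Fin 3, ∃ k, octLabel P.src (P.srcFace k) = (j, ε j) ∧
      octLabel P.tgt (P.tgtFace k) = (j - 1, ε (j - 1)))

/-- The shape parameters. -/
def shape : Fin 8 → ℂ :=
  ![(1 + Complex.I) / 2, 1 + Complex.I, 1 + Complex.I, Complex.I,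
    1 + Complex.I, (1 + Complex.I) / 2, Complex.I, (1 + Complex.I) / 2]

/-- A finite ideal point. -/
def fin (a : ℂ) : OnePoint ℂ := (a : OnePoint ℂ)

open Complex in
/-- The ideal vertices of the eight tetrahedra. -/
def vertexTable : Fin 8 → Fin 4 → OnePoint ℂ :=
  ![![fin (-I), OnePoint.infty, fin 0, fin 1],
    ![fin (-1), OnePoint.infty, fin I, fin 0],
    ![fin (-I), OnePoint.infty, fin (-1), fin 0],
    ![fin 0, OnePoint.infty, fin I, fin 1],
    ![fin I, fin 1, OnePoint.infty, fin (1 + 2 * I)],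
    ![fin (1 + I), fin (1 + 2 * I), fin 1, fin I],
    ![fin (1 + 2 * I), fin 1, OnePoint.infty, fin (2 + I)],
    ![fin (1 + I), fin 1, fin (1 + 2 * I), fin (2 + I)]]

/-- The edge equations of the triangulation, written out: one line for each of the eight edge
classes.  Each line stands for two equations: the product of its entries is `1` and the sum of
their arguments is `2π`. -/
def ExplicitEdgeEquations (z v w : Fin 8 → ℂ) : Prop :=
  ∀ l ∈ ([[z 0, w 1, z 2, w 3, z 4, z 5, v 6, v 7],
          [v 4, w 5, z 6, w 7],
          [w 0, v 1, v 2, z 3],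
          [v 0, z 1, w 2, v 3, w 4, v 5, w 6, z 7],
          [v 1, v 2, v 6, w 6, z 7, v 7],
          [w 0, z 3, z 4, w 4, z 5, v 5],
          [z 0, v 0, z 2, w 2, w 5, w 7],
          [z 1, w 1, v 3, w 3, v 4, z 6]] : List (List ℂ)),
    l.prod = 1 ∧ (l.map Complex.arg).sum = 2 * Real.pi

/-- The boundary holonomy equations, written out. -/
def ExplicitCuspEquations (z v w : Fin 8 → ℂ) : Prop :=
  (z 4 / v 5 = 1 ∧
    (w 4 * w 1 * v 7 * v 0) / (v 3 * w 6 * z 2 * z 5) = 1 ∧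
    z 3 / v 4 = 1 ∧
    (w 4 * w 1 * z 7 * z 0) / (v 3 * v 6 * w 2 * z 5) = 1) ∧
  ((w 0 * v 2) / (w 1 * v 6 * z 4 * w 3) = 1 ∧
    (z 1 * w 6 * z 7 * w 2) / (z 5 * z 0 * w 3 * z 4) = 1) ∧
  ((w 5 * v 4) / (z 7 * w 2 * z 1 * w 6) = 1 ∧
    (v 6 * z 4 * w 3 * w 1) / (v 0 * v 5 * z 7 * w 2) = 1)

/-! ### The Borromean rings -/

/-- The Borromean rings: three congruent ellipses in the coordinate planes of `ℝ³`. -/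
def borromeanRings : Set (EuclideanSpace ℝ (Fin 3)) :=
  {x | (x 2 = 0 ∧ x 0 ^ 2 / 4 + x 1 ^ 2 = 1) ∨
       (x 0 = 0 ∧ x 1 ^ 2 / 4 + x 2 ^ 2 = 1) ∨
       (x 1 = 0 ∧ x 2 ^ 2 / 4 + x 0 ^ 2 = 1)}

/-- The complement of the Borromean rings in the 3-sphere `ℝ³ ∪ {∞}`. -/
abbrev BorromeanComplement : Type :=
  {p : OnePoint (EuclideanSpace ℝ (Fin 3)) // ∀ x ∈ borromeanRings, p ≠ (x : OnePoint _)}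

end Borromean

end

noncomputable section

namespace Borromean

/-! The equations are finite computations. The substance is the identification of the glued space
with the complement of the rings and the construction of its universal covering; both come from one
explicit map on the two octahedra.

Topology. The coordinate planes cut the 3-sphere into eight octants. Each is the suspension of a
triangle with the apexes `0` and `∞`: the normalized squares of the coordinates are barycentric
coordinates, and a monotone function of the distance from `0` is the height. The two octahedra are
cut into octants as well; an octant of the first and the octant of the second with the same signs
are glued along their outer faces to a bipyramid, again a suspension of a triangle, whose three
equatorial vertices are ideal. The boundary of an octant of the sphere contains three arcs of the
rings, one in each quarter plane, and collapsing each arc to a point produces the bipyramid. The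
part of the quarter plane `j` on the side of `0` becomes the lower face with the index `j`, the part
on the side of `∞` the upper face with the index `j + 1`; this shift of the index is the rotation by
a third of a turn in the gluing. Both spaces are parametrized by the same compact set of triples
`m`, `u`, `r` with signs. By `arc_iff_vertex`, `pointQ_eq_of_pointP_eq` and `eqvGen_of_theta_eq`,
the induced map `theta` is defined exactly off the ideal vertices and identifies exactly the points
that the relation `FaceGlue` generates; compactness makes it continuous, and images of closed sets
closed.

Geometry. In the projective model an ideal regular octahedron is `∑ |n j| ≤ t`. That the images of
the two octahedra under the group of the face pairings tessellate hyperbolic space is proved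
arithmetically. Seen from one octahedron, the centers of all the others are integral points `(τ, α)`
of the hyperboloid, so `|α j| ≤ τ - 1`, and each octahedron lies in the Dirichlet domain of its
center (`ht_le_of_mem_cell`); conversely the octahedron with the nearest center contains the point
(`exists_tile`). For distinct centers equality forces `τ = 2`, a neighbour across a face, or `τ =
3`, which is reached by crossing one face more; hence the maps on the octahedra agree on overlaps
(`tileMap_eq`). Congruences modulo `4` (`exists_par`) show that the group acts freely up to sign and
does not mix the two kinds of centers.

Conclusion. The maps fit together to `proj`. Its fibres are the orbits, since every identification
made by `theta` is a chain of face identifications, each realized by the group (`proj_eq_iff`).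
Discreteness and freeness make `proj` a covering, and its local inverses are the charts, so that the
transition maps are elements of the group. The tetrahedra are the quarters of the octahedra around
one axis; the map that `proj` induces on their glued space is a closed continuous bijection.

Cusps. The holonomy of a path is trivial because each factor is a quotient of values of one
potential on the sides of the cusp triangles, so the product telescopes (`factorCode_eq`,
`sideCode_glue`). -/

/-! ### Polar coordinates on a triangle -/

/-- Twice the distance to the nearest integer. -/
def zigzag (u : ℝ) : ℝ := 2 * ‖(u : AddCircle (1 : ℝ))‖

/-- The `3`-periodic tent function that is `1` at `0` and vanishes on `[1, 2]`. -/
def tent (s : ℝ) : ℝ := max 0 (1 - ‖(s : AddCircle (3 : ℝ))‖)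

/-- Polar coordinates on the standard triangle: `m` is the relative distance from the centroid,
and `s` runs with period `3` through the boundary, with the vertices at the integers. -/
def polar (m s : ℝ) (j : Fin 3) : ℝ := (1 - m) / 3 + m * tent (s - ((j : ℕ) : ℝ))

theorem continuous_zigzag : Continuous zigzag :=
  continuous_const.mul (continuous_norm.comp (AddCircle.continuous_mk' 1))

theorem continuous_tent : Continuous tent :=
  continuous_const.max (continuous_const.sub (continuous_norm.comp (AddCircle.continuous_mk' 3)))

theorem zigzag_nonneg (u : ℝ) : 0 ≤ zigzag u := by unfold zigzag; positivity

theorem zigzag_sub_le (u v : ℝ) : zigzag u - zigzag v ≤ 2 * |u - v| := by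
  have h1 : ‖(u : AddCircle (1 : ℝ))‖ - ‖(v : AddCircle (1 : ℝ))‖
      ≤ ‖((u - v : ℝ) : AddCircle (1 : ℝ))‖ := by
    rw [AddCircle.coe_sub]; exact norm_sub_norm_le _ _
  have h2 : ‖((u - v : ℝ) : AddCircle (1 : ℝ))‖ ≤ |u - v| := by
    exact QuotientAddGroup.norm_mk_le_norm
  unfold zigzag; linarith

theorem zigzag_add_int (u : ℝ) (n : ℤ) : zigzag (u + n) = zigzag u := by
  unfold zigzag
  rw [AddCircle.coe_add]
  have : ((n : ℝ) : AddCircle (1 : ℝ)) = 0 := by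
    rw [AddCircle.coe_eq_zero_iff]; exact ⟨n, by simp⟩
  rw [this, add_zero]

theorem zigzag_of_abs_le {u : ℝ} (h : |u| ≤ 1 / 2) : zigzag u = 2 * |u| := by
  unfold zigzag
  rw [(AddCircle.norm_coe_eq_abs_iff (1 : ℝ) one_ne_zero).2 (by simpa using h)]

theorem zigzag_le_one (u : ℝ) : zigzag u ≤ 1 := by
  have h := zigzag_of_abs_le (abs_sub_round u)
  have h2 := zigzag_add_int (u - round u) (round u)
  rw [sub_add_cancel] at h2
  rw [h2, h]; linarith [abs_sub_round u]

theorem zigzag_left (n : ℤ) {v : ℝ} (h0 : 0 ≤ v) (h1 : v ≤ 1 / 2) : zigzag (n + v) = 2 * v := by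
  rw [add_comm, zigzag_add_int, zigzag_of_abs_le (by rwa [abs_of_nonneg h0]), abs_of_nonneg h0]

theorem zigzag_right (n : ℤ) {v : ℝ} (h0 : 1 / 2 ≤ v) (h1 : v ≤ 1) :
    zigzag (n + v) = 2 * (1 - v) := by
  have : (n : ℝ) + v = (v - 1) + ((n + 1 : ℤ) : ℝ) := by push_cast; ring
  rw [this, zigzag_add_int, zigzag_of_abs_le (by rw [abs_le]; constructor <;> linarith),
    abs_of_nonpos (by linarith)]
  ring

theorem tent_nonneg (s : ℝ) : 0 ≤ tent s := le_max_left _ _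

theorem tent_add (s : ℝ) (n : ℤ) : tent (s + 3 * n) = tent s := by
  unfold tent
  rw [AddCircle.coe_add]
  have : ((3 * n : ℝ) : AddCircle (3 : ℝ)) = 0 := by
    rw [AddCircle.coe_eq_zero_iff]; exact ⟨n, by simp [mul_comm]⟩
  rw [this, add_zero]

theorem tent_of_abs_le {s : ℝ} (h : |s| ≤ 1) : tent s = 1 - |s| := by
  unfold tent
  rw [(AddCircle.norm_coe_eq_abs_iff (3 : ℝ) (by norm_num)).2 (by norm_num; linarith),
    max_eq_right (by linarith)]

theorem tent_eq_zero {s : ℝ} (h1 : 1 ≤ s) (h2 : s ≤ 2) : tent s = 0 := by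
  rcases le_total s (3 / 2) with h | h
  · unfold tent
    rw [(AddCircle.norm_coe_eq_abs_iff (3 : ℝ) (by norm_num)).2
      (by rw [abs_of_nonneg (by linarith)]; norm_num; linarith),
      max_eq_left (by rw [abs_of_nonneg (by linarith)]; linarith)]
  · have := tent_add (s - 3) 1
    rw [show s - 3 + 3 * ((1 : ℤ) : ℝ) = s by push_cast; ring] at this
    rw [this]
    unfold tent
    rw [(AddCircle.norm_coe_eq_abs_iff (3 : ℝ) (by norm_num)).2
      (by rw [abs_of_nonpos (by linarith)]; norm_num; linarith),
      max_eq_left (by rw [abs_of_nonpos (by linarith)]; linarith)]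

/-- Between two consecutive integers only the tents at the two ends are nonzero. This makes `polar
1` a piecewise linear parametrization of the boundary of the triangle, one edge per unit interval.
-/
theorem tent_seg (n : ℤ) (k : Fin 3) {v : ℝ} (h0 : 0 ≤ v) (h1 : v ≤ 1) :
    tent (3 * n + (k : ℕ) + v - ((k : ℕ) : ℝ)) = 1 - v ∧
    tent (3 * n + (k : ℕ) + v - (((k + 1 : Fin 3) : ℕ) : ℝ)) = v ∧
    tent (3 * n + (k : ℕ) + v - (((k + 2 : Fin 3) : ℕ) : ℝ)) = 0 := by
  have a0 : ∀ l : ℤ, tent (v + 3 * l) = 1 - v := fun l => by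
    rw [tent_add, tent_of_abs_le (by rwa [abs_of_nonneg h0]), abs_of_nonneg h0]
  have a1 : ∀ l : ℤ, tent (v - 1 + 3 * l) = v := fun l => by
    rw [tent_add, tent_of_abs_le (by rw [abs_le]; constructor <;> linarith),
      abs_of_nonpos (by linarith)]
    ring
  have a2 : ∀ l : ℤ, tent (v + 1 + 3 * l) = 0 := fun l => by
    rw [tent_add, tent_eq_zero (by linarith) (by linarith)]
  fin_cases k
  · refine ⟨?_, ?_, ?_⟩
    · exact (congrArg tent (by simp; ring)).trans (a0 n)
    · exact (congrArg tent (by simp; ring)).trans (a1 n)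
    · exact (congrArg tent (by simp; ring)).trans (a2 (n - 1))
  · refine ⟨?_, ?_, ?_⟩
    · exact (congrArg tent (by simp; ring)).trans (a0 n)
    · exact (congrArg tent (by simp; ring)).trans (a1 n)
    · exact (congrArg tent (by simp; ring)).trans (a2 n)
  · refine ⟨?_, ?_, ?_⟩
    · exact (congrArg tent (by simp; ring)).trans (a0 n)
    · exact (congrArg tent (by simp; ring)).trans (a1 (n + 1))
    · exact (congrArg tent (by simp; ring)).trans (a2 n)

theorem exists_seg (s : ℝ) :
    ∃ (n : ℤ) (k : Fin 3) (v : ℝ), 0 ≤ v ∧ v < 1 ∧ s = 3 * n + (k : ℕ) + v := by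
  have hk : ((⌊s⌋ % 3).toNat) < 3 := by omega
  refine ⟨⌊s⌋ / 3, ⟨(⌊s⌋ % 3).toNat, hk⟩, Int.fract s, Int.fract_nonneg s, Int.fract_lt_one s, ?_⟩
  have h : (3 * (⌊s⌋ / 3) + ((⌊s⌋ % 3).toNat : ℤ)) = ⌊s⌋ := by omega
  have h2 : (3 * ((⌊s⌋ / 3 : ℤ) : ℝ) + (((⌊s⌋ % 3).toNat : ℕ) : ℝ)) = (⌊s⌋ : ℝ) := by
    exact_mod_cast h
  simp only
  rw [h2]; exact (Int.floor_add_fract s).symm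

theorem fin3_cases (k j : Fin 3) : j = k ∨ j = k + 1 ∨ j = k + 2 := by
  revert k j; decide

theorem fin3_add_one_add_two (k : Fin 3) : k + 1 + 2 = k := by
  revert k; decide

theorem fin3_add_two_add_one (k : Fin 3) : k + 2 + 1 = k := by
  revert k; decide

theorem fin3_add_one_add_one (k : Fin 3) : k + 1 + 1 = k + 2 := by
  revert k; decide

theorem sum_fin3_shift (f : Fin 3 → ℝ) (k : Fin 3) : ∑ j, f j = f k + f (k + 1) + f (k + 2) := by
  fin_cases k <;> simp [Fin.sum_univ_three] <;> ring

theorem sum_tent (s : ℝ) : ∑ j : Fin 3, tent (s - ((j : ℕ) : ℝ)) = 1 := by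
  obtain ⟨n, k, v, h0, h1, rfl⟩ := exists_seg s
  obtain ⟨e0, e1, e2⟩ := tent_seg n k h0 h1.le
  rw [sum_fin3_shift _ k, e0, e1, e2]; ring

theorem tent_le_one (s : ℝ) : tent s ≤ 1 := by
  unfold tent; exact max_le (by norm_num) (by linarith [norm_nonneg (s : AddCircle (3 : ℝ))])

theorem polar_nonneg {m : ℝ} (h0 : 0 ≤ m) (h1 : m ≤ 1) (s : ℝ) (j : Fin 3) : 0 ≤ polar m s j :=
  add_nonneg (by linarith) (mul_nonneg h0 (tent_nonneg _))

theorem sum_polar (m s : ℝ) : ∑ j, polar m s j = 1 := by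
  unfold polar
  rw [Finset.sum_add_distrib, ← Finset.mul_sum, sum_tent]
  simp; ring

theorem polar_add (m s : ℝ) (n : ℤ) : polar m (s + 3 * n) = polar m s := by
  ext j
  unfold polar
  rw [show s + 3 * (n : ℝ) - ((j : ℕ) : ℝ) = s - ((j : ℕ) : ℝ) + 3 * n by ring, tent_add]

theorem polar_eq_zero {m s : ℝ} (h0 : 0 ≤ m) (h1 : m ≤ 1) {j : Fin 3} (h : polar m s j = 0) :
    m = 1 ∧ tent (s - ((j : ℕ) : ℝ)) = 0 := by
  unfold polar at h
  have h2 : 0 ≤ m * tent (s - ((j : ℕ) : ℝ)) := mul_nonneg h0 (tent_nonneg _)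
  have hm : m = 1 := by linarith
  subst hm
  exact ⟨rfl, by linarith⟩

theorem polar_one (s : ℝ) (j : Fin 3) : polar 1 s j = tent (s - ((j : ℕ) : ℝ)) := by
  simp [polar]

/-- The smallest coordinate is `(1 - m) / 3`, which recovers `m`; unless the point is the centroid,
the tents are then determined, and they recover `s` modulo `3`. -/
theorem polar_inj {m m' s s' : ℝ} (h0 : 0 ≤ m) (h0' : 0 ≤ m')
    (h : polar m s = polar m' s') : m = m' ∧ (m = 0 ∨ ∃ n : ℤ, s' = s + 3 * n) := by
  obtain ⟨n, k, v, hv0, hv1, hs⟩ := exists_seg s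
  obtain ⟨n', k', v', hv0', hv1', hs'⟩ := exists_seg s'
  obtain ⟨e0, e1, e2⟩ := tent_seg n k hv0 hv1.le
  obtain ⟨e0', e1', e2'⟩ := tent_seg n' k' hv0' hv1'.le
  rw [← hs] at e0 e1 e2
  rw [← hs'] at e0' e1' e2'
  have hj : ∀ j : Fin 3, (1 - m) / 3 + m * tent (s - ((j : ℕ) : ℝ)) =
      (1 - m') / 3 + m' * tent (s' - ((j : ℕ) : ℝ)) := fun j => congrFun h j
  have hm : m = m' := by
    have h1 := hj (k + 2)
    have h2 := hj (k' + 2)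
    rw [e2] at h1
    rw [e2'] at h2
    have := mul_nonneg h0 (tent_nonneg (s - (((k' + 2 : Fin 3) : ℕ) : ℝ)))
    have := mul_nonneg h0' (tent_nonneg (s' - (((k + 2 : Fin 3) : ℕ) : ℝ)))
    linarith
  subst hm
  refine ⟨rfl, ?_⟩
  by_cases hm0 : m = 0
  · exact Or.inl hm0
  right
  have ht : ∀ j : Fin 3, tent (s - ((j : ℕ) : ℝ)) = tent (s' - ((j : ℕ) : ℝ)) := fun j =>
    mul_left_cancel₀ hm0 (by linarith [hj j])
  refine ⟨n' - n, ?_⟩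
  have hkk : k = k' ∧ v = v' := by
    rcases fin3_cases k k' with hk | hk | hk
    · subst hk
      exact ⟨rfl, by rw [← e1, ← e1', ht]⟩
    · exfalso
      have h1 := ht k'
      rw [e0', hk, e1] at h1
      have h2 := ht (k' + 2)
      rw [e2', hk, fin3_add_one_add_two, e0] at h2
      linarith
    · exfalso
      have h1 := ht k'
      rw [e0', hk, e2] at h1
      linarith
  rw [hs, hs', hkk.1, hkk.2]; push_cast; ring

/-- The index of a smallest coordinate is the vertex opposite to the edge that the ray from the
centroid meets; the other two coordinates give the position on this edge. -/
theorem polar_surj {b : Fin 3 → ℝ} (hb : ∀ j, 0 ≤ b j) (hs : ∑ j, b j = 1) :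
    ∃ m s : ℝ, 0 ≤ m ∧ m ≤ 1 ∧ polar m s = b := by
  obtain ⟨j, hj⟩ : ∃ j, ∀ i, b j ≤ b i := Finite.exists_min b
  obtain ⟨k, rfl⟩ : ∃ k : Fin 3, j = k + 2 := ⟨j + 1, (fin3_add_one_add_two j).symm⟩
  rw [sum_fin3_shift _ k] at hs
  by_cases hm : 1 - 3 * b (k + 2) = 0
  · refine ⟨0, 0, le_rfl, zero_le_one, ?_⟩
    ext i
    have h1 := hj k
    have h2 := hj (k + 1)
    simp only [polar]
    rcases fin3_cases k i with rfl | rfl | rfl <;> linarith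
  · have hm0 : 0 < 1 - 3 * b (k + 2) :=
      lt_of_le_of_ne (by linarith [hj k, hj (k + 1)]) (Ne.symm hm)
    set m := 1 - 3 * b (k + 2) with hmdef
    set v := (b (k + 1) - b (k + 2)) / m with hv
    have hv0 : 0 ≤ v := div_nonneg (by linarith [hj (k + 1)]) hm0.le
    have hv1 : v ≤ 1 := by rw [hv, div_le_one hm0]; linarith [hj k]
    have hmv : m * v = b (k + 1) - b (k + 2) := by rw [hv]; field_simp
    obtain ⟨e0, e1, e2⟩ := tent_seg 0 k hv0 hv1
    refine ⟨m, 3 * (0 : ℤ) + (k : ℕ) + v, hm0.le, by linarith [hb (k + 2)], ?_⟩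
    ext i
    unfold polar
    rcases fin3_cases k i with rfl | rfl | rfl
    · rw [e0, mul_sub, hmv]; linarith
    · rw [e1, hmv]; linarith
    · rw [e2]; linarith

/-! ### The two suspensions of the triangle

A point of the octant model has the coordinates `m`, `u`, `r`.  In the bipyramid with three ideal
vertices it has the height `r` and the polar coordinates `m`, `angleP m u r`; in the octant of the
complement of the rings it has the height `heightQ m u r` and the polar coordinates `m`,
`angleQ m u r`. -/

/-- The size of the triangle at the height `r`. -/
def kap (r : ℝ) : ℝ := min (1 + r / 2) (1 - 3 * r / 4)

/-- The height in the complement of the rings. -/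
def heightQ (m u r : ℝ) : ℝ := r + m * zigzag u * kap r

/-- The polar angle in the complement of the rings. -/
def angleQ (m u r : ℝ) : ℝ := u - max 0 (min (heightQ m u r) 1) / 2

/-- The polar angle in the bipyramid. -/
def angleP (m u r : ℝ) : ℝ := u + max r 0 / 8 + (1 / 2 - (|r| + 1 - m) / 8) * zigzag u

/-- The square of the distance from the origin as a function of the height. -/
def sqDist (h : ℝ) : ℝ := 2 * (2 + min h 0) / (4 - 3 * h)

theorem kap_of_nonpos {r : ℝ} (h : r ≤ 0) : kap r = 1 + r / 2 := min_eq_left (by linarith)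

theorem kap_of_nonneg {r : ℝ} (h : 0 ≤ r) : kap r = 1 - 3 * r / 4 := min_eq_right (by linarith)

theorem kap_nonneg {r : ℝ} (h0 : -2 ≤ r) (h1 : r ≤ 4 / 3) : 0 ≤ kap r :=
  le_min (by linarith) (by linarith)

theorem kap_le_one (r : ℝ) : kap r ≤ 1 := by
  rcases le_total r 0 with h | h
  · rw [kap_of_nonpos h]; linarith
  · rw [kap_of_nonneg h]; linarith

/-- The slope of `kap` is never below `-3 / 4`. As this is above `-1`, adding a multiple `c * kap r`
with `c ≤ 1` keeps the height strictly increasing in `r`. -/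
theorem kap_sub_le {r r' : ℝ} (h : r ≤ r') : kap r - kap r' ≤ 3 / 4 * (r' - r) := by
  have : kap r - 3 / 4 * (r' - r) ≤ kap r' :=
    le_min (by linarith [min_le_left (1 + r / 2) (1 - 3 * r / 4), show kap r ≤ 1 + r / 2 from
      min_le_left _ _]) (by linarith [show kap r ≤ 1 - 3 * r / 4 from min_le_right _ _])
  linarith

theorem continuous_kap : Continuous kap := by unfold kap; fun_prop

theorem height_lt {c r r' : ℝ} (h0 : 0 ≤ c) (h1 : c ≤ 1) (h : r < r') :
    r + c * kap r < r' + c * kap r' := by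
  have := kap_sub_le h.le
  nlinarith

theorem height_inj {c r r' : ℝ} (h0 : 0 ≤ c) (h1 : c ≤ 1) (h : r + c * kap r = r' + c * kap r') :
    r = r' := by
  rcases lt_trichotomy r r' with h' | h' | h'
  · linarith [height_lt h0 h1 h']
  · exact h'
  · linarith [height_lt h0 h1 h']

theorem mul_zigzag_mem {m : ℝ} (h0 : 0 ≤ m) (h1 : m ≤ 1) (u : ℝ) :
    0 ≤ m * zigzag u ∧ m * zigzag u ≤ 1 :=
  ⟨mul_nonneg h0 (zigzag_nonneg u), mul_le_one₀ h1 (zigzag_nonneg u) (zigzag_le_one u)⟩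

theorem le_heightQ {m r : ℝ} (h0 : 0 ≤ m) (h1 : m ≤ 1) (u : ℝ) (hr : -2 ≤ r) (hr' : r ≤ 4 / 3) :
    r ≤ heightQ m u r :=
  le_add_of_nonneg_right (mul_nonneg (mul_zigzag_mem h0 h1 u).1 (kap_nonneg hr hr'))

theorem heightQ_le {m r : ℝ} (h0 : 0 ≤ m) (h1 : m ≤ 1) (u : ℝ) (hr : -2 ≤ r) (hr' : r ≤ 4 / 3) :
    heightQ m u r ≤ r + kap r :=
  add_le_add_right (mul_le_of_le_one_left (kap_nonneg hr hr') (mul_zigzag_mem h0 h1 u).2) _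

theorem heightQ_le_top {m r : ℝ} (h0 : 0 ≤ m) (h1 : m ≤ 1) (u : ℝ) (hr : -2 ≤ r)
    (hr' : r ≤ 4 / 3) : heightQ m u r ≤ 1 + r / 4 := by
  have := heightQ_le h0 h1 u hr hr'
  have : kap r ≤ 1 - 3 * r / 4 := min_le_right _ _
  linarith

theorem sqDist_lt {h h' : ℝ} (h0 : -2 ≤ h) (hh : h < h') (h1 : h' < 4 / 3) :
    sqDist h < sqDist h' := by
  unfold sqDist
  rw [div_lt_div_iff₀ (by linarith) (by linarith)]
  rcases le_total h 0 with a | a <;> rcases le_total h' 0 with b | b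
  · rw [min_eq_left a, min_eq_left b]; nlinarith
  · rw [min_eq_left a, min_eq_right b]; nlinarith
  · linarith
  · rw [min_eq_right a, min_eq_right b]; nlinarith

theorem sqDist_nonneg {h : ℝ} (h0 : -2 ≤ h) (h1 : h < 4 / 3) : 0 ≤ sqDist h :=
  div_nonneg (mul_nonneg (by norm_num) (by linarith [le_min h0 (by norm_num : (-2 : ℝ) ≤ 0)]))
    (by linarith)

theorem sqDist_inj {h h' : ℝ} (h0 : -2 ≤ h) (h1 : h < 4 / 3) (h0' : -2 ≤ h') (h1' : h' < 4 / 3)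
    (e : sqDist h = sqDist h') : h = h' := by
  rcases lt_trichotomy h h' with a | a | a
  · linarith [sqDist_lt h0 a h1']
  · exact a
  · linarith [sqDist_lt h0' a h1]

theorem sqDist_pos {h : ℝ} (h0 : -2 < h) (h1 : h < 4 / 3) : 0 < sqDist h := by
  have h2 : sqDist (-2) = 0 := by unfold sqDist; norm_num
  rw [← h2]; exact sqDist_lt le_rfl h0 h1

theorem sqDist_surj {y : ℝ} (hy : 0 ≤ y) : ∃ h, -2 ≤ h ∧ h < 4 / 3 ∧ sqDist h = y := by
  rcases le_total y 1 with h | h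
  · refine ⟨(4 * y - 4) / (2 + 3 * y), ?_, ?_, ?_⟩
    · rw [le_div_iff₀ (by linarith)]; linarith
    · rw [div_lt_iff₀ (by linarith)]; linarith
    · have h2 : (4 * y - 4) / (2 + 3 * y) ≤ 0 := div_nonpos_of_nonpos_of_nonneg (by linarith)
        (by linarith)
      have h3 : (2 + 3 * y) ≠ 0 := by linarith
      have h4 : 4 - 3 * ((4 * y - 4) / (2 + 3 * y)) = 20 / (2 + 3 * y) := by field_simp; ring
      unfold sqDist
      rw [min_eq_left h2, h4]; field_simp; ring
  · have hy0 : y ≠ 0 := by linarith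
    have h2 : 0 ≤ (4 * y - 4) / (3 * y) := div_nonneg (by linarith) (by linarith)
    refine ⟨(4 * y - 4) / (3 * y), by linarith, ?_, ?_⟩
    · rw [div_lt_iff₀ (by linarith)]; linarith
    · have h4 : 4 - 3 * ((4 * y - 4) / (3 * y)) = 4 / y := by field_simp; ring
      unfold sqDist
      rw [min_eq_right h2, h4]; field_simp; ring

theorem heightQ_add (m u r : ℝ) (n : ℤ) : heightQ m (u + 3 * n) r = heightQ m u r := by
  unfold heightQ
  rw [show u + 3 * (n : ℝ) = u + ((3 * n : ℤ) : ℝ) by push_cast; ring, zigzag_add_int]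

theorem angleQ_add (m u r : ℝ) (n : ℤ) : angleQ m (u + 3 * n) r = angleQ m u r + 3 * n := by
  unfold angleQ; rw [heightQ_add]; ring

theorem angleP_add (m u r : ℝ) (n : ℤ) : angleP m (u + 3 * n) r = angleP m u r + 3 * n := by
  unfold angleP
  rw [show u + 3 * (n : ℝ) = u + ((3 * n : ℤ) : ℝ) by push_cast; ring, zigzag_add_int]
  push_cast; ring

/-- The zigzag has slopes `± 2`, and its coefficient is below `1 / 2` exactly when `|r| + 1 - m` is
positive. The degenerate case `m = 1`, `r = 0` is the equator, where the arcs collapse. -/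
theorem angleP_lt {m r u u' : ℝ} (h0 : 0 ≤ m) (hr : |r| ≤ 2)
    (hE : 0 < |r| + 1 - m) (h : u < u') : angleP m u r < angleP m u' r := by
  unfold angleP
  have h1 := zigzag_sub_le u u'
  rw [abs_of_neg (by linarith)] at h1
  nlinarith

theorem angleP_surj {m r : ℝ} (h0 : 0 ≤ m) (h1 : m ≤ 1) (hr : |r| ≤ 2) (s : ℝ) :
    ∃ u, angleP m u r = s := by
  have hc : Continuous (fun u => angleP m u r) := by
    unfold angleP
    exact (by fun_prop : Continuous fun u : ℝ => u + max r 0 / 8).add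
      (continuous_const.mul continuous_zigzag)
  have hb : ∀ u, u ≤ angleP m u r ∧ angleP m u r ≤ u + 1 := fun u => by
    have a := zigzag_nonneg u
    have b := zigzag_le_one u
    have c : max r 0 ≤ |r| := max_le (le_abs_self r) (abs_nonneg r)
    have d : 0 ≤ max r 0 := le_max_right _ _
    have e := abs_nonneg r
    unfold angleP
    constructor
    · nlinarith
    · nlinarith
  have := mem_range_of_exists_le_of_exists_ge hc (c := s) ⟨s - 1, by linarith [(hb (s - 1)).2]⟩
    ⟨s, (hb s).1⟩
  exact this

/-- On the equator the first half of each unit interval is stretched over a whole edge of the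
triangle, and the second half is collapsed to its end vertex. -/
theorem angleP_zero_left (n : ℤ) (k : Fin 3) {v : ℝ} (h0 : 0 ≤ v) (h1 : v ≤ 1 / 2) :
    angleP 1 (3 * n + (k : ℕ) + v) 0 = 3 * n + (k : ℕ) + 2 * v := by
  have := zigzag_left (3 * n + (k : ℕ)) h0 h1
  push_cast at this
  unfold angleP; rw [this]; norm_num; ring

theorem angleP_zero_right (n : ℤ) (k : Fin 3) {v : ℝ} (h0 : 1 / 2 ≤ v) (h1 : v ≤ 1) :
    angleP 1 (3 * n + (k : ℕ) + v) 0 = 3 * n + (k : ℕ) + 1 := by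
  have := zigzag_right (3 * n + (k : ℕ)) h0 h1
  push_cast at this
  unfold angleP; rw [this]; norm_num; ring

/-- Off the ideal vertices, a point of the bipyramid determines the parameter `u`. -/
theorem angleP_inj {m r u u' : ℝ} (h0 : 0 ≤ m) (h1 : m ≤ 1) (hr : |r| ≤ 2) (hm : m ≠ 0)
    (hv : ∀ j, kap r * polar m (angleP m u r) j ≠ 1)
    (h : polar m (angleP m u r) = polar m (angleP m u' r)) : ∃ n : ℤ, u' = u + 3 * n := by
  obtain ⟨-, hm' | ⟨l, hl⟩⟩ := polar_inj h0 h0 h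
  · exact absurd hm' hm
  rw [← angleP_add] at hl
  refine ⟨l, ?_⟩
  by_cases hE : 0 < |r| + 1 - m
  · rcases lt_trichotomy u' (u + 3 * l) with a | a | a
    · linarith [angleP_lt h0 hr hE a]
    · exact a
    · linarith [angleP_lt h0 hr hE a]
  · have hr0 : r = 0 := by
      have := abs_nonneg r
      exact abs_eq_zero.1 (by linarith)
    have hm1 : m = 1 := by have := abs_nonneg r; linarith
    subst hr0 hm1
    have key : ∀ w : ℝ, polar 1 (angleP 1 w 0) = polar 1 (angleP 1 u 0) →
        ∃ (z : ℤ) (v : ℝ), 0 ≤ v ∧ v < 1 / 2 ∧ w = z + v ∧ angleP 1 w 0 = z + 2 * v := by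
      intro w hw
      obtain ⟨n, k, v, v0, v1, rfl⟩ := exists_seg w
      rcases lt_or_ge v (1 / 2) with hv2 | hv2
      · refine ⟨3 * n + (k : ℕ), v, v0, hv2, by push_cast; ring, ?_⟩
        rw [angleP_zero_left n k v0 hv2.le]; push_cast; ring
      · exfalso
        -- The second half of the interval is collapsed to the ideal vertex `k + 1`, which `hv`
        -- excludes.
        apply hv (k + 1)
        rw [← hw, angleP_zero_right n k hv2 v1.le, polar_one, (tent_seg n k zero_le_one le_rfl).2.1,
          kap_of_nonpos le_rfl]
        norm_num
    obtain ⟨z, v, v0, v1, hw, hF⟩ := key (u + 3 * l) (by rw [angleP_add, polar_add])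
    obtain ⟨z', v', v0', v1', hw', hF'⟩ := key u' h.symm
    rw [hF, hF'] at hl
    -- Both doubled fractional parts lie in `[0, 1)`, so the equality of the angles determines the
    -- integers.
    have hz : z = z' := by
      have a1 : ((z - z' : ℤ) : ℝ) < 1 := by push_cast; linarith
      have a2 : (-1 : ℝ) < ((z - z' : ℤ) : ℝ) := by push_cast; linarith
      have a3 : z - z' < 1 := by exact_mod_cast a1
      have a4 : -1 < z - z' := by exact_mod_cast a2
      omega
    subst hz
    rw [hw, hw']; linarith

/-! ### Which sides of the triangle correspond to each other under the two angles. -/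

theorem zigzag_seg_le (n : ℤ) (k : Fin 3) {v : ℝ} (h0 : 0 ≤ v) (h1 : v ≤ 1) :
    zigzag (3 * n + (k : ℕ) + v) = 2 * min v (1 - v) := by
  rcases le_total v (1 / 2) with h | h
  · have := zigzag_left (3 * n + (k : ℕ)) h0 h
    push_cast at this
    rw [this, min_eq_left (by linarith)]
  · have := zigzag_right (3 * n + (k : ℕ)) h h1
    push_cast at this
    rw [this, min_eq_right (by linarith)]

/-- For `r ≤ 0` both angles carry the interval from `k` to `k + 1` into itself; `f` and `q` are the
positions in it. Below the equator they reach the start of the interval together and never its end.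
On the equator at least one of the two collapses: the point is an ideal vertex of the bipyramid, or
it lies on an axis in the sphere. -/
theorem inner_seg (n : ℤ) (k : Fin 3) {v r : ℝ} (h0 : 0 ≤ v) (h1 : v < 1) (hr : -2 ≤ r)
    (hr' : r ≤ 0) : ∃ f q : ℝ, 0 ≤ f ∧ f ≤ 1 ∧ 0 ≤ q ∧ q < 1 ∧
      angleP 1 (3 * n + (k : ℕ) + v) r = 3 * n + (k : ℕ) + f ∧
      angleQ 1 (3 * n + (k : ℕ) + v) r = 3 * n + (k : ℕ) + q ∧
      (f = 0 → q = 0) ∧ (r < 0 → f < 1) ∧ (r < 0 → q = 0 → f = 0) ∧ (r = 0 → f = 1 ∨ q = 0) := by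
  have hz := zigzag_seg_le n k h0 h1.le
  have ha : |r| = -r := abs_of_nonpos hr'
  have hm0 : 0 ≤ min v (1 - v) := le_min h0 (by linarith)
  have hmv : min v (1 - v) ≤ v := min_le_left _ _
  have hmv' : min v (1 - v) ≤ 1 - v := min_le_right _ _
  have hk := kap_of_nonpos hr'
  set c := min v (1 - v) with hc
  have hh : heightQ 1 (3 * n + (k : ℕ) + v) r = r + 2 * c * (1 + r / 2) := by
    unfold heightQ; rw [hz, hk]; ring
  have hh2 : heightQ 1 (3 * n + (k : ℕ) + v) r ≤ 2 * c := by rw [hh]; nlinarith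
  set ρ := heightQ 1 (3 * n + (k : ℕ) + v) r
  have hψ0 : 0 ≤ max 0 (min ρ 1) := le_max_left _ _
  have hψ1 : max 0 (min ρ 1) ≤ 2 * c := max_le (by linarith) (min_le_of_left_le hh2)
  refine ⟨v + (1 / 2 + r / 8) * (2 * c), v - max 0 (min ρ 1) / 2, by nlinarith, by nlinarith,
    by linarith, by linarith, ?_, ?_, ?_, ?_, ?_, ?_⟩
  · unfold angleP; rw [hz, ha, max_eq_right hr']; ring
  · unfold angleQ; ring
  · intro hf
    have : v = 0 := by nlinarith
    linarith
  · intro hr0; nlinarith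
  · intro hr0 hq
    by_cases hv0 : v = 0
    · have : c = 0 := by linarith
      rw [hv0, this]; ring
    · have hv0 : 0 < v := lt_of_le_of_ne h0 (Ne.symm hv0)
      exfalso
      have hψ : max 0 (min ρ 1) = 2 * v := by linarith
      have hρ : min ρ 1 = 2 * v := by
        rcases max_choice 0 (min ρ 1) with h | h <;> linarith
      have : 2 * v ≤ ρ := by rw [← hρ]; exact min_le_left _ _
      nlinarith
  · intro hr0
    rcases le_total v (1 / 2) with h | h
    · right
      have hcv : c = v := min_eq_left (by linarith)
      have : ρ = 2 * v := by rw [hh, hr0, hcv]; ring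
      rw [this, min_eq_left (by linarith), max_eq_right (by linarith)]; ring
    · left
      have hcv : c = 1 - v := min_eq_right (by linarith)
      rw [hr0, hcv]; ring

/-- For `r ≥ 0` the natural interval is centered at the integer: it goes to the edge from `k` to `k
+ 1` in the bipyramid, but to the edge from `k - 1` to `k` in the sphere. The summand `max r 0 / 8`
of `angleP` is what makes the left end land exactly on `k`; at this end the height in the sphere is
at least `1`, so the clamped height there is `1`. -/
theorem outer_seg (n : ℤ) (k : Fin 3) {v r : ℝ} (h0 : -(1 / 2) ≤ v) (h1 : v < 1 / 2) (hr : 0 ≤ r)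
    (hr' : r ≤ 4 / 3) : ∃ f q : ℝ, 0 ≤ f ∧ f < 1 ∧ 0 ≤ q ∧ q ≤ 1 ∧
      angleP 1 (3 * n + (k : ℕ) + v) r = 3 * n + (k : ℕ) + f ∧
      angleQ 1 (3 * n + (k : ℕ) + v) r = 3 * n + (k : ℕ) - 1 + q ∧
      (0 < r → f = 0 → q = 0) ∧ (q = 0 → f = 0) ∧ (0 < r → q < 1) := by
  have hz : zigzag (3 * n + (k : ℕ) + v) = 2 * |v| := by
    have := zigzag_add_int v (3 * n + (k : ℕ))
    push_cast at this
    rw [add_comm, this, zigzag_of_abs_le (abs_le.2 ⟨h0, h1.le⟩)]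
  have ha : |r| = r := abs_of_nonneg hr
  have hk := kap_of_nonneg hr
  have hv0 := abs_nonneg v
  have hv1 : |v| ≤ 1 / 2 := abs_le.2 ⟨h0, h1.le⟩
  have hh : heightQ 1 (3 * n + (k : ℕ) + v) r = r + 2 * |v| * (1 - 3 * r / 4) := by
    unfold heightQ; rw [hz, hk]; ring
  have hP : angleP 1 (3 * n + (k : ℕ) + v) r =
      3 * n + (k : ℕ) + (v + r / 8 + (1 / 2 - r / 8) * (2 * |v|)) := by
    unfold angleP; rw [hz, ha, max_eq_left hr]; ring
  have hh2 : 2 * |v| ≤ heightQ 1 (3 * n + (k : ℕ) + v) r := by rw [hh]; nlinarith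
  set ρ := heightQ 1 (3 * n + (k : ℕ) + v) r
  have hψ1 : max 0 (min ρ 1) ≤ 1 := max_le zero_le_one (min_le_right _ _)
  have hψ2 : 2 * |v| ≤ max 0 (min ρ 1) := le_max_of_le_right (le_min hh2 (by linarith))
  have hvv := le_abs_self v
  have hvf : (0 ≤ v ∧ |v| = v) ∨ (v ≤ 0 ∧ |v| = -v) := by
    rcases le_total 0 v with h | h
    · exact Or.inl ⟨h, abs_of_nonneg h⟩
    · exact Or.inr ⟨h, abs_of_nonpos h⟩
  have hval : -(1 / 2) = v → max 0 (min ρ 1) = 1 := fun h => by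
    have : |v| = 1 / 2 := by rw [← h]; norm_num
    have : 1 ≤ ρ := by rw [hh, this]; linarith
    rw [min_eq_right this]; norm_num
  refine ⟨v + r / 8 + (1 / 2 - r / 8) * (2 * |v|), 1 + v - max 0 (min ρ 1) / 2, ?_, ?_, by linarith,
    by linarith, hP, ?_, ?_, ?_, ?_⟩
  · rcases hvf with ⟨a, b⟩ | ⟨a, b⟩ <;> rw [b] <;> nlinarith
  · rcases hvf with ⟨a, b⟩ | ⟨a, b⟩ <;> rw [b] <;> nlinarith
  · unfold angleQ; ring
  · intro hr0 hf
    have hv : -(1 / 2) = v := by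
      rcases hvf with ⟨a, b⟩ | ⟨a, b⟩ <;> rw [b] at hf
      · exfalso; nlinarith
      · have : r * (1 / 2 + v) = 0 := by linarith
        rcases mul_eq_zero.1 this with h | h <;> linarith
    rw [hval hv]; linarith
  · intro hq
    have hv : v = -(1 / 2) := by linarith
    rw [hv]; norm_num [abs_of_neg]
  · intro hr0
    rcases hvf with ⟨a, b⟩ | ⟨a, b⟩
    · have : 2 * |v| < min ρ 1 := lt_min (by rw [hh]; nlinarith) (by linarith)
      have : 2 * |v| < max 0 (min ρ 1) := lt_max_of_lt_right this
      linarith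
    · rcases eq_or_lt_of_le a with a | a
      · have : 0 < min ρ 1 := lt_min (by rw [hh, b, a]; linarith) one_pos
        have : 0 < max 0 (min ρ 1) := lt_max_of_lt_right this
        linarith
      · linarith [le_max_left 0 (min ρ 1)]

theorem exists_seg_pred (n : ℤ) (k : Fin 3) :
    ∃ n' : ℤ, (3 * n + (k : ℕ) - 1 : ℝ) = 3 * n' + ((k + 2 : Fin 3) : ℕ) := by
  fin_cases k
  · exact ⟨n - 1, by simp; ring⟩
  · exact ⟨n, by simp⟩
  · exact ⟨n, by simp; ring⟩

section Zeros

variable {m u r : ℝ} {j : Fin 3}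

/-- In the first octahedron the faces of an octant keep their index. The vanishing matters because a
sign is lost exactly where its coordinate vanishes. -/
theorem polarQ_eq_zero_of_inner (h0 : 0 ≤ m) (h1 : m ≤ 1) (hr : -2 ≤ r) (hr' : r ≤ 0)
    (hv : ∀ i, kap r * polar m (angleP m u r) i ≠ 1) (h : polar m (angleP m u r) j = 0) :
    polar m (angleQ m u r) j = 0 := by
  obtain ⟨rfl, h⟩ := polar_eq_zero h0 h1 h
  obtain ⟨n, k, v, v0, v1, rfl⟩ := exists_seg u
  obtain ⟨f, q, f0, f1, q0, q1, hP, hQ, c1, c2, -, -⟩ := inner_seg n k v0 v1 hr hr'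
  obtain ⟨p0, p1, p2⟩ := tent_seg n k f0 f1
  obtain ⟨s0, s1, s2⟩ := tent_seg n k q0 q1.le
  rw [hP] at h hv
  rw [polar_one, hQ]
  rcases fin3_cases k j with rfl | rfl | rfl
  · exfalso
    have hf : f = 1 := by linarith
    rcases lt_or_eq_of_le hr' with a | rfl
    · linarith [c2 a]
    · apply hv (j + 1)
      rw [polar_one, p1, hf, kap_of_nonpos le_rfl]; norm_num
  · rw [s1]; exact c1 (by linarith)
  · exact s2

theorem polarP_eq_zero_of_inner (h0 : 0 ≤ m) (h1 : m ≤ 1) (hr : -2 ≤ r) (hr' : r < 0)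
    (h : polar m (angleQ m u r) j = 0) : polar m (angleP m u r) j = 0 := by
  obtain ⟨rfl, h⟩ := polar_eq_zero h0 h1 h
  obtain ⟨n, k, v, v0, v1, rfl⟩ := exists_seg u
  obtain ⟨f, q, f0, f1, q0, q1, hP, hQ, -, -, c3, -⟩ := inner_seg n k v0 v1 hr hr'.le
  obtain ⟨p0, p1, p2⟩ := tent_seg n k f0 f1
  obtain ⟨s0, s1, s2⟩ := tent_seg n k q0 q1.le
  rw [hQ] at h
  rw [polar_one, hP]
  rcases fin3_cases k j with rfl | rfl | rfl
  · linarith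
  · rw [p1]; exact c3 hr' (by linarith)
  · exact p2

/-- An equatorial point that has a vanishing coordinate in the sphere and is not ideal lies there on
the axis `k`, while in the bipyramid it lies on the edge from `k` to `k + 1`. The sole coordinate
known to vanish there, `k + 2`, serves for both indices `j` that vanish in the sphere. -/
theorem polarP_eq_zero_of_middle (h0 : 0 ≤ m) (h1 : m ≤ 1)
    (hv : ∀ i, kap 0 * polar m (angleP m u 0) i ≠ 1) (h : polar m (angleQ m u 0) j = 0) :
    polar m (angleP m u 0) j = 0 ∨ polar m (angleP m u 0) (j + 1) = 0 := by
  obtain ⟨rfl, h⟩ := polar_eq_zero h0 h1 h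
  obtain ⟨n, k, v, v0, v1, rfl⟩ := exists_seg u
  obtain ⟨f, q, f0, f1, q0, q1, hP, hQ, -, -, -, c4⟩ := inner_seg n k v0 v1 (by norm_num) le_rfl
  obtain ⟨p0, p1, p2⟩ := tent_seg n k f0 f1
  obtain ⟨s0, s1, s2⟩ := tent_seg n k q0 q1.le
  rw [hQ] at h
  rw [hP] at hv ⊢
  have hq : q = 0 := by
    rcases c4 rfl with hf | hq
    · exfalso
      apply hv (k + 1)
      rw [polar_one, p1, hf, kap_of_nonpos le_rfl]; norm_num
    · exact hq
  rw [polar_one, polar_one]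
  rcases fin3_cases k j with rfl | rfl | rfl
  · linarith
  · right; rw [fin3_add_one_add_one]; exact p2
  · left; exact p2

theorem outer_tents (h0 : 0 ≤ r) (h1 : r ≤ 4 / 3) (u : ℝ) : ∃ (k : Fin 3) (f q : ℝ),
    0 ≤ f ∧ f < 1 ∧ 0 ≤ q ∧ q ≤ 1 ∧ (0 < r → f = 0 → q = 0) ∧ (q = 0 → f = 0) ∧ (0 < r → q < 1) ∧
    polar 1 (angleP 1 u r) k = 1 - f ∧ polar 1 (angleP 1 u r) (k + 1) = f ∧
    polar 1 (angleP 1 u r) (k + 2) = 0 ∧ polar 1 (angleQ 1 u r) (k + 2) = 1 - q ∧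
    polar 1 (angleQ 1 u r) k = q ∧ polar 1 (angleQ 1 u r) (k + 1) = 0 := by
  -- Adding a half turns the intervals that start at integers into those centered at integers.
  obtain ⟨n, k, v, v0, v1, hu⟩ := exists_seg (u + 1 / 2)
  obtain rfl : u = 3 * n + (k : ℕ) + (v - 1 / 2) := by linarith
  obtain ⟨f, q, f0, f1, q0, q1, hP, hQ, c1, c2, c3⟩ :=
    outer_seg n k (v := v - 1 / 2) (by linarith) (by linarith) h0 h1
  obtain ⟨p0, p1, p2⟩ := tent_seg n k f0 f1.le
  obtain ⟨n', hn'⟩ := exists_seg_pred n k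
  obtain ⟨s0, s1, s2⟩ := tent_seg n' (k + 2) q0 q1
  rw [hn'] at hQ
  rw [fin3_add_two_add_one] at s1
  rw [show k + 2 + 2 = k + 1 by clear hu hP hQ p0 p1 p2 hn' s0 s1 s2; revert k; decide] at s2
  refine ⟨k, f, q, f0, f1, q0, q1, c1, c2, c3, ?_⟩
  simp only [polar_one, hP, hQ]
  exact ⟨p0, p1, p2, s0, s1, s2⟩

/-- In the second octahedron the index of a face is shifted by one relative to the quarter plane;
compare `axisIdx`. -/
theorem polarQ_eq_zero_of_outer (h0 : 0 ≤ m) (h1 : m ≤ 1) (hr : 0 ≤ r) (hr' : r ≤ 4 / 3)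
    (hv : ∀ i, kap r * polar m (angleP m u r) i ≠ 1) (h : polar m (angleP m u r) (j + 1) = 0) :
    polar m (angleQ m u r) j = 0 := by
  obtain ⟨rfl, -⟩ := polar_eq_zero h0 h1 h
  obtain ⟨k, f, q, f0, f1, q0, q1, c1, c2, c3, p0, p1, p2, s0, s1, s2⟩ := outer_tents hr hr' u
  rcases fin3_cases k j with rfl | rfl | rfl
  · rw [p1] at h
    rw [s1]
    rcases lt_or_eq_of_le hr with a | rfl
    · exact c1 a h
    · exfalso; apply hv j; rw [p0, h, kap_of_nonpos le_rfl]; norm_num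
  · exact s2
  · rw [fin3_add_two_add_one, p0] at h; linarith

theorem polarP_eq_zero_of_outer (h0 : 0 ≤ m) (h1 : m ≤ 1) (hr : 0 < r) (hr' : r ≤ 4 / 3)
    (h : polar m (angleQ m u r) j = 0) : polar m (angleP m u r) (j + 1) = 0 := by
  obtain ⟨rfl, -⟩ := polar_eq_zero h0 h1 h
  obtain ⟨k, f, q, f0, f1, q0, q1, c1, c2, c3, p0, p1, p2, s0, s1, s2⟩ := outer_tents hr.le hr' u
  rcases fin3_cases k j with rfl | rfl | rfl
  · rw [p1]; exact c2 (by linarith)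
  · rw [fin3_add_one_add_one]; exact p2
  · linarith [c3 hr]

end Zeros

theorem paramQ_eq_of_paramP_eq {m m' u u' r : ℝ} (h0 : 0 ≤ m) (h1 : m ≤ 1) (h0' : 0 ≤ m')
    (hr : |r| ≤ 2) (hv : ∀ i, kap r * polar m (angleP m u r) i ≠ 1)
    (h : polar m (angleP m u r) = polar m' (angleP m' u' r)) :
    heightQ m u r = heightQ m' u' r ∧
      polar m (angleQ m u r) = polar m' (angleQ m' u' r) := by
  obtain ⟨rfl, hm⟩ := polar_inj h0 h0' h
  by_cases hm0 : m = 0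
  · subst hm0
    constructor
    · simp [heightQ]
    · ext j; simp [polar]
  · obtain ⟨n, rfl⟩ := angleP_inj h0 h1 hr hm0 hv h
    rw [heightQ_add, angleQ_add, polar_add]
    exact ⟨rfl, rfl⟩

/-- The polar angle in the sphere differs from `u` by a function of the height alone, so angle and
height give `u` modulo `3`; then `r` follows because the height is injective in it. At the centroid
the angles carry no information and are not needed. -/
theorem paramP_eq_of_paramQ_eq {m m' u u' r r' : ℝ} (h0 : 0 ≤ m) (h1 : m ≤ 1) (h0' : 0 ≤ m')
    (hh : heightQ m u r = heightQ m' u' r')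
    (h : polar m (angleQ m u r) = polar m' (angleQ m' u' r')) :
    r = r' ∧ polar m (angleP m u r) = polar m' (angleP m' u' r') := by
  obtain ⟨rfl, hm⟩ := polar_inj h0 h0' h
  by_cases hm0 : m = 0
  · subst hm0
    constructor
    · simpa [heightQ] using hh
    · ext j; simp [polar]
  · obtain ⟨n, hn⟩ := hm.resolve_left hm0
    have hu : u' = u + 3 * n := by
      unfold angleQ at hn; rw [hh] at hn; linarith
    subst hu
    rw [heightQ_add] at hh
    obtain ⟨a, b⟩ := mul_zigzag_mem h0 h1 u
    obtain rfl := height_inj a b hh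
    rw [angleP_add, polar_add]
    exact ⟨rfl, rfl⟩

theorem heightQ_eq_bot {m u r : ℝ} (h0 : 0 ≤ m) (h1 : m ≤ 1) (hr : -2 ≤ r) (hr' : r ≤ 4 / 3)
    (h : heightQ m u r = -2) : r = -2 := by
  linarith [le_heightQ h0 h1 u hr hr']

theorem heightQ_eq_top {m u r : ℝ} (h0 : 0 ≤ m) (h1 : m ≤ 1) (hr : -2 ≤ r) (hr' : r ≤ 4 / 3)
    (h : heightQ m u r = 4 / 3) : r = 4 / 3 := by
  linarith [heightQ_le_top h0 h1 u hr hr']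

/-- The ideal vertices of the bipyramid correspond to the arcs of the rings. -/
theorem arc_iff_vertex {m u r : ℝ} (h0 : 0 ≤ m) (h1 : m ≤ 1) (hr : -2 ≤ r) (hr' : r ≤ 4 / 3) :
    (∃ k, polar m (angleQ m u r) (k + 2) = 0 ∧ heightQ m u r < 4 / 3 ∧
      sqDist (heightQ m u r) *
        (polar m (angleQ m u r) k / 4 + polar m (angleQ m u r) (k + 1)) = 1) ↔
    ∃ j, kap r * polar m (angleP m u r) j = 1 := by
  constructor
  · rintro ⟨k, hk, ht, hy⟩
    obtain ⟨rfl, -⟩ := polar_eq_zero h0 h1 hk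
    have hsum := sum_polar 1 (angleQ 1 u r)
    rw [sum_fin3_shift _ k, hk] at hsum
    set s := polar 1 (angleQ 1 u r) (k + 1) with hs
    have hs0 : 0 ≤ s := polar_nonneg zero_le_one le_rfl _ _
    have hk0 : 0 ≤ polar 1 (angleQ 1 u r) k := polar_nonneg zero_le_one le_rfl _ _
    have hs1 : polar 1 (angleQ 1 u r) k = 1 - s := by linarith
    have hρ2 : -2 ≤ heightQ 1 u r := hr.trans (le_heightQ h0 h1 u hr hr')
    have hρ : heightQ 1 u r = 1 - s := by
      rw [hs1] at hy
      -- The function `sqDist` is chosen so that the height is affine along the arc: over the point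
      -- of the edge with the coordinates `1 - s`, `s` the ellipse is at the height `1 - s`.
      -- Monotonicity makes it the only height.
      have h2 : sqDist (1 - s) * ((1 - s) / 4 + s) = 1 := by
        unfold sqDist
        rw [min_eq_right (by linarith)]
        have : 4 - 3 * (1 - s) ≠ 0 := by linarith
        field_simp; ring
      refine sqDist_inj hρ2 ht (by linarith) (by linarith) ?_
      exact mul_right_cancel₀ (b := (1 - s) / 4 + s) (by linarith) (hy.trans h2.symm)
    obtain ⟨t0, t1, t2⟩ := tent_seg 0 k hs0 (by linarith : s ≤ 1)
    have hpol : polar 1 (3 * (0 : ℤ) + (k : ℕ) + s) = polar 1 (angleQ 1 u r) := by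
      ext j
      rw [polar_one]
      rcases fin3_cases k j with rfl | rfl | rfl
      · rw [t0, hs1]
      · rw [t1]
      · rw [t2, hk]
    obtain ⟨-, hm | ⟨n, hn⟩⟩ := polar_inj zero_le_one zero_le_one hpol
    · norm_num at hm
    -- Half of the height is added to the angle `k + s`; so `u` is in the collapsed half of the
    -- interval.
    have hu : u = 3 * n + (k : ℕ) + (1 + s) / 2 := by
      unfold angleQ at hn
      rw [hρ, min_eq_left (by linarith), max_eq_right (by linarith)] at hn
      push_cast at hn
      linarith
    have hz := zigzag_right (3 * n + (k : ℕ)) (v := (1 + s) / 2) (by linarith) (by linarith)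
    push_cast at hz
    rw [← hu] at hz
    have hr0 : r = 0 := by
      refine height_inj (c := zigzag u) (zigzag_nonneg u) (zigzag_le_one u) ?_
      unfold heightQ at hρ
      rw [one_mul] at hρ
      rw [hρ, kap_of_nonpos le_rfl, hz]; ring
    subst hr0
    refine ⟨k + 1, ?_⟩
    rw [hu, angleP_zero_right n k (by linarith) (by linarith), polar_one,
      (tent_seg n k zero_le_one le_rfl).2.1, kap_of_nonpos le_rfl]
    norm_num
  · rintro ⟨j, hj⟩
    have hk1 := kap_le_one r
    have hk0 := kap_nonneg hr hr'
    have hp0 := polar_nonneg h0 h1 (angleP m u r) j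
    have hp1 : polar m (angleP m u r) j ≤ 1 := by
      rw [← sum_polar m (angleP m u r)]
      exact Finset.single_le_sum (fun i _ => polar_nonneg h0 h1 _ i) (Finset.mem_univ j)
    have hkap : kap r = 1 := by nlinarith
    have hpol : polar m (angleP m u r) j = 1 := by nlinarith
    have hr0 : r = 0 := by
      rcases le_total r 0 with h | h
      · rw [kap_of_nonpos h] at hkap; linarith
      · rw [kap_of_nonneg h] at hkap; linarith
    have hm1 : m = 1 := by
      unfold polar at hpol
      nlinarith [tent_le_one (angleP m u r - ((j : ℕ) : ℝ))]
    subst hr0 hm1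
    obtain ⟨n, k, v, v0, v1, rfl⟩ := exists_seg u
    have harc : 1 / 2 ≤ v → (∃ l, polar 1 (angleQ 1 (3 * n + (k : ℕ) + v) 0) (l + 2) = 0 ∧
        heightQ 1 (3 * n + (k : ℕ) + v) 0 < 4 / 3 ∧
      sqDist (heightQ 1 (3 * n + (k : ℕ) + v) 0) * (polar 1 (angleQ 1 (3 * n + (k : ℕ) + v) 0) l / 4
        + polar 1 (angleQ 1 (3 * n + (k : ℕ) + v) 0) (l + 1)) = 1) := fun hv => by
      have hz := zigzag_right (3 * n + (k : ℕ)) hv v1.le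
      push_cast at hz
      have hρ : heightQ 1 (3 * n + (k : ℕ) + v) 0 = 2 * (1 - v) := by
        unfold heightQ; rw [hz, kap_of_nonpos le_rfl]; ring
      have hQ : angleQ 1 (3 * n + (k : ℕ) + v) 0 = 3 * n + (k : ℕ) + (2 * v - 1) := by
        unfold angleQ
        rw [hρ, min_eq_left (by linarith), max_eq_right (by linarith)]; ring
      obtain ⟨t0, t1, t2⟩ := tent_seg n k (v := 2 * v - 1) (by linarith) (by linarith)
      refine ⟨k, ?_⟩
      rw [hρ, hQ, polar_one, polar_one, polar_one, t0, t1, t2]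
      refine ⟨rfl, by linarith, ?_⟩
      unfold sqDist
      rw [min_eq_right (by linarith)]
      rw [div_mul_eq_mul_div, div_eq_one_iff_eq (by linarith)]; ring
    rcases le_total v (1 / 2) with hv | hv
    · have h2 := hpol
      rw [angleP_zero_left n k v0 hv, polar_one] at h2
      obtain ⟨t0, t1, t2⟩ := tent_seg n k (v := 2 * v) (by linarith) (by linarith)
      rcases fin3_cases k j with rfl | rfl | rfl
      · have hv0 : v = 0 := by linarith
        subst hv0
        have hz := zigzag_left (3 * n + (j : ℕ)) (v := 0) le_rfl (by norm_num)
        push_cast at hz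
        have hρ : heightQ 1 (3 * n + (j : ℕ) + 0) 0 = 0 := by
          unfold heightQ; rw [hz]; ring
        have hQ : angleQ 1 (3 * n + (j : ℕ) + 0) 0 = 3 * n + (j : ℕ) + 0 := by
          unfold angleQ; rw [hρ]; norm_num
        obtain ⟨t0, t1, t2⟩ := tent_seg n j (v := 0) le_rfl zero_le_one
        -- Here `u` is an integer, the limit of the preceding collapsed half; the point is the end
        -- at height `0` of the arc with the index `j + 2`, on the axis `j`.
        refine ⟨j + 2, ?_⟩
        rw [hρ, hQ, polar_one, polar_one, polar_one, fin3_add_two_add_one, t0, t2,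
          show j + 2 + 2 = j + 1 by clear * - ; revert j; decide, t1]
        refine ⟨rfl, by norm_num, ?_⟩
        unfold sqDist; norm_num
      · exact harc (by linarith)
      · linarith
    · exact harc hv

/-! ### The octahedra and the complement of the rings -/

abbrev Space3 : Type := EuclideanSpace ℝ (Fin 3)

/-- The parameters `m`, `u`, `r` of a point of the octant model, and the signs of an octant. -/
abbrev Param : Type := ℝ × ℝ × ℝ × (Fin 3 → ℝ)

/-- The parameters of the first octahedron (`false`) and of the second one (`true`). -/
def paramSet (a : Bool) : Set Param :=
  Set.Icc 0 1 ×ˢ Set.Icc 0 3 ×ˢ (if a then Set.Icc 0 (4 / 3) else Set.Icc (-2) 0) ×ˢ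
    Set.univ.pi (fun _ => {1, -1})

/-- The index of the barycentric coordinate that belongs to the axis `j`. -/
def axisIdx (a : Bool) (j : Fin 3) : Fin 3 := if a then j + 1 else j

/-- The point of the octahedron `a` with the given parameters. -/
def pointP (a : Bool) (w : Param) (j : Fin 3) : ℝ :=
  w.2.2.2 j * (kap w.2.2.1 * polar w.1 (angleP w.1 w.2.1 w.2.2.1) (axisIdx a j))

/-- The coordinates of the finite point of the 3-sphere with the given parameters. -/
def euclid (w : Param) : Space3 := WithLp.toLp 2 fun j => w.2.2.2 j *
  √(sqDist (heightQ w.1 w.2.1 w.2.2.1) * polar w.1 (angleQ w.1 w.2.1 w.2.2.1) j)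

/-- The point of the 3-sphere with the given parameters. -/
def pointQ (w : Param) : OnePoint Space3 :=
  if heightQ w.1 w.2.1 w.2.2.1 < 4 / 3 then (euclid w : OnePoint Space3) else OnePoint.infty

/-- The octahedron with the vertices `± e j`, without its vertices. -/
def octa : Set (Fin 3 → ℝ) := {v | ∑ j, |v j| ≤ 1 ∧ ∀ j, |v j| ≠ 1}

/-- The complement of the rings. -/
def ringCompl : Set (OnePoint Space3) := {p | ∀ x ∈ borromeanRings, p ≠ (x : OnePoint Space3)}

theorem isCompact_paramSet (a : Bool) : IsCompact (paramSet a) := by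
  refine isCompact_Icc.prod (isCompact_Icc.prod (IsCompact.prod ?_
    (isCompact_univ_pi fun _ => (Set.toFinite _).isCompact)))
  cases a
  · exact isCompact_Icc
  · exact isCompact_Icc

theorem mem_paramSet {a : Bool} {m u r : ℝ} {e : Fin 3 → ℝ} : (m, u, r, e) ∈ paramSet a ↔
    (0 ≤ m ∧ m ≤ 1) ∧ (0 ≤ u ∧ u ≤ 3) ∧ (if a then 0 ≤ r ∧ r ≤ 4 / 3 else -2 ≤ r ∧ r ≤ 0) ∧
    ∀ j, e j = 1 ∨ e j = -1 := by
  cases a <;> simp [paramSet, Set.mem_prod, Set.mem_pi]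

/-- The bounds for the parameters of a point of one of the octahedra. -/
structure IsParam (w : Param) : Prop where
  m0 : 0 ≤ w.1
  m1 : w.1 ≤ 1
  r0 : -2 ≤ w.2.2.1
  r1 : w.2.2.1 ≤ 4 / 3
  sgn : ∀ j, w.2.2.2 j = 1 ∨ w.2.2.2 j = -1

theorem isParam_of_mem {a : Bool} {w : Param} (h : w ∈ paramSet a) : IsParam w := by
  obtain ⟨m, u, r, e⟩ := w
  obtain ⟨⟨a1, a2⟩, -, a3, a4⟩ := mem_paramSet.1 h
  cases a
  · exact ⟨a1, a2, a3.1, a3.2.trans (by norm_num), a4⟩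
  · exact ⟨a1, a2, by linarith [a3.1], a3.2, a4⟩

theorem IsParam.abs_r {w : Param} (h : IsParam w) : |w.2.2.1| ≤ 2 :=
  abs_le.2 ⟨h.r0, by linarith [h.r1]⟩

theorem IsParam.height0 {w : Param} (h : IsParam w) : -2 ≤ heightQ w.1 w.2.1 w.2.2.1 :=
  h.r0.trans (le_heightQ h.m0 h.m1 _ h.r0 h.r1)

theorem IsParam.height1 {w : Param} (h : IsParam w) : heightQ w.1 w.2.1 w.2.2.1 ≤ 4 / 3 :=
  (heightQ_le_top h.m0 h.m1 _ h.r0 h.r1).trans (by linarith [h.r1])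

theorem IsParam.abs_sgn {w : Param} (h : IsParam w) (j : Fin 3) : |w.2.2.2 j| = 1 := by
  rcases h.sgn j with e | e <;> rw [e] <;> simp

theorem IsParam.abs_pointP {w : Param} (h : IsParam w) (a : Bool) (j : Fin 3) :
    |pointP a w j| = kap w.2.2.1 * polar w.1 (angleP w.1 w.2.1 w.2.2.1) (axisIdx a j) := by
  unfold pointP
  rw [abs_mul, h.abs_sgn, one_mul,
    abs_of_nonneg (mul_nonneg (kap_nonneg h.r0 h.r1) (polar_nonneg h.m0 h.m1 _ _))]

theorem sum_axisIdx (a : Bool) (f : Fin 3 → ℝ) : ∑ j, f (axisIdx a j) = ∑ j, f j := by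
  cases a
  · rfl
  · simp only [axisIdx, if_true, Fin.sum_univ_three]
    simp only [Fin.isValue, zero_add, show (1 + 1 : Fin 3) = 2 from rfl,
      show (2 + 1 : Fin 3) = 0 from rfl]
    ring

theorem exists_axisIdx (a : Bool) (i : Fin 3) : ∃ j, axisIdx a j = i := by
  cases a
  · exact ⟨i, rfl⟩
  · exact ⟨i + 2, fin3_add_two_add_one i⟩

theorem IsParam.sum_pointP {w : Param} (h : IsParam w) (a : Bool) :
    ∑ j, |pointP a w j| = kap w.2.2.1 := by
  simp only [h.abs_pointP a]
  rw [← Finset.mul_sum, sum_axisIdx a, sum_polar, mul_one]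

theorem IsParam.mem_octa {w : Param} (h : IsParam w) (a : Bool) : pointP a w ∈ octa ↔
    ∀ i, kap w.2.2.1 * polar w.1 (angleP w.1 w.2.1 w.2.2.1) i ≠ 1 := by
  constructor
  · rintro ⟨-, h2⟩ i
    obtain ⟨j, rfl⟩ := exists_axisIdx a i
    rw [← h.abs_pointP a]; exact h2 j
  · intro h2
    exact ⟨by rw [h.sum_pointP]; exact kap_le_one _, fun j => by rw [h.abs_pointP]; exact h2 _⟩

theorem IsParam.euclid_sq {w : Param} (h : IsParam w) (hh : heightQ w.1 w.2.1 w.2.2.1 < 4 / 3)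
    (j : Fin 3) : euclid w j ^ 2 =
      sqDist (heightQ w.1 w.2.1 w.2.2.1) * polar w.1 (angleQ w.1 w.2.1 w.2.2.1) j := by
  have : euclid w j = w.2.2.2 j *
    √(sqDist (heightQ w.1 w.2.1 w.2.2.1) * polar w.1 (angleQ w.1 w.2.1 w.2.2.1) j) := rfl
  rw [this, mul_pow, Real.sq_sqrt (mul_nonneg (sqDist_nonneg h.height0 hh)
    (polar_nonneg h.m0 h.m1 _ _)), ← sq_abs, h.abs_sgn]
  ring

theorem IsParam.sum_euclid_sq {w : Param} (h : IsParam w)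
    (hh : heightQ w.1 w.2.1 w.2.2.1 < 4 / 3) :
    ∑ j, euclid w j ^ 2 = sqDist (heightQ w.1 w.2.1 w.2.2.1) := by
  simp only [h.euclid_sq hh]
  rw [← Finset.mul_sum, sum_polar, mul_one]

theorem mem_rings_iff (x : Space3) : x ∈ borromeanRings ↔
    ∃ k, x (k + 2) = 0 ∧ x k ^ 2 / 4 + x (k + 1) ^ 2 = 1 := by
  constructor
  · rintro (⟨h1, h2⟩ | ⟨h1, h2⟩ | ⟨h1, h2⟩)
    · exact ⟨0, h1, h2⟩
    · exact ⟨1, h1, h2⟩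
    · exact ⟨2, h1, h2⟩
  · rintro ⟨k, h1, h2⟩
    fin_cases k
    · exact Or.inl ⟨h1, h2⟩
    · exact Or.inr (Or.inl ⟨h1, h2⟩)
    · exact Or.inr (Or.inr ⟨h1, h2⟩)

/-- In squared coordinates the ellipse equation becomes linear in the barycentric coordinates, so
this is `arc_iff_vertex` read for points with signs. -/
theorem IsParam.mem_ringCompl {w : Param} (h : IsParam w) (a : Bool) :
    pointQ w ∈ ringCompl ↔ pointP a w ∈ octa := by
  rw [h.mem_octa a, ← not_iff_not]
  push Not
  rw [← arc_iff_vertex h.m0 h.m1 h.r0 h.r1]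
  constructor
  · intro hn
    simp only [ringCompl, Set.mem_ofPred_eq, not_forall, not_not] at hn
    obtain ⟨x, hx, hw⟩ := hn
    unfold pointQ at hw
    split_ifs at hw with hh
    · obtain rfl := OnePoint.coe_injective hw
      obtain ⟨k, h1, h2⟩ := (mem_rings_iff _).1 hx
      rw [h.euclid_sq hh, h.euclid_sq hh] at h2
      have h3 := h.euclid_sq hh (k + 2)
      rw [h1] at h3
      refine ⟨k, ?_, hh, by linarith⟩
      have h4 : sqDist (heightQ w.1 w.2.1 w.2.2.1) ≠ 0 := by
        intro h0; rw [h0] at h2; norm_num at h2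
      rcases mul_eq_zero.1 (by linarith : sqDist (heightQ w.1 w.2.1 w.2.2.1) *
        polar w.1 (angleQ w.1 w.2.1 w.2.2.1) (k + 2) = 0) with h5 | h5
      · exact absurd h5 h4
      · exact h5
    · exact absurd hw (OnePoint.infty_ne_coe _)
  · rintro ⟨k, h1, hh, h2⟩ hn
    refine hn (euclid w) ((mem_rings_iff _).2 ⟨k, ?_, ?_⟩) (by unfold pointQ; rw [if_pos hh])
    · have := h.euclid_sq hh (k + 2)
      rw [h1, mul_zero] at this
      exact pow_eq_zero_iff (two_ne_zero) |>.1 this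
    · rw [h.euclid_sq hh, h.euclid_sq hh]; linarith

theorem pointQ_eq_of_sgn_eq {w w' : Param}
    (hh : heightQ w.1 w.2.1 w.2.2.1 = heightQ w'.1 w'.2.1 w'.2.2.1)
    (hd : polar w.1 (angleQ w.1 w.2.1 w.2.2.1) = polar w'.1 (angleQ w'.1 w'.2.1 w'.2.2.1))
    (hs : ∀ j, polar w.1 (angleQ w.1 w.2.1 w.2.2.1) j ≠ 0 → w.2.2.2 j = w'.2.2.2 j) :
    pointQ w = pointQ w' := by
  unfold pointQ
  rw [hh]
  split_ifs
  · congr 1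
    unfold euclid
    congr 1
    ext j
    rw [hh, hd]
    by_cases h0 : polar w.1 (angleQ w.1 w.2.1 w.2.2.1) j = 0
    · rw [← hd, h0]; simp
    · rw [hs j h0]
  · rfl

theorem kap_inj {a : Bool} {r r' : ℝ} (h : if a then 0 ≤ r ∧ r ≤ 4 / 3 else -2 ≤ r ∧ r ≤ 0)
    (h' : if a then 0 ≤ r' ∧ r' ≤ 4 / 3 else -2 ≤ r' ∧ r' ≤ 0) (e : kap r = kap r') : r = r' := by
  cases a
  · simp only [Bool.false_eq_true, if_false] at h h'
    rw [kap_of_nonpos h.2, kap_of_nonpos h'.2] at e; linarith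
  · simp only [if_true] at h h'
    rw [kap_of_nonneg h.1, kap_of_nonneg h'.1] at e; linarith

theorem polarQ_eq_zero_of_polarP {a : Bool} {w : Param} (hw : w ∈ paramSet a)
    (ho : pointP a w ∈ octa) {j : Fin 3}
    (h : polar w.1 (angleP w.1 w.2.1 w.2.2.1) (axisIdx a j) = 0) :
    polar w.1 (angleQ w.1 w.2.1 w.2.2.1) j = 0 := by
  have hp := isParam_of_mem hw
  obtain ⟨-, -, hr, -⟩ := mem_paramSet.1 hw
  have hv := (hp.mem_octa a).1 ho
  cases a
  · exact polarQ_eq_zero_of_inner hp.m0 hp.m1 hr.1 hr.2 hv h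
  · exact polarQ_eq_zero_of_outer hp.m0 hp.m1 hr.1 hr.2 hv h

theorem heightQ_of_kap_eq_zero {w : Param} (h : kap w.2.2.1 = 0) :
    heightQ w.1 w.2.1 w.2.2.1 = w.2.2.1 := by
  unfold heightQ; rw [h]; ring

/-- The size `kap` vanishes only at `r = -2` and `r = 4 / 3`, the centers of the octahedra; they go
to `0` and `∞`, whatever the other parameters are. -/
theorem pointQ_eq_of_kap_eq_zero {w w' : Param} (hr : w.2.2.1 = w'.2.2.1)
    (hk : kap w.2.2.1 = 0) : pointQ w = pointQ w' := by
  have h1 := heightQ_of_kap_eq_zero hk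
  have h2 := heightQ_of_kap_eq_zero (hr ▸ hk)
  rw [← hr] at h2
  unfold pointQ euclid
  rw [← hr, h1, h2]
  split_ifs with hh
  · have hr2 : w.2.2.1 = -2 := by
      rcases le_total w.2.2.1 0 with a | a
      · rw [kap_of_nonpos a] at hk; linarith
      · rw [kap_of_nonneg a] at hk; linarith
    have h0 : sqDist w.2.2.1 = 0 := by rw [hr2]; unfold sqDist; norm_num
    simp [h0]
  · rfl

/-- A point of an octahedron determines the point of the 3-sphere. -/
theorem pointQ_eq_of_pointP_eq {a : Bool} {w w' : Param} (hw : w ∈ paramSet a)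
    (hw' : w' ∈ paramSet a) (ho : pointP a w ∈ octa) (h : pointP a w = pointP a w') :
    pointQ w = pointQ w' := by
  have hp := isParam_of_mem hw
  have hp' := isParam_of_mem hw'
  have hk : kap w.2.2.1 = kap w'.2.2.1 := by rw [← hp.sum_pointP a, ← hp'.sum_pointP a, h]
  have hr : w.2.2.1 = w'.2.2.1 :=
    kap_inj (mem_paramSet.1 hw).2.2.1 (mem_paramSet.1 hw').2.2.1 hk
  by_cases hk0 : kap w.2.2.1 = 0
  · exact pointQ_eq_of_kap_eq_zero hr hk0
  have hb : polar w.1 (angleP w.1 w.2.1 w.2.2.1) = polar w'.1 (angleP w'.1 w'.2.1 w.2.2.1) := by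
    ext i
    obtain ⟨j, rfl⟩ := exists_axisIdx a i
    have h1 := hp.abs_pointP a j
    have h2 := hp'.abs_pointP a j
    rw [h, h2, ← hr] at h1
    exact (mul_left_cancel₀ hk0 h1).symm
  obtain ⟨h1, h2⟩ := paramQ_eq_of_paramP_eq hp.m0 hp.m1 hp'.m0 hp.abs_r ((hp.mem_octa a).1 ho) hb
  refine pointQ_eq_of_sgn_eq (by rw [h1, hr]) (by rw [h2, hr]) fun j hj => ?_
  have hj' : polar w.1 (angleP w.1 w.2.1 w.2.2.1) (axisIdx a j) ≠ 0 := fun h0 =>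
    hj (polarQ_eq_zero_of_polarP hw ho h0)
  have h3 := congrFun h j
  unfold pointP at h3
  rw [← hr, ← hb] at h3
  exact mul_right_cancel₀ (mul_ne_zero hk0 hj') h3

theorem exists_sgn (x : ℝ) : ∃ e : ℝ, (e = 1 ∨ e = -1) ∧ x = e * |x| := by
  rcases le_total 0 x with h | h
  · exact ⟨1, Or.inl rfl, by rw [abs_of_nonneg h, one_mul]⟩
  · exact ⟨-1, Or.inr rfl, by rw [abs_of_nonpos h]; ring⟩

theorem exists_reduce (u : ℝ) : ∃ n : ℤ, 0 ≤ u + 3 * n ∧ u + 3 * n ≤ 3 := by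
  obtain ⟨n, k, v, v0, v1, rfl⟩ := exists_seg u
  refine ⟨-n, ?_, ?_⟩
  · push_cast; have : (0 : ℝ) ≤ (k : ℕ) := Nat.cast_nonneg _; linarith
  · push_cast
    have : ((k : ℕ) : ℝ) ≤ 2 := by exact_mod_cast (by omega : (k : ℕ) ≤ 2)
    linarith

/-- Every point of the bipyramid has parameters. -/
theorem exists_param {b : Fin 3 → ℝ} (hb : ∀ j, 0 ≤ b j) (hs : ∑ j, b j = 1) {r : ℝ}
    (hr : |r| ≤ 2) : ∃ m u : ℝ, (0 ≤ m ∧ m ≤ 1) ∧ (0 ≤ u ∧ u ≤ 3) ∧ polar m (angleP m u r) = b := by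
  obtain ⟨m, s, m0, m1, hp⟩ := polar_surj hb hs
  obtain ⟨u, hu⟩ := angleP_surj m0 m1 hr s
  obtain ⟨n, n0, n1⟩ := exists_reduce u
  exact ⟨m, u + 3 * n, ⟨m0, m1⟩, ⟨n0, n1⟩, by rw [angleP_add, polar_add, hu, hp]⟩

theorem exists_bary {v : Fin 3 → ℝ} (hv : ∀ j, 0 ≤ v j) :
    ∃ b : Fin 3 → ℝ, (∀ j, 0 ≤ b j) ∧ ∑ j, b j = 1 ∧ ∀ j, v j = (∑ i, v i) * b j := by
  by_cases h : ∑ i, v i = 0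
  · refine ⟨fun _ => 1 / 3, fun _ => by norm_num, by simp, fun j => ?_⟩
    rw [h, zero_mul]
    exact (Finset.sum_eq_zero_iff_of_nonneg fun i _ => hv i).1 h j (Finset.mem_univ j)
  · refine ⟨fun j => v j / ∑ i, v i, fun j => div_nonneg (hv j)
      (Finset.sum_nonneg fun i _ => hv i), ?_, fun j => by field_simp⟩
    rw [← Finset.sum_div, div_self h]

theorem pointP_surj (a : Bool) {v : Fin 3 → ℝ} (hv : ∑ j, |v j| ≤ 1) :
    ∃ w ∈ paramSet a, pointP a w = v := by
  obtain ⟨b, b0, b1, hb⟩ := exists_bary (v := fun j => |v j|) (fun j => abs_nonneg _)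
  have hc0 : 0 ≤ ∑ j, |v j| := Finset.sum_nonneg fun _ _ => abs_nonneg _
  choose e he hve using fun j => exists_sgn (v j)
  set c := ∑ j, |v j|
  -- The size of the triangle determines `r` once it is known on which side of the equator the
  -- octahedron lies.
  obtain ⟨r, hr, hk, hr2⟩ : ∃ r : ℝ, (if a then 0 ≤ r ∧ r ≤ 4 / 3 else -2 ≤ r ∧ r ≤ 0) ∧
      kap r = c ∧ |r| ≤ 2 := by
    cases a
    · refine ⟨2 * (c - 1), ⟨by linarith, by linarith⟩, ?_, abs_le.2 ⟨by linarith, by linarith⟩⟩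
      rw [kap_of_nonpos (by linarith)]; ring
    · refine ⟨4 / 3 * (1 - c), ⟨by linarith, by linarith⟩, ?_, abs_le.2 ⟨by linarith, by linarith⟩⟩
      rw [kap_of_nonneg (by linarith)]; ring
  obtain ⟨b', b0', b1', hbb⟩ : ∃ b' : Fin 3 → ℝ, (∀ j, 0 ≤ b' j) ∧ ∑ j, b' j = 1 ∧
      ∀ j, b' (axisIdx a j) = b j := by
    cases a
    · exact ⟨b, b0, b1, fun _ => rfl⟩
    · have hb' : ∀ j, (fun j => b (j + 2)) (axisIdx true j) = b j := fun j => by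
        simp only [axisIdx, if_true, fin3_add_one_add_two]
      refine ⟨fun j => b (j + 2), fun j => b0 _, ?_, hb'⟩
      rw [← sum_axisIdx true]; simp only [hb']; exact b1
  obtain ⟨m, u, hm, hu, hp⟩ := exists_param b0' b1' hr2
  refine ⟨(m, u, r, e), mem_paramSet.2 ⟨hm, hu, hr, he⟩, ?_⟩
  ext j
  simp only [pointP, hp, hk, hbb]
  rw [← hb, ← hve]

theorem pointQ_surj (p : OnePoint Space3) : ∃ a, ∃ w ∈ paramSet a, pointQ w = p := by
  induction p using OnePoint.rec with
  | infty =>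
    refine ⟨true, (0, 0, 4 / 3, fun _ => 1), mem_paramSet.2 ⟨by norm_num, by norm_num,
      ⟨by norm_num, le_rfl⟩, fun _ => Or.inl rfl⟩, ?_⟩
    unfold pointQ heightQ; norm_num
  | coe x =>
    obtain ⟨d, d0, d1, hd⟩ := exists_bary (v := fun j => x j ^ 2) (fun j => sq_nonneg _)
    obtain ⟨h, h0, h1, hy⟩ := sqDist_surj (y := ∑ j, x j ^ 2)
      (Finset.sum_nonneg fun _ _ => sq_nonneg _)
    obtain ⟨m, s, m0, m1, hp⟩ := polar_surj d0 d1
    choose e he hxe using fun j => exists_sgn (x j)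
    -- The angle `u` can be found before `r`, since `angleQ` depends on `r` only through the height,
    -- which is already prescribed.
    obtain ⟨n, n0, n1⟩ := exists_reduce (s + max 0 (min h 1) / 2)
    set u := s + max 0 (min h 1) / 2 + 3 * n with hu
    obtain ⟨c0, c1⟩ := mul_zigzag_mem m0 m1 u
    obtain ⟨r, ⟨r0, r1⟩, hr⟩ : h ∈ (fun r => heightQ m u r) '' Set.Icc (-2) (4 / 3) := by
      apply intermediate_value_Icc (by norm_num)
      · unfold heightQ
        exact (continuous_id.add (continuous_const.mul continuous_kap)).continuousOn
      · constructor
        · have : heightQ m u (-2) = -2 := by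
            unfold heightQ; rw [kap_of_nonpos (by norm_num)]; ring
          linarith
        · have : heightQ m u (4 / 3) = 4 / 3 := by
            unfold heightQ; rw [kap_of_nonneg (by norm_num)]; ring
          linarith
    simp only at hr
    have hQ : polar m (angleQ m u r) = d := by
      rw [← hp, ← polar_add m s n]
      congr 1
      unfold angleQ; rw [hr, hu]; ring
    have hpt : pointQ (m, u, r, e) = (x : OnePoint Space3) := by
      unfold pointQ euclid
      simp only [hr, if_pos h1, hy, hQ]
      congr 1
      ext j
      simp only
      rw [← hd, Real.sqrt_sq_eq_abs, ← hxe]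
    rcases le_total 0 r with hr0 | hr0
    · exact ⟨true, (m, u, r, e), mem_paramSet.2 ⟨⟨m0, m1⟩, ⟨n0, n1⟩, ⟨hr0, r1⟩, he⟩, hpt⟩
    · exact ⟨false, (m, u, r, e), mem_paramSet.2 ⟨⟨m0, m1⟩, ⟨n0, n1⟩, ⟨r0, hr0⟩, he⟩, hpt⟩

/-! ### Continuity of the parametrizations and of the induced maps of the octahedra. -/

theorem continuous_polar {α : Type*} [TopologicalSpace α] {f g : α → ℝ} (hf : Continuous f)
    (hg : Continuous g) (j : Fin 3) : Continuous fun x => polar (f x) (g x) j := by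
  unfold polar
  exact ((continuous_const.sub hf).div_const 3).add
    (hf.mul (continuous_tent.comp (hg.sub continuous_const)))

theorem continuous_heightQ : Continuous fun w : Param => heightQ w.1 w.2.1 w.2.2.1 := by
  unfold heightQ
  have h1 : Continuous fun w : Param => zigzag w.2.1 := continuous_zigzag.comp (by fun_prop)
  have h2 : Continuous fun w : Param => kap w.2.2.1 := continuous_kap.comp (by fun_prop)
  fun_prop

theorem continuous_angleQ : Continuous fun w : Param => angleQ w.1 w.2.1 w.2.2.1 := by
  unfold angleQ
  have := continuous_heightQ
  fun_prop

theorem continuous_angleP : Continuous fun w : Param => angleP w.1 w.2.1 w.2.2.1 := by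
  unfold angleP
  have h1 : Continuous fun w : Param => zigzag w.2.1 := continuous_zigzag.comp (by fun_prop)
  fun_prop

theorem continuous_pointP (a : Bool) : Continuous (pointP a) := by
  refine continuous_pi fun j => ?_
  unfold pointP
  have h1 := continuous_polar (f := fun w : Param => w.1) (by fun_prop) continuous_angleP
    (axisIdx a j)
  have h2 : Continuous fun w : Param => kap w.2.2.1 := continuous_kap.comp (by fun_prop)
  fun_prop

theorem continuousAt_euclid {w : Param} (h : heightQ w.1 w.2.1 w.2.2.1 < 4 / 3) :
    ContinuousAt euclid w := by
  have h1 : ContinuousAt (fun w : Param => sqDist (heightQ w.1 w.2.1 w.2.2.1)) w := by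
    unfold sqDist
    have hc : ContinuousAt (fun w : Param => heightQ w.1 w.2.1 w.2.2.1) w :=
      continuous_heightQ.continuousAt
    exact ContinuousAt.div (continuousAt_const.mul (continuousAt_const.add
      (hc.min continuousAt_const))) (continuousAt_const.sub (continuousAt_const.mul hc))
      (by linarith)
  have h2 : ContinuousAt (fun w : Param => (fun j => w.2.2.2 j *
      √(sqDist (heightQ w.1 w.2.1 w.2.2.1) * polar w.1 (angleQ w.1 w.2.1 w.2.2.1) j) :
        Fin 3 → ℝ)) w := by
    refine continuousAt_pi.2 fun j => ContinuousAt.mul (by fun_prop) ?_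
    exact ((h1.mul (continuous_polar (f := fun w : Param => w.1) (by fun_prop)
      continuous_angleQ j).continuousAt).sqrt)
  exact (PiLp.continuous_toLp 2 _).continuousAt.comp h2

theorem continuousOn_pointQ (a : Bool) : ContinuousOn pointQ (paramSet a) := by
  intro w hw
  have hp := isParam_of_mem hw
  rcases lt_or_eq_of_le hp.height1 with hh | hh
  · have hev : ∀ᶠ w' in 𝓝 w, heightQ w'.1 w'.2.1 w'.2.2.1 < 4 / 3 :=
      continuous_heightQ.continuousAt.eventually_lt continuousAt_const hh
    refine ContinuousAt.continuousWithinAt ?_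
    refine ((OnePoint.continuous_coe.continuousAt.comp (continuousAt_euclid hh)).congr ?_)
    filter_upwards [hev] with w' h'
    simp [pointQ, h']
  · have hw0 : pointQ w = OnePoint.infty := by unfold pointQ; rw [if_neg (by rw [hh]; simp)]
    rw [ContinuousWithinAt, hw0]
    -- A neighbourhood of `∞` contains all points of norm greater than some `R`; a height above both
    -- `0` and `4 / 3 - 1 / (R ^ 2 + 1)` forces the squared norm above `R ^ 2`.
    refine OnePoint.le_nhds_infty.2 fun s hs hsc => ?_
    obtain ⟨R, hR⟩ := hsc.isBounded.exists_norm_le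
    have hev : ∀ᶠ w' in 𝓝[paramSet a] w,
        max 0 (4 / 3 - 1 / (R ^ 2 + 1)) < heightQ w'.1 w'.2.1 w'.2.2.1 := by
      refine (continuousAt_const.eventually_lt continuous_heightQ.continuousAt ?_).filter_mono
        nhdsWithin_le_nhds
      rw [hh]
      refine max_lt (by norm_num) ?_
      have : 0 < 1 / (R ^ 2 + 1) := by positivity
      linarith
    rw [Filter.mem_map]
    filter_upwards [hev, self_mem_nhdsWithin] with w' h' hm
    simp only [Set.mem_preimage]
    by_cases h2 : heightQ w'.1 w'.2.1 w'.2.2.1 < 4 / 3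
    swap
    · exact Or.inr (by unfold pointQ; rw [if_neg h2]; rfl)
    · left
      refine ⟨euclid w', fun hx => ?_, by unfold pointQ; rw [if_pos h2]⟩
      have h3 := (isParam_of_mem hm).sum_euclid_sq h2
      have h4 := hR _ hx
      have h5 : ‖euclid w'‖ ^ 2 = ∑ j, euclid w' j ^ 2 := EuclideanSpace.real_norm_sq_eq _
      rw [h3] at h5
      have h6 : sqDist (heightQ w'.1 w'.2.1 w'.2.2.1) ≤ R ^ 2 := by
        rw [← h5]; exact pow_le_pow_left₀ (norm_nonneg _) h4 2
      have h7 := (max_lt_iff.1 h').1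
      have h8 := (max_lt_iff.1 h').2
      unfold sqDist at h6
      rw [min_eq_right h7.le, div_le_iff₀ (by linarith)] at h6
      have h9 : 4 - 3 * heightQ w'.1 w'.2.1 w'.2.2.1 < 3 * (1 / (R ^ 2 + 1)) := by linarith
      have h10 : R ^ 2 * (4 - 3 * heightQ w'.1 w'.2.1 w'.2.2.1) ≤ R ^ 2 * (3 * (1 / (R ^ 2 + 1))) :=
        mul_le_mul_of_nonneg_left h9.le (sq_nonneg R)
      have h11 : R ^ 2 * (3 * (1 / (R ^ 2 + 1))) ≤ 3 := by
        rw [mul_one_div, mul_div_assoc', div_le_iff₀ (by positivity)]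
        nlinarith [sq_nonneg R]
      linarith

/-- The map from the octahedron `a` to the complement of the rings. -/
def theta (a : Bool) (v : Fin 3 → ℝ) : OnePoint Space3 :=
  open Classical in
  -- The value at `∞` is a dummy for vectors outside the closed octahedron; on `octa` the choice of
  -- parameters is irrelevant.
  if h : ∃ w ∈ paramSet a, pointP a w = v then pointQ h.choose else OnePoint.infty

theorem theta_pointP {a : Bool} {w : Param} (hw : w ∈ paramSet a) (ho : pointP a w ∈ octa) :
    theta a (pointP a w) = pointQ w := by
  have h : ∃ w' ∈ paramSet a, pointP a w' = pointP a w := ⟨w, hw, rfl⟩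
  unfold theta
  rw [dif_pos h]
  exact pointQ_eq_of_pointP_eq h.choose_spec.1 hw (by rw [h.choose_spec.2]; exact ho)
    h.choose_spec.2

theorem theta_mem {a : Bool} {v : Fin 3 → ℝ} (hv : v ∈ octa) : theta a v ∈ ringCompl := by
  obtain ⟨w, hw, rfl⟩ := pointP_surj a hv.1
  rw [theta_pointP hw hv]
  exact ((isParam_of_mem hw).mem_ringCompl a).2 hv

/-- The preimage of a closed set is the trace on `octa` of the image of a compact set of parameters,
so no explicit inverse of the parametrization is needed. -/
theorem continuousOn_theta (a : Bool) : ContinuousOn (theta a) octa := by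
  rw [continuousOn_iff_isClosed]
  intro C hC
  have hk : IsCompact (paramSet a ∩ pointQ ⁻¹' C) := by
    obtain ⟨D, hD, he⟩ := continuousOn_iff_isClosed.1 (continuousOn_pointQ a) C hC
    rw [Set.inter_comm, he, Set.inter_comm]
    exact (isCompact_paramSet a).inter_right hD
  refine ⟨pointP a '' (paramSet a ∩ pointQ ⁻¹' C), (hk.image (continuous_pointP a)).isClosed, ?_⟩
  ext v
  constructor
  · rintro ⟨h1, h2⟩
    obtain ⟨w, hw, rfl⟩ := pointP_surj a h2.1
    rw [Set.mem_preimage, theta_pointP hw h2] at h1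
    exact ⟨⟨w, ⟨hw, h1⟩, rfl⟩, h2⟩
  · rintro ⟨⟨w, ⟨hw, h1⟩, rfl⟩, h2⟩
    exact ⟨by rw [Set.mem_preimage, theta_pointP hw h2]; exact h1, h2⟩

/-- The same compactness argument with the roles of the two parametrizations exchanged. -/
theorem theta_image_closed (a : Bool) {C : Set (Fin 3 → ℝ)} (hC : IsClosed C) :
    ∃ D : Set (OnePoint Space3), IsClosed D ∧ theta a '' (C ∩ octa) = D ∩ ringCompl := by
  have hk : IsCompact (paramSet a ∩ pointP a ⁻¹' C) :=
    (isCompact_paramSet a).inter_right (hC.preimage (continuous_pointP a))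
  refine ⟨pointQ '' (paramSet a ∩ pointP a ⁻¹' C),
    (hk.image_of_continuousOn ((continuousOn_pointQ a).mono Set.inter_subset_left)).isClosed, ?_⟩
  ext p
  constructor
  · rintro ⟨v, ⟨h1, h2⟩, rfl⟩
    refine ⟨?_, theta_mem h2⟩
    obtain ⟨w, hw, rfl⟩ := pointP_surj a h2.1
    exact ⟨w, ⟨hw, h1⟩, (theta_pointP hw h2).symm⟩
  · rintro ⟨⟨w, ⟨hw, h1⟩, rfl⟩, h2⟩
    have h3 := ((isParam_of_mem hw).mem_ringCompl a).1 h2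
    exact ⟨pointP a w, ⟨h1, h3⟩, theta_pointP hw h3⟩

theorem theta_surj {p : OnePoint Space3} (hp : p ∈ ringCompl) :
    ∃ a, ∃ v ∈ octa, theta a v = p := by
  obtain ⟨a, w, hw, rfl⟩ := pointQ_surj p
  have h := ((isParam_of_mem hw).mem_ringCompl a).1 hp
  exact ⟨a, pointP a w, h, theta_pointP hw h⟩

/-! ### The identifications made by the map to the sphere. -/

/-- The identification of the faces of the two octahedra. -/
def FaceGlue (p q : Bool × (Fin 3 → ℝ)) : Prop :=
  ∃ b e : Fin 3 → ℝ, (∀ j, 0 ≤ b j) ∧ ∑ j, b j = 1 ∧ (∀ j, b j ≠ 1) ∧ (∀ j, e j = 1 ∨ e j = -1) ∧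
    p = (false, fun j => e j * b j) ∧ q = (true, fun j => e j * b (j + 1))

/-- Paired points are the two descriptions of one equatorial parameter `(m, u, 0, e)`, which belongs
to both octahedra. -/
theorem theta_eq_of_faceGlue {p q : Bool × (Fin 3 → ℝ)} (h : FaceGlue p q) :
    theta p.1 p.2 = theta q.1 q.2 := by
  obtain ⟨b, e, b0, b1, b2, he, rfl, rfl⟩ := h
  obtain ⟨m, u, hm, hu, hp⟩ := exists_param b0 b1 (r := 0) (by norm_num)
  have hk : kap 0 = 1 := by rw [kap_of_nonpos le_rfl]; norm_num
  have h1 : (m, u, (0 : ℝ), e) ∈ paramSet false := mem_paramSet.2 ⟨hm, hu, by norm_num, he⟩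
  have h2 : (m, u, (0 : ℝ), e) ∈ paramSet true := mem_paramSet.2 ⟨hm, hu, by norm_num, he⟩
  have ho : ∀ a, pointP a (m, u, (0 : ℝ), e) ∈ octa := fun a =>
    ((isParam_of_mem h1).mem_octa a).2 fun i => by simp only [hk, one_mul, hp]; exact b2 i
  have e1 : pointP false (m, u, (0 : ℝ), e) = fun j => e j * b j := by
    ext j; simp [pointP, hk, hp, axisIdx]
  have e2 : pointP true (m, u, (0 : ℝ), e) = fun j => e j * b (j + 1) := by
    ext j; simp [pointP, hk, hp, axisIdx]
  simp only
  rw [← e1, ← e2, theta_pointP h1 (ho _), theta_pointP h2 (ho _)]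

/-- A sign is invisible in the first octahedron if `b j = 0`. If `b (j + 1) = 0` it is invisible in
the second one: the point is moved there through its face and back through the face with the other
sign. -/
theorem eqvGen_update {b e : Fin 3 → ℝ} (b0 : ∀ j, 0 ≤ b j) (b1 : ∑ j, b j = 1)
    (b2 : ∀ j, b j ≠ 1) (he : ∀ j, e j = 1 ∨ e j = -1) {j : Fin 3} {c : ℝ} (hc : c = 1 ∨ c = -1)
    (h : e j = c ∨ b j = 0 ∨ b (j + 1) = 0) :
    Relation.EqvGen FaceGlue (false, fun i => e i * b i)
      (false, fun i => Function.update e j c i * b i) := by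
  have he' : ∀ i, Function.update e j c i = 1 ∨ Function.update e j c i = -1 := fun i => by
    by_cases hi : i = j
    · subst hi; simpa using hc
    · simpa [Function.update_of_ne hi] using he i
  rcases h with h | h | h
  · rw [← h, Function.update_eq_self]; exact .refl _
  · have : (fun i => e i * b i) = fun i => Function.update e j c i * b i := by
      ext i
      by_cases hi : i = j
      · subst hi; rw [h]; simp
      · rw [Function.update_of_ne hi]
    rw [← this]; exact .refl _
  · have : (fun i => e i * b (i + 1)) = fun i => Function.update e j c i * b (i + 1) := by
      ext i
      by_cases hi : i = j
      · subst hi; rw [h]; simp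
      · rw [Function.update_of_ne hi]
    refine .trans _ (true, fun i => e i * b (i + 1)) _ (.rel _ _ ⟨b, e, b0, b1, b2, he, rfl, rfl⟩) ?_
    rw [this]
    exact .symm _ _ (.rel _ _ ⟨b, _, b0, b1, b2, he', rfl, rfl⟩)

theorem eqvGen_of_sgn {b e e' : Fin 3 → ℝ} (b0 : ∀ j, 0 ≤ b j) (b1 : ∑ j, b j = 1)
    (b2 : ∀ j, b j ≠ 1) (he : ∀ j, e j = 1 ∨ e j = -1) (he' : ∀ j, e' j = 1 ∨ e' j = -1)
    (h : ∀ j, e j = e' j ∨ b j = 0 ∨ b (j + 1) = 0) :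
    Relation.EqvGen FaceGlue (false, fun i => e i * b i) (false, fun i => e' i * b i) := by
  have upd : ∀ (f : Fin 3 → ℝ) (j : Fin 3), (∀ j, f j = 1 ∨ f j = -1) →
      ∀ i, Function.update f j (e' j) i = 1 ∨ Function.update f j (e' j) i = -1 := fun f j hf i => by
    by_cases hi : i = j
    · subst hi; simpa using he' i
    · simpa [Function.update_of_ne hi] using hf i
  have h0 := eqvGen_update b0 b1 b2 he (j := 0) (he' 0) (h 0)
  have h1 := eqvGen_update b0 b1 b2 (upd e 0 he) (j := 1) (he' 1) (by simpa using h 1)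
  have h2 := eqvGen_update b0 b1 b2 (upd _ 1 (upd e 0 he)) (j := 2) (he' 2) (by simpa using h 2)
  have h3 := (h0.trans _ _ _ h1).trans _ _ _ h2
  convert! h3 using 4 with i
  fin_cases i <;> simp

/-- Two points of the octahedra that are mapped to the same point are identified by the gluing of
the faces. -/
theorem eqvGen_of_theta_eq {a a' : Bool} {v v' : Fin 3 → ℝ} (hv : v ∈ octa) (hv' : v' ∈ octa)
    (h : theta a v = theta a' v') : Relation.EqvGen FaceGlue (a, v) (a', v') := by
  obtain ⟨w, hw, rfl⟩ := pointP_surj a hv.1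
  obtain ⟨w', hw', rfl⟩ := pointP_surj a' hv'.1
  rw [theta_pointP hw hv, theta_pointP hw' hv'] at h
  have hp := isParam_of_mem hw
  have hp' := isParam_of_mem hw'
  obtain ⟨-, -, hr, -⟩ := mem_paramSet.1 hw
  obtain ⟨-, -, hr', -⟩ := mem_paramSet.1 hw'
  have same : w.2.2.1 = w'.2.2.1 → a = a' → (∀ j, pointP a w j = pointP a' w' j) →
      Relation.EqvGen FaceGlue (a, pointP a w) (a', pointP a' w') := fun _ ha hj => by
    have : pointP a w = pointP a' w' := funext hj
    rw [this, ha]; exact .refl _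
  -- Negative `r` occur only in the first octahedron and positive ones only in the second.
  have side : w.2.2.1 = w'.2.2.1 → w.2.2.1 ≠ 0 → a = a' := fun e h0 => by
    rw [← e] at hr'
    cases a <;> cases a'
    · rfl
    · exact absurd (le_antisymm hr.2 hr'.1) h0
    · exact absurd (le_antisymm hr'.2 hr.1) h0
    · rfl
  have ends : w.2.2.1 = w'.2.2.1 → kap w.2.2.1 = 0 → w.2.2.1 ≠ 0 →
      Relation.EqvGen FaceGlue (a, pointP a w) (a', pointP a' w') := fun e hk h0 => by
    refine same e (side e h0) fun j => ?_
    unfold pointP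
    rw [← e, hk]; ring
  unfold pointQ at h
  by_cases hh : heightQ w.1 w.2.1 w.2.2.1 < 4 / 3
  swap
  · have h2 : ¬ heightQ w'.1 w'.2.1 w'.2.2.1 < 4 / 3 := fun h2 => by
      rw [if_neg hh, if_pos h2] at h
      exact OnePoint.infty_ne_coe _ h
    have e1 := heightQ_eq_top hp.m0 hp.m1 hp.r0 hp.r1 (le_antisymm hp.height1 (not_lt.1 hh))
    have e2 := heightQ_eq_top hp'.m0 hp'.m1 hp'.r0 hp'.r1 (le_antisymm hp'.height1 (not_lt.1 h2))
    refine ends (e1.trans e2.symm) ?_ (by rw [e1]; norm_num)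
    rw [e1, kap_of_nonneg (by norm_num)]; norm_num
  have hh' : heightQ w'.1 w'.2.1 w'.2.2.1 < 4 / 3 := by
    by_contra h2
    rw [if_pos hh, if_neg h2] at h
    exact OnePoint.coe_ne_infty _ h
  rw [if_pos hh, if_pos hh'] at h
  have hE : euclid w = euclid w' := OnePoint.coe_injective h
  have hρ : heightQ w.1 w.2.1 w.2.2.1 = heightQ w'.1 w'.2.1 w'.2.2.1 := by
    refine sqDist_inj hp.height0 hh hp'.height0 hh' ?_
    rw [← hp.sum_euclid_sq hh, ← hp'.sum_euclid_sq hh', hE]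
  rcases eq_or_lt_of_le hp.height0 with hb | hb
  · have e1 := heightQ_eq_bot hp.m0 hp.m1 hp.r0 hp.r1 hb.symm
    have e2 := heightQ_eq_bot hp'.m0 hp'.m1 hp'.r0 hp'.r1 (hb.trans hρ).symm
    refine ends (e1.trans e2.symm) ?_ (by rw [e1]; norm_num)
    rw [e1, kap_of_nonpos (by norm_num)]; norm_num
  have hy := sqDist_pos hb hh
  have hd : polar w.1 (angleQ w.1 w.2.1 w.2.2.1) = polar w'.1 (angleQ w'.1 w'.2.1 w'.2.2.1) := by
    ext j
    have h1 := hp.euclid_sq hh j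
    have h2 := hp'.euclid_sq hh' j
    rw [← hE, h1, ← hρ] at h2
    exact mul_left_cancel₀ hy.ne' h2
  obtain ⟨hrr, hbb⟩ := paramP_eq_of_paramQ_eq hp.m0 hp.m1 hp'.m0 hρ hd
  have hsg : ∀ j, polar w.1 (angleQ w.1 w.2.1 w.2.2.1) j ≠ 0 → w.2.2.2 j = w'.2.2.2 j := fun j hj => by
    have h1 : w.2.2.2 j * √(sqDist (heightQ w.1 w.2.1 w.2.2.1) *
      polar w.1 (angleQ w.1 w.2.1 w.2.2.1) j) = w'.2.2.2 j * √(sqDist (heightQ w'.1 w'.2.1 w'.2.2.1)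
      * polar w'.1 (angleQ w'.1 w'.2.1 w'.2.2.1) j) := congrArg (fun x : Space3 => x j) hE
    rw [← hρ, ← hd] at h1
    refine mul_right_cancel₀ (Real.sqrt_ne_zero'.2 (mul_pos hy ?_)) h1
    exact lt_of_le_of_ne (polar_nonneg hp.m0 hp.m1 _ _) (Ne.symm hj)
  -- Off the equator the coordinates that vanish in the sphere also vanish in the octahedron, so the
  -- sphere sees every sign that matters.
  have nonmid : (∀ j, polar w.1 (angleP w.1 w.2.1 w.2.2.1) (axisIdx a j) ≠ 0 →
      polar w.1 (angleQ w.1 w.2.1 w.2.2.1) j ≠ 0) → w.2.2.1 ≠ 0 →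
      Relation.EqvGen FaceGlue (a, pointP a w) (a', pointP a' w') := fun hz h0 => by
    have ha := side hrr h0
    refine same hrr ha fun j => ?_
    subst ha
    unfold pointP
    rw [← hbb, ← hrr]
    by_cases hj : polar w.1 (angleP w.1 w.2.1 w.2.2.1) (axisIdx a j) = 0
    · rw [hj]; ring
    · rw [hsg j (hz j hj)]
  rcases lt_trichotomy w.2.2.1 0 with h0 | h0 | h0
  · refine nonmid (fun j hj h1 => hj ?_) h0.ne
    have ha : a = false := by
      cases a
      · rfl
      · exact absurd hr.1 (not_le.2 h0)
    subst ha
    exact polarP_eq_zero_of_inner hp.m0 hp.m1 hp.r0 h0 h1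
  -- On the equator both points are moved to the first octahedron; the signs that the sphere does
  -- not see are then changed one at a time.
  · have hk : kap w.2.2.1 = 1 := by rw [h0, kap_of_nonpos le_rfl]; norm_num
    have hvv := (hp.mem_octa a).1 hv
    set b := polar w.1 (angleP w.1 w.2.1 w.2.2.1) with hbdef
    have b0 : ∀ j, 0 ≤ b j := fun j => polar_nonneg hp.m0 hp.m1 _ _
    have b1 : ∑ j, b j = 1 := sum_polar _ _
    have b2 : ∀ j, b j ≠ 1 := fun j => by have := hvv j; rwa [hk, one_mul] at this
    have toFalse : ∀ (c : Bool) (e : Fin 3 → ℝ), (∀ j, e j = 1 ∨ e j = -1) →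
        Relation.EqvGen FaceGlue (c, fun j => e j * b (axisIdx c j)) (false, fun j => e j * b j) := by
      intro c e he
      cases c
      · exact .refl _
      · exact .symm _ _ (.rel _ _ ⟨b, e, b0, b1, b2, he, rfl, rfl⟩)
    have e1 : pointP a w = fun j => w.2.2.2 j * b (axisIdx a j) := by
      ext j; unfold pointP; rw [hk, one_mul]
    have e2 : pointP a' w' = fun j => w'.2.2.2 j * b (axisIdx a' j) := by
      ext j; unfold pointP; rw [← hrr, hk, one_mul, hbb, hrr]
    rw [e1, e2]
    refine ((toFalse a _ hp.sgn).trans _ _ _ ?_).trans _ _ _ ((toFalse a' _ hp'.sgn).symm)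
    refine eqvGen_of_sgn b0 b1 b2 hp.sgn hp'.sgn fun j => ?_
    by_cases hj : polar w.1 (angleQ w.1 w.2.1 w.2.2.1) j = 0
    · right
      rw [h0] at hj hvv
      rw [hbdef, h0]
      rw [hbdef, h0] at hvv
      exact polarP_eq_zero_of_middle hp.m0 hp.m1 hvv hj
    · exact Or.inl (hsg j hj)
  · refine nonmid (fun j hj h1 => hj ?_) h0.ne'
    have ha : a = true := by
      cases a
      · exact absurd hr.2 (not_le.2 h0)
      · rfl
    subst ha
    exact polarP_eq_zero_of_outer hp.m0 hp.m1 h0 hp.r1 h1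

/-! ### Minkowski coordinates on hyperbolic space -/

/-- The time coordinate. -/
def ht (X : H3) : ℝ := ((X.1 0 0).re + (X.1 1 1).re) / 2

/-- The first space coordinate. -/
def hx (X : H3) : ℝ := (X.1 0 1).re

/-- The second space coordinate. -/
def hy (X : H3) : ℝ := (X.1 0 1).im

/-- The third space coordinate. -/
def hz (X : H3) : ℝ := ((X.1 0 0).re - (X.1 1 1).re) / 2

theorem H3.val_eq (X : H3) : X.1 = !![((ht X + hz X : ℝ) : ℂ), (⟨hx X, hy X⟩ : ℂ);
    (⟨hx X, -hy X⟩ : ℂ), ((ht X - hz X : ℝ) : ℂ)] := by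
  have hH := X.2.1.1
  have h00 : (X.1 0 0).im = 0 := by
    have := hH.apply 0 0
    exact Complex.conj_eq_iff_im.1 this
  have h11 : (X.1 1 1).im = 0 := by
    have := hH.apply 1 1
    exact Complex.conj_eq_iff_im.1 this
  have h10 : X.1 1 0 = star (X.1 0 1) := (hH.apply 1 0).symm
  ext i j
  fin_cases i <;> fin_cases j
  · apply Complex.ext
    · simp [ht, hz]; ring
    · simp [h00]
  · apply Complex.ext <;> simp [hx, hy]
  · apply Complex.ext <;> simp [hx, hy, h10]
  · apply Complex.ext
    · simp [ht, hz]; ring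
    · simp [h11]

theorem H3.det_eq (X : H3) : ht X ^ 2 - hx X ^ 2 - hy X ^ 2 - hz X ^ 2 = 1 := by
  have h := X.2.2
  rw [X.val_eq, Matrix.det_fin_two_of] at h
  have := congrArg Complex.re h
  simp at this
  nlinarith

theorem ht_pos (X : H3) : 0 < ht X := by
  have h0 := X.2.1.diag_pos (i := 0)
  have h1 := X.2.1.diag_pos (i := 1)
  rw [Complex.lt_def] at h0 h1
  have a := h0.1
  have b := h1.1
  simp at a b
  unfold ht; linarith

theorem H3.ext_coord {X Y : H3} (h0 : ht X = ht Y) (h1 : hx X = hx Y) (h2 : hy X = hy Y)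
    (h3 : hz X = hz Y) : X = Y := by
  apply Subtype.ext
  rw [X.val_eq, Y.val_eq, h0, h1, h2, h3]

theorem smul_val (g : SL(2, ℂ)) (X : H3) : (g • X).1 = g.1 * X.1 * g.1ᴴ := rfl

theorem continuous_val : Continuous fun X : H3 => X.1 := continuous_subtype_val

theorem continuous_entry (i j : Fin 2) : Continuous fun X : H3 => X.1 i j :=
  (continuous_apply_apply i j).comp continuous_val

theorem continuous_ht : Continuous ht :=
  ((Complex.continuous_re.comp (continuous_entry 0 0)).add
    (Complex.continuous_re.comp (continuous_entry 1 1))).div_const 2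

theorem continuous_hx : Continuous hx := Complex.continuous_re.comp (continuous_entry 0 1)

theorem continuous_hy : Continuous hy := Complex.continuous_im.comp (continuous_entry 0 1)

theorem continuous_hz : Continuous hz :=
  ((Complex.continuous_re.comp (continuous_entry 0 0)).sub
    (Complex.continuous_re.comp (continuous_entry 1 1))).div_const 2

/-- The action of a matrix with the rows `(a, b)`, `(c, d)` in terms of its entries. -/
theorem smul_entry (g : SL(2, ℂ)) (X : H3) (i j : Fin 2) : (g • X).1 i j =
    g.1 i 0 * ((ht X + hz X : ℝ) : ℂ) * star (g.1 j 0) + g.1 i 0 * ⟨hx X, hy X⟩ * star (g.1 j 1) +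
    g.1 i 1 * ⟨hx X, -hy X⟩ * star (g.1 j 0) + g.1 i 1 * ((ht X - hz X : ℝ) : ℂ) * star (g.1 j 1) := by
  rw [smul_val, X.val_eq]
  simp [Matrix.mul_apply, Fin.sum_univ_two, Matrix.conjTranspose_apply]
  ring

/-- The point with the matrix `1`, the center of the first octahedron. -/
def origin : H3 := ⟨1, Matrix.PosDef.one, Matrix.det_one⟩

theorem ht_origin : ht origin = 1 := by simp [ht, origin]
theorem hx_origin : hx origin = 0 := by simp [hx, origin]
theorem hy_origin : hy origin = 0 := by simp [hy, origin]
theorem hz_origin : hz origin = 0 := by simp [hz, origin]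

/-- `SL(2, ℂ)` acts transitively on hyperbolic space, in terms of coordinates. -/
theorem exists_smul_origin {t x y z : ℝ} (ht0 : 0 < t) (h : t ^ 2 - x ^ 2 - y ^ 2 - z ^ 2 = 1) :
    ∃ g : SL(2, ℂ), ht (g • origin) = t ∧ hx (g • origin) = x ∧ hy (g • origin) = y ∧
      hz (g • origin) = z := by
  have hq : 0 < t - z := by nlinarith [sq_nonneg x, sq_nonneg y, sq_nonneg (t - z)]
  set s := √(t - z) with hs
  have hs0 : 0 < s := Real.sqrt_pos.2 hq
  have hs2 : s * s = t - z := Real.mul_self_sqrt hq.le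
  have hsc : (s : ℂ) ≠ 0 := by exact_mod_cast hs0.ne'
  -- The triangular factor `M` in the Cholesky decomposition `M Mᴴ` of the given positive matrix.
  let M : Matrix (Fin 2) (Fin 2) ℂ := !![((1 / s : ℝ) : ℂ), ⟨x / s, y / s⟩; 0, (s : ℂ)]
  have hM : M.det = 1 := by
    rw [Matrix.det_fin_two_of]; push_cast; field_simp; simp
  have hz1 : (t + z) * (s * s) = 1 + x ^ 2 + y ^ 2 := by rw [hs2]; nlinarith
  let g : SL(2, ℂ) := ⟨M, hM⟩
  have hg : g.1 = M := rfl
  refine ⟨g, ?_, ?_, ?_, ?_⟩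
  · unfold ht
    rw [smul_entry, smul_entry, ht_origin, hx_origin, hy_origin, hz_origin]
    simp [hg, M]
    field_simp
    nlinarith
  · unfold hx
    rw [smul_entry, ht_origin, hx_origin, hy_origin, hz_origin]
    simp [hg, M]
    field_simp
  · unfold hy
    rw [smul_entry, ht_origin, hx_origin, hy_origin, hz_origin]
    simp [hg, M]
    field_simp
  · unfold hz
    rw [smul_entry, smul_entry, ht_origin, hx_origin, hy_origin, hz_origin]
    simp [hg, M]
    field_simp
    nlinarith

theorem exists_coord {t x y z : ℝ} (ht0 : 0 < t) (h : t ^ 2 - x ^ 2 - y ^ 2 - z ^ 2 = 1) :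
    ∃ X : H3, ht X = t ∧ hx X = x ∧ hy X = y ∧ hz X = z :=
  (exists_smul_origin ht0 h).imp' (· • origin) fun _ h => h

/-- The coordinates along the axes of the octahedra: `false` stands for the first octahedron and
`true` for the second one. -/
def lab (a : Bool) (X : H3) : Fin 3 → ℝ :=
  if a then ![hy X, -hx X, hz X] else ![-hz X, hx X, hy X]

/-- The standard octahedron, with the ideal vertices `0, ∞, ±1, ±i`. -/
def cell : Set H3 := {X | |hx X| + |hy X| + |hz X| ≤ ht X}

theorem sum_abs_lab (a : Bool) (X : H3) : ∑ j, |lab a X j| = |hx X| + |hy X| + |hz X| := by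
  cases a <;> simp [lab, Fin.sum_univ_three] <;> ring

theorem sum_sq_lab (a : Bool) (X : H3) : ∑ j, lab a X j ^ 2 = ht X ^ 2 - 1 := by
  have := X.det_eq
  cases a <;> simp [lab, Fin.sum_univ_three] <;> linarith

theorem continuous_lab (a : Bool) : Continuous (lab a) := by
  have h1 := continuous_hx
  have h2 := continuous_hy
  have h3 := continuous_hz
  refine continuous_pi fun j => ?_
  cases a <;> fin_cases j <;> simp [lab] <;> fun_prop

/-- Coordinates of the projective model, along the axes of the octahedra. -/
def klein (a : Bool) (X : H3) (j : Fin 3) : ℝ := lab a X j / ht X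

theorem continuous_klein (a : Bool) : Continuous (klein a) := by
  refine continuous_pi fun j => ?_
  exact ((continuous_apply j).comp (continuous_lab a)).div continuous_ht fun X => (ht_pos X).ne'

theorem sum_sq_klein (a : Bool) (X : H3) : ∑ j, klein a X j ^ 2 = 1 - 1 / ht X ^ 2 := by
  have h := (ht_pos X).ne'
  simp only [klein, div_pow]
  rw [← Finset.sum_div, sum_sq_lab]
  field_simp

theorem sum_sq_klein_lt (a : Bool) (X : H3) : ∑ j, klein a X j ^ 2 < 1 := by
  rw [sum_sq_klein]
  have := ht_pos X
  have : 0 < 1 / ht X ^ 2 := by positivity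
  linarith

theorem ht_eq_klein (a : Bool) (X : H3) : ht X = 1 / √(1 - ∑ j, klein a X j ^ 2) := by
  have h := ht_pos X
  rw [sum_sq_klein, sub_sub_cancel, Real.sqrt_div zero_le_one, Real.sqrt_one,
    Real.sqrt_sq h.le, one_div_one_div]

theorem lab_eq_klein (a : Bool) (X : H3) (j : Fin 3) : lab a X j = ht X * klein a X j := by
  have h := (ht_pos X).ne'
  unfold klein; field_simp

theorem coord_of_lab {a : Bool} {X Y : H3} (h0 : ht X = ht Y) (h : lab a X = lab a Y) : X = Y := by
  have h0' := congrFun h 0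
  have h1 := congrFun h 1
  have h2 := congrFun h 2
  cases a
  · simp [lab] at h0' h1 h2
    exact H3.ext_coord h0 h1 h2 h0'
  · simp [lab] at h0' h1 h2
    exact H3.ext_coord h0 h1 h0' h2

theorem klein_injective (a : Bool) : Function.Injective (klein a) := fun X Y h => by
  have h0 : ht X = ht Y := by rw [ht_eq_klein a X, ht_eq_klein a Y, h]
  refine coord_of_lab h0 (a := a) ?_
  ext j
  rw [lab_eq_klein, lab_eq_klein, h0, h]

theorem exists_klein (a : Bool) {v : Fin 3 → ℝ} (hv : ∑ j, v j ^ 2 < 1) : ∃ X, klein a X = v := by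
  have h1 : 0 < 1 - ∑ j, v j ^ 2 := by linarith
  set t := 1 / √(1 - ∑ j, v j ^ 2) with ht'
  have hs0 : 0 < √(1 - ∑ j, v j ^ 2) := Real.sqrt_pos.2 h1
  have ht0 : 0 < t := by positivity
  have ht2 : t ^ 2 * (1 - ∑ j, v j ^ 2) = 1 := by
    rw [ht', div_pow, Real.sq_sqrt h1.le]; field_simp
  rw [Fin.sum_univ_three] at ht2
  cases a
  · obtain ⟨X, e0, e1, e2, e3⟩ := exists_coord (t := t) (x := t * v 1) (y := t * v 2)
      (z := -(t * v 0)) ht0 (by linarith)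
    refine ⟨X, ?_⟩
    ext j
    fin_cases j <;> simp [klein, lab, e0, e1, e2, e3] <;> field_simp
  · obtain ⟨X, e0, e1, e2, e3⟩ := exists_coord (t := t) (x := -(t * v 1)) (y := t * v 0)
      (z := t * v 2) ht0 (by linarith)
    refine ⟨X, ?_⟩
    ext j
    fin_cases j <;> simp [klein, lab, e0, e1, e2, e3] <;> field_simp

theorem sum_abs_klein (a : Bool) (X : H3) :
    ∑ j, |klein a X j| = (|hx X| + |hy X| + |hz X|) / ht X := by
  rw [← sum_abs_lab a, Finset.sum_div]
  refine Finset.sum_congr rfl fun j _ => ?_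
  rw [klein, abs_div, abs_of_pos (ht_pos X)]

theorem abs_klein_lt_one (a : Bool) (X : H3) (j : Fin 3) : |klein a X j| < 1 := by
  have h := sum_sq_klein_lt a X
  have h2 : klein a X j ^ 2 ≤ ∑ j, klein a X j ^ 2 :=
    Finset.single_le_sum (f := fun j => klein a X j ^ 2) (fun i _ => sq_nonneg _)
      (Finset.mem_univ j)
  exact (sq_lt_one_iff_abs_lt_one _).1 (by linarith)

theorem klein_mem_octa {a : Bool} {X : H3} : klein a X ∈ octa ↔ X ∈ cell := by
  constructor
  · intro h
    have := h.1
    rw [sum_abs_klein, div_le_one (ht_pos X)] at this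
    exact this
  · intro h
    exact ⟨by rw [sum_abs_klein, div_le_one (ht_pos X)]; exact h,
      fun j => (abs_klein_lt_one a X j).ne⟩

/-- The octahedron is inscribed in the unit ball and touches the sphere only at its vertices. -/
theorem sum_sq_lt_of_mem_octa {v : Fin 3 → ℝ} (hv : v ∈ octa) : ∑ j, v j ^ 2 < 1 := by
  obtain ⟨h1, h2⟩ := hv
  rw [Fin.sum_univ_three] at h1 ⊢
  have a0 := abs_nonneg (v 0)
  have a1 := abs_nonneg (v 1)
  have a2 := abs_nonneg (v 2)
  have l0 : |v 0| < 1 := lt_of_le_of_ne (by linarith) (h2 0)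
  have l1 : |v 1| < 1 := lt_of_le_of_ne (by linarith) (h2 1)
  have l2 : |v 2| < 1 := lt_of_le_of_ne (by linarith) (h2 2)
  rw [← sq_abs (v 0), ← sq_abs (v 1), ← sq_abs (v 2)]
  by_cases h : |v 0| + |v 1| + |v 2| < 1
  · nlinarith
  · have h : |v 0| + |v 1| + |v 2| = 1 := by linarith
    rcases eq_or_lt_of_le a0 with z | z
    · rw [← z] at h ⊢
      nlinarith
    · nlinarith [mul_nonneg a1 a2]

theorem exists_klein_of_mem_octa (a : Bool) {v : Fin 3 → ℝ} (hv : v ∈ octa) :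
    ∃ X ∈ cell, klein a X = v := by
  obtain ⟨X, rfl⟩ := exists_klein a (sum_sq_lt_of_mem_octa hv)
  exact ⟨X, klein_mem_octa.1 hv, rfl⟩

/-- The Hermitian matrix is a continuous function of the projective coordinates on the open ball,
which provides a continuous left inverse. -/
theorem isInducing_klein (a : Bool) : IsInducing (klein a) := by
  let B : Set (Fin 3 → ℝ) := {v | ∑ j, v j ^ 2 < 1}
  let f : H3 → B := fun X => ⟨klein a X, sum_sq_klein_lt a X⟩
  let T : B → ℝ := fun v => 1 / √(1 - ∑ j, v.1 j ^ 2)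
  have hc : ∀ j, Continuous fun v : B => v.1 j := fun j =>
    (continuous_apply j).comp continuous_subtype_val
  have hT : Continuous T := by
    refine continuous_const.div ?_ fun v => ?_
    · exact Real.continuous_sqrt.comp
        (continuous_const.sub (continuous_finsetSum _ fun j _ => (hc j).pow 2))
    · have : ∑ j, v.1 j ^ 2 < 1 := v.2
      exact (Real.sqrt_pos.2 (by linarith)).ne'
  let sx : B → ℝ := fun v => if a then -v.1 1 else v.1 1
  let sy : B → ℝ := fun v => if a then v.1 0 else v.1 2
  let sz : B → ℝ := fun v => if a then v.1 2 else -v.1 0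
  have hsx : Continuous sx := by
    cases a
    · exact hc 1
    · exact (hc 1).neg
  have hsy : Continuous sy := by
    cases a
    · exact hc 2
    · exact hc 0
  have hsz : Continuous sz := by
    cases a
    · exact (hc 0).neg
    · exact hc 2
  let g : B → Matrix (Fin 2) (Fin 2) ℂ := fun v =>
    !![((T v + T v * sz v : ℝ) : ℂ), ((T v * sx v : ℝ) : ℂ) + ((T v * sy v : ℝ) : ℂ) * Complex.I;
       ((T v * sx v : ℝ) : ℂ) - ((T v * sy v : ℝ) : ℂ) * Complex.I, ((T v - T v * sz v : ℝ) : ℂ)]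
  have hg : Continuous g := by
    refine continuous_matrix fun i j => ?_
    fin_cases i <;> fin_cases j <;> simp [g] <;> fun_prop
  have hf : Continuous f := (continuous_klein a).subtype_mk _
  have hgf : g ∘ f = fun X : H3 => X.1 := by
    funext X
    have hTX : T (f X) = ht X := (ht_eq_klein a X).symm
    have h1 : T (f X) * sx (f X) = hx X := by
      rw [hTX]; cases a <;> simp [sx, f, klein, lab] <;> field_simp [(ht_pos X).ne']
    have h2 : T (f X) * sy (f X) = hy X := by
      rw [hTX]; cases a <;> simp [sy, f, klein, lab] <;> field_simp [(ht_pos X).ne']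
    have h3 : T (f X) * sz (f X) = hz X := by
      rw [hTX]; cases a <;> simp [sz, f, klein, lab] <;> field_simp [(ht_pos X).ne']
    simp only [Function.comp_apply, g]
    rw [h1, h2, h3, hTX]
    conv_rhs => rw [X.val_eq]
    ext i j
    fin_cases i <;> fin_cases j <;> apply Complex.ext <;> simp
  have hfi : IsInducing f := IsInducing.of_comp hf hg (by rw [hgf]; exact IsInducing.subtypeVal)
  exact IsInducing.subtypeVal.comp hfi

theorem isClosed_cell : IsClosed cell := by
  have h1 := continuous_hx
  have h2 := continuous_hy
  have h3 := continuous_hz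
  have h4 := continuous_ht
  exact isClosed_le (by fun_prop) h4

/-! ### Möbius transformations of ideal points -/

theorem moebius_one (ζ : OnePoint ℂ) : moebius 1 ζ = ζ := by
  simp [moebius]

theorem moebius_mul (g h : SL(2, ℂ)) (ζ : OnePoint ℂ) :
    moebius (g * h) ζ = moebius g (moebius h ζ) := by
  simp [moebius, mul_smul]

/-- Projective form of the equation `moebius g ζ = ζ'`, for a multiple `M` of `g`. -/
theorem moebius_eq_of_proportional {g : SL(2, ℂ)} {M : Matrix (Fin 2) (Fin 2) ℂ} {s : ℂ}
    (hs : s ≠ 0) (hg : g.1 = s • M) (ζ ζ' : OnePoint ℂ) : moebius g ζ = ζ' ↔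
      (M 0 0 * idealVector ζ 0 + M 0 1 * idealVector ζ 1) * idealVector ζ' 1 =
        (M 1 0 * idealVector ζ 0 + M 1 1 * idealVector ζ 1) * idealVector ζ' 0 := by
  have hdet : g.1 0 0 * g.1 1 1 - g.1 0 1 * g.1 1 0 = 1 := by
    rw [← Matrix.det_fin_two]; exact g.2
  have h00 : g.1 0 0 = s * M 0 0 := by rw [hg]; rfl
  have h01 : g.1 0 1 = s * M 0 1 := by rw [hg]; rfl
  have h10 : g.1 1 0 = s * M 1 0 := by rw [hg]; rfl
  have h11 : g.1 1 1 = s * M 1 1 := by rw [hg]; rfl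
  have key : moebius g ζ = ζ' ↔
      (g.1 0 0 * idealVector ζ 0 + g.1 0 1 * idealVector ζ 1) * idealVector ζ' 1 =
        (g.1 1 0 * idealVector ζ 0 + g.1 1 1 * idealVector ζ 1) * idealVector ζ' 0 := by
    have e : ∀ i j, ((g : GL (Fin 2) ℂ) : Matrix (Fin 2) (Fin 2) ℂ) i j = g.1 i j := fun _ _ => rfl
    induction ζ using OnePoint.rec with
    | infty =>
      have hv : idealVector OnePoint.infty = ![1, 0] := rfl
      rw [moebius, OnePoint.smul_infty_eq_ite, e, e]
      induction ζ' using OnePoint.rec with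
      | infty => simp [hv, eq_comm]
      | coe z =>
        have hz : idealVector (z : OnePoint ℂ) = ![z, 1] := rfl
        split_ifs with h
        · have : g.1 0 0 ≠ 0 := by
            intro h0; rw [h, h0] at hdet; simp at hdet
          simp [hv, hz, h, this]
        · rw [OnePoint.coe_eq_coe, div_eq_iff h]
          simp [hv, hz, mul_comm]
    | coe w =>
      have hv : idealVector (w : OnePoint ℂ) = ![w, 1] := rfl
      rw [moebius, OnePoint.smul_some_eq_ite, e, e, e, e]
      induction ζ' using OnePoint.rec with
      | infty =>
        have hv : idealVector OnePoint.infty = ![1, 0] := rfl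
        simp [*, eq_comm]
      | coe z =>
        have hz : idealVector (z : OnePoint ℂ) = ![z, 1] := rfl
        split_ifs with h
        · have : g.1 0 0 * w + g.1 0 1 ≠ 0 := by
            intro h0
            have h1 : g.1 0 0 * (g.1 1 0 * w + g.1 1 1) - g.1 1 0 * (g.1 0 0 * w + g.1 0 1) = 1 := by
              linear_combination hdet
            rw [h, h0] at h1; simp at h1
          simp [hv, hz, h, this]
        · rw [OnePoint.coe_eq_coe, div_eq_iff h]
          simp [hv, hz, mul_comm z]
  rw [key, h00, h01, h10, h11]
  constructor
  · intro h; apply mul_left_cancel₀ hs; linear_combination h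
  · intro h; linear_combination s * h

theorem moebius_eq_iff (g : SL(2, ℂ)) (ζ ζ' : OnePoint ℂ) : moebius g ζ = ζ' ↔
      (g.1 0 0 * idealVector ζ 0 + g.1 0 1 * idealVector ζ 1) * idealVector ζ' 1 =
        (g.1 1 0 * idealVector ζ 0 + g.1 1 1 * idealVector ζ 1) * idealVector ζ' 0 :=
  moebius_eq_of_proportional one_ne_zero (by simp) ζ ζ'

theorem idealVector_infty : idealVector OnePoint.infty = ![1, 0] := rfl

theorem idealVector_coe (z : ℂ) : idealVector (z : OnePoint ℂ) = ![z, 1] := rfl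

theorem idealVector_fin (z : ℂ) : idealVector (fin z) = ![z, 1] := rfl

theorem sl_ext {g h : SL(2, ℂ)} (h00 : g.1 0 0 = h.1 0 0) (h01 : g.1 0 1 = h.1 0 1)
    (h10 : g.1 1 0 = h.1 1 0) (h11 : g.1 1 1 = h.1 1 1) : g = h := by
  apply Subtype.ext
  ext i j
  fin_cases i <;> fin_cases j <;> assumption

theorem sl_det (g : SL(2, ℂ)) : g.1 0 0 * g.1 1 1 - g.1 0 1 * g.1 1 0 = 1 := by
  rw [← Matrix.det_fin_two]; exact g.2

theorem sl_eq_one_or_neg_one {g : SL(2, ℂ)} (h01 : g.1 0 1 = 0) (h10 : g.1 1 0 = 0)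
    (h : g.1 0 0 = g.1 1 1) : g = 1 ∨ g = -1 := by
  have hd := sl_det g
  rw [h01, h] at hd
  have : g.1 1 1 = 1 ∨ g.1 1 1 = -1 := by
    apply mul_self_eq_one_iff.1; linear_combination hd
  rcases this with e | e
  · left; exact sl_ext (by simp [h, e]) (by simp [h01]) (by simp [h10]) (by simp [e])
  · right; exact sl_ext (by simp [h, e]) (by simp [h01]) (by simp [h10]) (by simp [e])

/-- A Möbius transformation with three fixed points is the identity. -/
theorem eq_one_or_neg_one_of_moebius {g : SL(2, ℂ)} {ζ : Fin 3 → OnePoint ℂ}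
    (hζ : Function.Injective ζ) (h : ∀ k, moebius g (ζ k) = ζ k) : g = 1 ∨ g = -1 := by
  have two : ∀ a b : ℂ, a ≠ b → g.1 1 0 = 0 →
      (g.1 0 0 * a + g.1 0 1) * 1 = (g.1 1 0 * a + g.1 1 1) * a →
      (g.1 0 0 * b + g.1 0 1) * 1 = (g.1 1 0 * b + g.1 1 1) * b → g = 1 ∨ g = -1 := by
    intro a b hab hc ha hb
    rw [hc] at ha hb
    have hab' : a - b ≠ 0 := sub_ne_zero.2 hab
    have h1 : g.1 0 0 = g.1 1 1 := by
      apply mul_right_cancel₀ hab'; linear_combination ha - hb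
    refine sl_eq_one_or_neg_one ?_ hc h1
    rw [h1] at ha
    linear_combination ha
  have inf : ∀ i j k : Fin 3, ζ i = OnePoint.infty → j ≠ i → k ≠ i → j ≠ k → g = 1 ∨ g = -1 := by
    intro i j k hi hj hk hjk
    have h0 := (moebius_eq_iff _ _ _).1 (h i)
    have h1 := (moebius_eq_iff _ _ _).1 (h j)
    have h2 := (moebius_eq_iff _ _ _).1 (h k)
    obtain ⟨a, ha⟩ := OnePoint.ne_infty_iff_exists.1 (fun e => hj (hζ (e.trans hi.symm)))
    obtain ⟨b, hb⟩ := OnePoint.ne_infty_iff_exists.1 (fun e => hk (hζ (e.trans hi.symm)))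
    rw [hi] at h0
    rw [← ha] at h1
    rw [← hb] at h2
    simp [idealVector_infty, idealVector_coe] at h0 h1 h2
    refine two a b (fun e => hjk (hζ (by rw [← ha, ← hb, e]))) h0.symm ?_ ?_
    · linear_combination h1
    · linear_combination h2
  by_cases h0 : ζ 0 = OnePoint.infty
  · exact inf 0 1 2 h0 (by decide) (by decide) (by decide)
  by_cases h1 : ζ 1 = OnePoint.infty
  · exact inf 1 0 2 h1 (by decide) (by decide) (by decide)
  by_cases h2 : ζ 2 = OnePoint.infty
  · exact inf 2 0 1 h2 (by decide) (by decide) (by decide)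
  obtain ⟨a, ha⟩ := OnePoint.ne_infty_iff_exists.1 h0
  obtain ⟨b, hb⟩ := OnePoint.ne_infty_iff_exists.1 h1
  obtain ⟨c, hc⟩ := OnePoint.ne_infty_iff_exists.1 h2
  have e0 := (moebius_eq_iff _ _ _).1 (h 0)
  have e1 := (moebius_eq_iff _ _ _).1 (h 1)
  have e2 := (moebius_eq_iff _ _ _).1 (h 2)
  rw [← ha] at e0
  rw [← hb] at e1
  rw [← hc] at e2
  simp [idealVector_coe] at e0 e1 e2
  have hab : a - b ≠ 0 := sub_ne_zero.2 fun e =>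
    absurd (hζ (by rw [← ha, ← hb, e]) : (0 : Fin 3) = 1) (by decide)
  have hbc : b - c ≠ 0 := sub_ne_zero.2 fun e =>
    absurd (hζ (by rw [← hc, ← hb, e]) : (1 : Fin 3) = 2) (by decide)
  have hac : a - c ≠ 0 := sub_ne_zero.2 fun e =>
    absurd (hζ (by rw [← ha, ← hc, e]) : (0 : Fin 3) = 2) (by decide)
  have f1 : g.1 0 0 - g.1 1 1 = g.1 1 0 * (a + b) := by
    apply mul_left_cancel₀ hab; linear_combination e0 - e1
  have f2 : g.1 0 0 - g.1 1 1 = g.1 1 0 * (a + c) := by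
    apply mul_left_cancel₀ hac; linear_combination e0 - e2
  have f3 : g.1 1 0 = 0 := by
    apply mul_left_cancel₀ hbc; linear_combination f2 - f1
  refine two a b (sub_ne_zero.1 hab) f3 ?_ ?_
  · linear_combination e0
  · linear_combination e1

theorem eq_or_eq_neg_of_realizes {n : ℕ} {ζ : Fin n → Fin 4 → OnePoint ℂ} {P : FacePairing n}
    (hP : Function.Injective fun k => ζ P.src (P.srcFace k)) {g h : SL(2, ℂ)}
    (hg : Realizes ζ P g) (hh : Realizes ζ P h) : g = h ∨ g = -h := by
  have : h⁻¹ * g = 1 ∨ h⁻¹ * g = -1 := by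
    refine eq_one_or_neg_one_of_moebius hP fun k => ?_
    rw [moebius_mul, hg k, ← hh k, ← moebius_mul, inv_mul_cancel, moebius_one]
  rcases this with e | e
  · left; exact (inv_mul_eq_one.1 e).symm
  · right; rw [inv_mul_eq_iff_eq_mul] at e; rw [e]; simp

theorem neg_smul_H3 (g : SL(2, ℂ)) (X : H3) : (-g) • X = g • X := by
  apply Subtype.ext
  rw [smul_val, smul_val]
  simp

/-- A projective transformation given by an invertible matrix is given by one of determinant 1. -/
theorem exists_sl_proportional {M : Matrix (Fin 2) (Fin 2) ℂ} (hM : M.det ≠ 0) :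
    ∃ g : SL(2, ℂ), ∃ s : ℂ, s ≠ 0 ∧ g.1 = s • M := by
  obtain ⟨s, hs⟩ := IsAlgClosed.exists_pow_nat_eq (M.det)⁻¹ (n := 2) (by norm_num)
  have hs0 : s ≠ 0 := by
    rintro rfl
    have := inv_ne_zero hM
    rw [← hs] at this; simp at this
  exact ⟨⟨s • M, by rw [Matrix.det_smul]; simp [hs, hM]⟩, s, hs0, rfl⟩

theorem hasShape_of_matrix {ζ : Fin 4 → OnePoint ℂ} {z : ℂ} (a b c d : ℂ) (hdet : a * d - b * c ≠ 0)
    (h0 : a * idealVector (ζ 0) 0 + b * idealVector (ζ 0) 1 = 0)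
    (h1 : c * idealVector (ζ 1) 0 + d * idealVector (ζ 1) 1 = 0)
    (h2 : a * idealVector (ζ 2) 0 + b * idealVector (ζ 2) 1 =
      (c * idealVector (ζ 2) 0 + d * idealVector (ζ 2) 1) * z)
    (h3 : a * idealVector (ζ 3) 0 + b * idealVector (ζ 3) 1 =
      c * idealVector (ζ 3) 0 + d * idealVector (ζ 3) 1) : HasShape ζ z := by
  obtain ⟨g, s, hs, hg⟩ := exists_sl_proportional (M := !![a, b; c, d])
    (by rwa [Matrix.det_fin_two_of])
  refine ⟨g, ?_, ?_, ?_, ?_⟩ <;> rw [moebius_eq_of_proportional hs hg]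
  · simp [idealVector_coe, h0]
  · simp [idealVector_infty, h1]
  · simp [idealVector_coe, h2]
  · simp [idealVector_coe, h3]

/-- Each matrix is a multiple of the Möbius transformation with its zero at the vertex `0`, its pole
at the vertex `1` and the value `1` at the vertex `3`; the value at the vertex `2` is then the
shape. -/
theorem hasShape_vertexTable (t : Fin 8) : HasShape (vertexTable t) (shape t) := by
  have key : ∀ x : ℂ, x.re ≠ 0 ∨ x.im ≠ 0 → x ≠ 0 := by
    rintro x h rfl; simp at h
  fin_cases t
  · refine hasShape_of_matrix 1 Complex.I 0 (1 + Complex.I) (key _ ?_) ?_ ?_ ?_ ?_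
    · norm_num
    all_goals
      apply Complex.ext <;> simp [vertexTable, shape, idealVector_fin, idealVector_infty] <;> norm_num
  · refine hasShape_of_matrix 1 1 0 1 (key _ ?_) ?_ ?_ ?_ ?_
    · norm_num
    all_goals
      apply Complex.ext <;> simp [vertexTable, shape, idealVector_fin, idealVector_infty]
  · refine hasShape_of_matrix 1 Complex.I 0 Complex.I (key _ ?_) ?_ ?_ ?_ ?_
    · norm_num
    all_goals
      apply Complex.ext <;> simp [vertexTable, shape, idealVector_fin, idealVector_infty]
  · refine hasShape_of_matrix 1 0 0 1 (key _ ?_) ?_ ?_ ?_ ?_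
    · norm_num
    all_goals
      apply Complex.ext <;> simp [vertexTable, shape, idealVector_fin, idealVector_infty]
  · refine hasShape_of_matrix (1 + Complex.I) (-Complex.I * (1 + Complex.I)) 1 (-1)
      (key _ ?_) ?_ ?_ ?_ ?_
    · norm_num
    all_goals
      apply Complex.ext <;> simp [vertexTable, shape, idealVector_fin, idealVector_infty] <;> norm_num
  · refine hasShape_of_matrix (1 + Complex.I) (-(1 + Complex.I) * (1 + Complex.I)) 1 (-(1 + 2 * Complex.I))
      (key _ ?_) ?_ ?_ ?_ ?_
    · norm_num
    all_goals
      apply Complex.ext <;> simp [vertexTable, shape, idealVector_fin] <;> norm_num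
  · refine hasShape_of_matrix Complex.I (-Complex.I * (1 + 2 * Complex.I)) 1 (-1)
      (key _ ?_) ?_ ?_ ?_ ?_
    · norm_num
    all_goals
      apply Complex.ext <;> simp [vertexTable, shape, idealVector_fin, idealVector_infty] <;> norm_num
  · refine hasShape_of_matrix (1 + Complex.I) (-(1 + Complex.I) * (1 + Complex.I)) 1 (-1)
      (key _ ?_) ?_ ?_ ?_ ?_
    · norm_num
    all_goals
      apply Complex.ext <;> simp [vertexTable, shape, idealVector_fin] <;> norm_num

theorem HasShape.injective {ζ : Fin 4 → OnePoint ℂ} {z : ℂ} (h : HasShape ζ z) (hz : 0 < z.im) :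
    Function.Injective ζ := by
  obtain ⟨g, h0, h1, h2, h3⟩ := h
  have z0 : z ≠ 0 := by rintro rfl; simp at hz
  have z1 : z ≠ 1 := by rintro rfl; simp at hz
  have : Function.Injective (fun k => moebius g (ζ k)) := by
    intro i j hij
    fin_cases i <;> fin_cases j <;>
      simp [h0, h1, h2, h3, z0, z1, z0.symm, z1.symm] at hij ⊢
  exact fun i j hij => this (congrArg (moebius g) hij)

theorem shape_im_pos (t : Fin 8) : 0 < (shape t).im := by
  fin_cases t <;> simp [shape]

theorem vertexTable_injective (t : Fin 8) : Function.Injective (vertexTable t) :=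
  (hasShape_vertexTable t).injective (shape_im_pos t)

/-! ### The group generated by the face pairings -/

/-- The matrix with the Gaussian integer entries given by their real and imaginary parts. -/
def gaussMat (v : Fin 8 → ℤ) : Matrix (Fin 2) (Fin 2) ℂ :=
  !![⟨v 0, v 1⟩, ⟨v 2, v 3⟩; ⟨v 4, v 5⟩, ⟨v 6, v 7⟩]

/-- The product of Gaussian integer matrices. -/
def gaussMul (v w : Fin 8 → ℤ) : Fin 8 → ℤ :=
  ![v 0 * w 0 - v 1 * w 1 + (v 2 * w 4 - v 3 * w 5), v 0 * w 1 + v 1 * w 0 + (v 2 * w 5 + v 3 * w 4),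
    v 0 * w 2 - v 1 * w 3 + (v 2 * w 6 - v 3 * w 7), v 0 * w 3 + v 1 * w 2 + (v 2 * w 7 + v 3 * w 6),
    v 4 * w 0 - v 5 * w 1 + (v 6 * w 4 - v 7 * w 5), v 4 * w 1 + v 5 * w 0 + (v 6 * w 5 + v 7 * w 4),
    v 4 * w 2 - v 5 * w 3 + (v 6 * w 6 - v 7 * w 7), v 4 * w 3 + v 5 * w 2 + (v 6 * w 7 + v 7 * w 6)]

/-- The adjugate of a Gaussian integer matrix. -/
def gaussAdj (v : Fin 8 → ℤ) : Fin 8 → ℤ :=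
  ![v 6, v 7, -v 2, -v 3, -v 4, -v 5, v 0, v 1]

theorem gaussMat_mul (v w : Fin 8 → ℤ) : gaussMat v * gaussMat w = gaussMat (gaussMul v w) := by
  ext i j
  fin_cases i <;> fin_cases j <;> apply Complex.ext <;>
    simp [gaussMat, gaussMul, Matrix.mul_apply, Fin.sum_univ_two]

theorem gaussMat_adj (v : Fin 8 → ℤ) : (gaussMat v).adjugate = gaussMat (gaussAdj v) := by
  rw [gaussMat, Matrix.adjugate_fin_two_of]
  ext i j
  fin_cases i <;> fin_cases j <;> apply Complex.ext <;> simp [gaussMat, gaussAdj]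

theorem gaussMat_one : gaussMat ![1, 0, 0, 0, 0, 0, 1, 0] = 1 := by
  ext i j
  fin_cases i <;> fin_cases j <;> apply Complex.ext <;> simp [gaussMat]

theorem gaussMat_neg (v : Fin 8 → ℤ) : gaussMat (-v) = -gaussMat v := by
  ext i j
  fin_cases i <;> fin_cases j <;> apply Complex.ext <;> simp [gaussMat]

theorem gaussMat_det (v : Fin 8 → ℤ) : (gaussMat v).det =
    ⟨(v 0 * v 6 - v 1 * v 7 - (v 2 * v 4 - v 3 * v 5) : ℤ),
      (v 0 * v 7 + v 1 * v 6 - (v 2 * v 5 + v 3 * v 4) : ℤ)⟩ := by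
  rw [gaussMat, Matrix.det_fin_two_of]
  apply Complex.ext <;> simp

/-- The entries of the isometries that realize the outer face pairings. -/
def outerInts : Fin 8 → Fin 8 → ℤ :=
  ![![1, 0, 0, 0, 0, 0, 1, 0], ![2, 0, 0, -1, 0, -1, 0, 0], ![1, -1, 0, 1, 0, -1, 1, 1],
    ![1, -2, 1, 1, -1, -1, 1, 0], ![1, 0, 2, 0, 0, 0, 1, 0], ![2, -2, 0, -1, 0, -1, 0, 0],
    ![1, -1, 2, -1, 0, -1, 1, -1], ![3, 0, 1, 1, 1, -1, 1, 0]]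

/-- The isometries that realize the outer face pairings. -/
def outerMat (i : Fin 8) : SL(2, ℂ) :=
  ⟨gaussMat (outerInts i), by
    rw [gaussMat_det]
    have h : outerInts i 0 * outerInts i 6 - outerInts i 1 * outerInts i 7 -
        (outerInts i 2 * outerInts i 4 - outerInts i 3 * outerInts i 5) = 1 ∧
        outerInts i 0 * outerInts i 7 + outerInts i 1 * outerInts i 6 -
        (outerInts i 2 * outerInts i 5 + outerInts i 3 * outerInts i 4) = 0 := by
      revert i; decide
    rw [h.1, h.2]
    apply Complex.ext <;> simp⟩

theorem outerMat_val (i : Fin 8) : (outerMat i).1 = gaussMat (outerInts i) := rfl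

/-- The translation that takes the first octahedron to the second one. -/
def shift : SL(2, ℂ) :=
  ⟨gaussMat ![1, 0, 1, 1, 0, 0, 1, 0], by rw [gaussMat_det]; apply Complex.ext <;> simp⟩

theorem shift_val : shift.1 = gaussMat ![1, 0, 1, 1, 0, 0, 1, 0] := rfl

theorem outerMat_realizes (i : Fin 8) :
    Realizes vertexTable (outerPairings.get (i.cast rfl)) (outerMat i) := by
  intro k
  rw [moebius_eq_iff, outerMat_val]
  fin_cases i <;> fin_cases k <;> apply Complex.ext <;>
    simp [outerPairings, vertexTable, gaussMat, outerInts, idealVector_fin, idealVector_infty] <;>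
    norm_num

/-- The octahedron to which a tetrahedron belongs. -/
def side (t : Fin 8) : Bool := decide (4 ≤ t)

/-- The ideal vertices of the two octahedra. -/
def octPoint : Bool → OctVertex → OnePoint ℂ
  | false, (0, true) => fin 0
  | false, (0, false) => OnePoint.infty
  | false, (1, true) => fin 1
  | false, (1, false) => fin (-1)
  | false, (2, true) => fin Complex.I
  | false, (2, false) => fin (-Complex.I)
  | true, (0, true) => fin (1 + 2 * Complex.I)
  | true, (0, false) => fin 1
  | true, (1, true) => fin Complex.I
  | true, (1, false) => fin (2 + Complex.I)
  | true, (2, true) => OnePoint.infty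
  | true, (2, false) => fin (1 + Complex.I)

/-- The ideal vertices of the tetrahedra depend only on the octahedron and the label. This reduces
all statements about the placement of tetrahedra to decidable ones about labels. -/
theorem vertexTable_eq (t : Fin 8) (i : Fin 4) :
    vertexTable t i = octPoint (side t) (octLabel t i) := by
  fin_cases t <;> fin_cases i <;> rfl

theorem innerPairings_label : ∀ P ∈ innerPairings, (P.src < 4 ↔ P.tgt < 4) ∧
    ∀ k, octLabel P.src (P.srcFace k) = octLabel P.tgt (P.tgtFace k) := by
  decide

theorem innerPairings_side {P : FacePairing 8} (hP : P ∈ innerPairings) :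
    side P.src = side P.tgt := by
  have := (innerPairings_label P hP).1
  simp only [side, decide_eq_decide, ← not_lt]
  rw [this]

theorem innerPairings_vertex {P : FacePairing 8} (hP : P ∈ innerPairings) (k : Fin 3) :
    vertexTable P.src (P.srcFace k) = vertexTable P.tgt (P.tgtFace k) := by
  rw [vertexTable_eq, vertexTable_eq, innerPairings_side hP, (innerPairings_label P hP).2 k]

theorem outerMat_zero : outerMat 0 = 1 := Subtype.ext gaussMat_one

theorem one_realizes {P : FacePairing 8} (hP : P ∈ innerPairings) : Realizes vertexTable P 1 :=
  fun k => by rw [moebius_one, innerPairings_vertex hP]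

theorem exists_outerMat_realizes {P : FacePairing 8} (hP : P ∈ pairings) :
    ∃ i, Realizes vertexTable P (outerMat i) := by
  rcases List.mem_append.1 hP with h | h
  · exact ⟨0, by rw [outerMat_zero]; exact one_realizes h⟩
  · obtain ⟨i, rfl⟩ := List.get_of_mem h
    exact ⟨i.cast rfl, outerMat_realizes (i.cast rfl)⟩

theorem srcFace_injective : ∀ P ∈ pairings, Function.Injective P.srcFace := by
  decide

/-- Three distinct ideal points determine an isometry up to sign. An inner pairing is realized by
the identity, which is also the first of the outer isometries because one outer pair of faces
already coincides. -/
theorem eq_outerMat_of_realizes {P : FacePairing 8} (hP : P ∈ pairings) {g : SL(2, ℂ)}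
    (hg : Realizes vertexTable P g) : ∃ i, g = outerMat i ∨ g = -outerMat i := by
  obtain ⟨i, hi⟩ := exists_outerMat_realizes hP
  exact ⟨i, eq_or_eq_neg_of_realizes
    ((vertexTable_injective _).comp (srcFace_injective P hP)) hg hi⟩

/-- The group generated by the face pairings. -/
abbrev Gam : Subgroup SL(2, ℂ) := facePairingGroup pairings vertexTable

theorem realizes_mem_Gam {P : FacePairing 8} (hP : P ∈ pairings) {g : SL(2, ℂ)}
    (hg : Realizes vertexTable P g) : g ∈ Gam :=
  Subgroup.subset_closure ⟨P, hP, hg⟩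

theorem outerMat_mem (i : Fin 8) : outerMat i ∈ Gam :=
  realizes_mem_Gam (List.mem_append_right _ (List.get_mem _ _)) (outerMat_realizes i)

/-! ### Congruences satisfied by the group of the face pairings. -/

/-- Congruence conditions on the entries of a Gaussian integer matrix, of four types. -/
def ParType : Fin 4 → (Fin 8 → ℤ) → Prop
  | 0, v => v 0 % 2 = 1 ∧ v 1 % 2 = 0 ∧ v 2 % 2 = 0 ∧ v 3 % 2 = 0 ∧
      (v 3 + v 5) % 4 = 0 ∧ (v 0 + v 6) % 4 = 2 ∧ (v 1 + v 7) % 4 = 0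
  | 1, v => v 0 % 2 = 0 ∧ v 1 % 2 = 0 ∧ v 2 % 2 = 0 ∧ v 3 % 2 = 1 ∧
      (v 2 + v 4) % 4 = 0 ∧ (v 3 + v 5) % 4 = 2 ∧ (v 0 + v 6) % 4 = 2
  | 2, v => v 0 % 2 = 1 ∧ v 1 % 2 = 0 ∧ v 2 % 2 = 1 ∧ v 3 % 2 = 1 ∧
      (v 3 + v 5) % 4 = 0 ∧ (v 0 + v 6 + v 2 + v 4) % 4 = 2 ∧ (v 1 + v 7 + v 2 + v 4) % 4 = 2
  | 3, v => v 0 % 2 = 1 ∧ v 1 % 2 = 1 ∧ v 2 % 2 = 0 ∧ v 3 % 2 = 1 ∧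
      (v 0 + v 6) % 4 = 2 ∧ (v 1 + v 3 + v 5 + v 7) % 4 = 0 ∧ (v 2 + v 3 + v 4 + v 5) % 4 = 0

/-- The congruence conditions satisfied by the elements of the group of the face pairings. -/
def Par (τ : Fin 4) (v : Fin 8 → ℤ) : Prop :=
  ((v 0 - v 6) % 2 = 0 ∧ (v 1 - v 7) % 2 = 0 ∧ (v 2 - v 4) % 2 = 0 ∧ (v 3 - v 5) % 2 = 0) ∧
    ParType τ v

/-- The multiplication of the types of congruence conditions. -/
def parMul : Fin 4 → Fin 4 → Fin 4 :=
  ![![0, 1, 2, 3], ![1, 0, 3, 2], ![2, 3, 0, 1], ![3, 2, 1, 0]]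

theorem Par.neg {τ : Fin 4} {v : Fin 8 → ℤ} (h : Par τ v) : Par τ (-v) := by
  obtain ⟨⟨q0, q1, q2, q3⟩, h⟩ := h
  fin_cases τ <;> obtain ⟨h0, h1, h2, h3, h4, h5, h6⟩ := h <;>
    refine ⟨⟨?_, ?_, ?_, ?_⟩, ?_, ?_, ?_, ?_, ?_, ?_, ?_⟩ <;> simp only [Pi.neg_apply] <;> omega

/-- Generators of the group of the face pairings. -/
def genInts : Fin 5 → Fin 8 → ℤ :=
  ![![1, 0, 2, 0, 0, 0, 1, 0], ![1, 0, 0, 0, 2, 0, 1, 0], ![2, 0, 0, -1, 0, -1, 0, 0],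
    ![1, -1, 0, 1, 0, -1, 1, 1], ![1, -2, 1, 1, -1, -1, 1, 0]]

/-- The types of the generators. -/
def genType : Fin 5 → Fin 4 := ![0, 0, 1, 3, 2]

/-- Solving the congruences by free integers makes the entries of a product with a fixed generator
linear forms in them, so that each congruence for the product is checked by linear integer
arithmetic. -/
theorem Par.exists_eq {τ : Fin 4} {v : Fin 8 → ℤ} (h : Par τ v) : ∃ a b c d e f g k : ℤ, v = ![
    ![1 + 2 * a, 2 * b, 2 * c, 2 * d, 2 * c + 2 * e, 4 * f - 2 * d, 4 * g + 1 - 2 * a,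
      4 * k - 2 * b],
    ![2 * a, 2 * b, 2 * c, 1 + 2 * d, 4 * e - 2 * c, 4 * f + 1 - 2 * d, 4 * g + 2 - 2 * a, 2 * k],
    ![1 + 2 * a, 2 * b, 1 + 2 * c, 1 + 2 * d, 1 + 2 * c + 2 * e, 4 * f - 1 - 2 * d,
      4 * g - 1 - 2 * a - 4 * c - 2 * e, 4 * k - 2 * b - 4 * c - 2 * e],
    ![1 + 2 * a, 1 + 2 * b, 2 * c, 1 + 2 * d, 4 * f - 2 * c - 2 - 2 * d - 2 * e, 1 + 2 * e,
      4 * g + 1 - 2 * a, 4 * k - 3 - 2 * b - 2 * d - 2 * e]] τ := by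
  obtain ⟨⟨q0, q1, q2, q3⟩, h⟩ := h
  fin_cases τ <;> obtain ⟨h0, h1, h2, h3, h4, h5, h6⟩ := h
  · refine ⟨v 0 / 2, v 1 / 2, v 2 / 2, v 3 / 2, (v 4 - v 2) / 2, (v 3 + v 5) / 4,
      (v 0 + v 6) / 4, (v 1 + v 7) / 4, ?_⟩
    ext i; fin_cases i <;> simp <;> omega
  · refine ⟨v 0 / 2, v 1 / 2, v 2 / 2, v 3 / 2, (v 2 + v 4) / 4, (v 3 + v 5) / 4,
      (v 0 + v 6) / 4, v 7 / 2, ?_⟩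
    ext i; fin_cases i <;> simp <;> omega
  · refine ⟨v 0 / 2, v 1 / 2, v 2 / 2, v 3 / 2, (v 4 - v 2) / 2, (v 3 + v 5) / 4,
      (v 0 + v 6 + v 2 + v 4) / 4, (v 1 + v 7 + v 2 + v 4) / 4, ?_⟩
    ext i; fin_cases i <;> simp <;> omega
  · refine ⟨v 0 / 2, v 1 / 2, v 2 / 2, v 3 / 2, v 5 / 2, (v 2 + v 3 + v 4 + v 5) / 4,
      (v 0 + v 6) / 4, (v 1 + v 3 + v 5 + v 7) / 4, ?_⟩
    ext i; fin_cases i <;> simp <;> omega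

-- The four types multiply like the Klein four-group. It suffices to multiply by generators on the
-- right, since the group is explored by `closure_induction_right`.
set_option maxHeartbeats 2000000 in
theorem Par.mul_gen {τ : Fin 4} {v : Fin 8 → ℤ} (h : Par τ v) (i : Fin 5) :
    Par (parMul τ (genType i)) (gaussMul v (genInts i)) := by
  obtain ⟨a, b, c, d, e, f, g, k, rfl⟩ := h.exists_eq
  clear h
  fin_cases τ <;> fin_cases i <;> simp only [gaussMul, genInts, Par, ParType, parMul, genType,
    Matrix.cons_val, Fin.reduceFinMk, Fin.zero_eta, Fin.mk_one, Fin.isValue] <;>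
    refine ⟨⟨?_, ?_, ?_, ?_⟩, ?_, ?_, ?_, ?_, ?_, ?_, ?_⟩ <;> omega

set_option maxHeartbeats 2000000 in
theorem Par.mul_gen_adj {τ : Fin 4} {v : Fin 8 → ℤ} (h : Par τ v) (i : Fin 5) :
    Par (parMul τ (genType i)) (gaussMul v (gaussAdj (genInts i))) := by
  obtain ⟨a, b, c, d, e, f, g, k, rfl⟩ := h.exists_eq
  clear h
  fin_cases τ <;> fin_cases i <;> simp only [gaussMul, gaussAdj, genInts, Par, ParType, parMul, genType,
    Matrix.cons_val, Fin.reduceFinMk, Fin.zero_eta, Fin.mk_one, Fin.isValue] <;>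
    refine ⟨⟨?_, ?_, ?_, ?_⟩, ?_, ?_, ?_, ?_, ?_, ?_, ?_⟩ <;> omega

/-- Generators of the group of the face pairings. -/
def genMat (i : Fin 5) : SL(2, ℂ) :=
  ⟨gaussMat (genInts i), by
    rw [gaussMat_det]
    have h : genInts i 0 * genInts i 6 - genInts i 1 * genInts i 7 -
        (genInts i 2 * genInts i 4 - genInts i 3 * genInts i 5) = 1 ∧
        genInts i 0 * genInts i 7 + genInts i 1 * genInts i 6 -
        (genInts i 2 * genInts i 5 + genInts i 3 * genInts i 4) = 0 := by
      revert i; decide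
    rw [h.1, h.2]
    apply Complex.ext <;> simp⟩

theorem genMat_val (i : Fin 5) : (genMat i).1 = gaussMat (genInts i) := rfl

theorem outerMat_eq_mul {i : Fin 8} {j k : Fin 5}
    (h : outerInts i = gaussMul (genInts j) (genInts k)) : outerMat i = genMat j * genMat k := by
  apply Subtype.ext
  rw [Matrix.SpecialLinearGroup.coe_mul, genMat_val, genMat_val, gaussMat_mul, ← h]
  rfl

theorem outerMat_eq {i : Fin 8} {j : Fin 5} (h : outerInts i = genInts j) :
    outerMat i = genMat j := by
  apply Subtype.ext
  rw [genMat_val, ← h]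
  rfl

theorem outerMat_mem_closure (i : Fin 8) :
    outerMat i ∈ Subgroup.closure (Set.range genMat) := by
  have hg : ∀ j, genMat j ∈ Subgroup.closure (Set.range genMat) :=
    fun j => Subgroup.subset_closure ⟨j, rfl⟩
  fin_cases i
  · exact outerMat_zero ▸ one_mem _
  · exact outerMat_eq (i := 1) (j := 2) (by decide) ▸ hg 2
  · exact outerMat_eq (i := 2) (j := 3) (by decide) ▸ hg 3
  · exact outerMat_eq (i := 3) (j := 4) (by decide) ▸ hg 4
  · exact outerMat_eq (i := 4) (j := 0) (by decide) ▸ hg 0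
  · exact outerMat_eq_mul (i := 5) (j := 0) (k := 2) (by decide) ▸ mul_mem (hg 0) (hg 2)
  · exact outerMat_eq_mul (i := 6) (j := 3) (k := 0) (by decide) ▸ mul_mem (hg 3) (hg 0)
  · exact outerMat_eq_mul (i := 7) (j := 4) (k := 1) (by decide) ▸ mul_mem (hg 4) (hg 1)

theorem exists_par_of_mem_closure {g : SL(2, ℂ)}
    (hg : g ∈ Subgroup.closure (Set.range genMat ∪ {-1})) :
    ∃ τ v, g.1 = gaussMat v ∧ Par τ v := by
  induction hg using Subgroup.closure_induction_right with
  | one => exact ⟨0, _, gaussMat_one.symm, by simp [Par, ParType]⟩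
  | mul_right x y hx hy ih =>
    obtain ⟨τ, v, hv, hp⟩ := ih
    rcases hy with ⟨i, rfl⟩ | rfl
    · exact ⟨_, _, by rw [Matrix.SpecialLinearGroup.coe_mul, hv, genMat_val, gaussMat_mul],
        hp.mul_gen i⟩
    · exact ⟨_, _, by rw [mul_neg_one, Matrix.SpecialLinearGroup.coe_neg, hv, ← gaussMat_neg],
        hp.neg⟩
  | mul_inv_cancel x y hx hy ih =>
    obtain ⟨τ, v, hv, hp⟩ := ih
    rcases hy with ⟨i, rfl⟩ | rfl
    · exact ⟨_, _, by rw [Matrix.SpecialLinearGroup.coe_mul, Matrix.SpecialLinearGroup.coe_inv, hv,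
        genMat_val, gaussMat_adj, gaussMat_mul], hp.mul_gen_adj i⟩
    · exact ⟨_, _, by rw [inv_neg, inv_one, mul_neg_one, Matrix.SpecialLinearGroup.coe_neg, hv,
        ← gaussMat_neg], hp.neg⟩

theorem exists_par {g : SL(2, ℂ)} (hg : g ∈ Gam) : ∃ τ v, g.1 = gaussMat v ∧ Par τ v := by
  refine exists_par_of_mem_closure ?_
  refine (Subgroup.closure_le _).2 ?_ hg
  rintro g ⟨P, hP, hg⟩
  have h1 : -1 ∈ Subgroup.closure (Set.range genMat ∪ {-1}) :=
    Subgroup.subset_closure (Or.inr rfl)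
  obtain ⟨i, rfl | rfl⟩ := eq_outerMat_of_realizes hP hg
  · exact Subgroup.closure_mono Set.subset_union_left (outerMat_mem_closure i)
  · have := mul_mem h1 (Subgroup.closure_mono Set.subset_union_left (outerMat_mem_closure i))
    rwa [neg_one_mul] at this

/-! ### Freeness of the action and inequivalence of the two centers. -/

/-- An element of `SL(2, ℂ)` that fixes the origin is unitary. -/
theorem unitary_of_smul_origin {g : SL(2, ℂ)} (h : g • origin = origin) :
    g.1 1 1 = star (g.1 0 0) ∧ g.1 0 1 = -star (g.1 1 0) := by
  have h1 : g.1 * g.1ᴴ = 1 := by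
    have := congrArg Subtype.val h
    rw [smul_val] at this
    simpa [origin] using this
  have h2 : g.1ᴴ = g.1.adjugate := by
    have h3 : g.1.adjugate * g.1 = 1 := by
      rw [Matrix.adjugate_mul, g.2, one_smul]
    calc g.1ᴴ = (g.1.adjugate * g.1) * g.1ᴴ := by rw [h3, one_mul]
      _ = g.1.adjugate := by rw [mul_assoc, h1, mul_one]
  rw [Matrix.adjugate_fin_two] at h2
  have e := fun i j => congrFun (congrFun h2 i) j
  have e0 := e 0 0
  have e1 := e 0 1
  simp [Matrix.conjTranspose_apply] at e0 e1
  refine ⟨by simp [e0], by simp [e1]⟩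

theorem exists_eq_smul_origin (X : H3) : ∃ h : SL(2, ℂ), X = h • origin := by
  obtain ⟨g, h0, h1, h2, h3⟩ := exists_smul_origin (ht_pos X) X.det_eq
  exact ⟨g, H3.ext_coord h0.symm h1.symm h2.symm h3.symm⟩

/-- The trace of an elliptic element or of the identity. -/
theorem trace_of_smul_eq {g : SL(2, ℂ)} {X : H3} (h : g • X = X) :
    (g.1 0 0 + g.1 1 1).im = 0 ∧ |(g.1 0 0 + g.1 1 1).re| ≤ 2 ∧
      (|(g.1 0 0 + g.1 1 1).re| = 2 → g = 1 ∨ g = -1) := by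
  obtain ⟨k, rfl⟩ := exists_eq_smul_origin X
  -- Conjugation preserves the trace and makes the element unitary, with `a`, `c` in its first
  -- column and the trace `2 Re a`; since `|a|² + |c|² = 1`, extremal trace forces `c = 0` and `a =
  -- ± 1`.
  have hu : (k⁻¹ * g * k) • origin = origin := by
    rw [mul_smul, mul_smul, h, inv_smul_smul]
  set u := k⁻¹ * g * k with hu'
  have htr : g.1 0 0 + g.1 1 1 = u.1 0 0 + u.1 1 1 := by
    rw [← Matrix.trace_fin_two, ← Matrix.trace_fin_two, hu', Matrix.SpecialLinearGroup.coe_mul,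
      Matrix.trace_mul_comm, ← Matrix.SpecialLinearGroup.coe_mul,
      show k * (k⁻¹ * g) = g from mul_inv_cancel_left k g]
  obtain ⟨h1, h2⟩ := unitary_of_smul_origin hu
  have hd := sl_det u
  rw [h1, h2] at hd
  have hd' := congrArg Complex.re hd
  simp at hd'
  rw [htr, h1]
  set a := u.1 0 0
  set c := u.1 1 0
  have e : (a + star a).re = 2 * a.re := by simp; ring
  rw [e]
  refine ⟨by simp, ?_, ?_⟩
  · rw [abs_le]; constructor <;> nlinarith [sq_nonneg a.im, sq_nonneg c.re, sq_nonneg c.im]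
  · intro h
    have h4 : (2 * a.re) ^ 2 = 4 := by rw [← sq_abs, h]; norm_num
    have i0 : a.im = 0 := by
      apply pow_eq_zero_iff two_ne_zero |>.1; nlinarith [sq_nonneg a.im, sq_nonneg c.re, sq_nonneg c.im]
    have i1 : c.re = 0 := by
      apply pow_eq_zero_iff two_ne_zero |>.1; nlinarith [sq_nonneg a.im, sq_nonneg c.re, sq_nonneg c.im]
    have i2 : c.im = 0 := by
      apply pow_eq_zero_iff two_ne_zero |>.1; nlinarith [sq_nonneg a.im, sq_nonneg c.re, sq_nonneg c.im]
    have hc : c = 0 := Complex.ext i1 i2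
    have hu1 : u = 1 ∨ u = -1 := sl_eq_one_or_neg_one (by rw [h2]; simp [c] at hc ⊢; exact hc) hc
      (by rw [h1]; apply Complex.ext <;> simp [a] at i0 ⊢; linarith)
    have hg : g = k * u * k⁻¹ := by rw [hu']; group
    rw [hg]
    rcases hu1 with e | e <;> rw [e] <;> simp

/-- The group of the face pairings acts freely, up to the sign. -/
theorem eq_one_or_neg_one_of_smul_eq {g : SL(2, ℂ)} (hg : g ∈ Gam) {X : H3} (h : g • X = X) :
    g = 1 ∨ g = -1 := by
  obtain ⟨τ, v, hv, hp⟩ := exists_par hg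
  have hd := g.2
  rw [hv, gaussMat_det] at hd
  have hre := congrArg Complex.re hd
  have him := congrArg Complex.im hd
  simp only [Complex.one_re, Complex.one_im] at hre him
  norm_cast at hre him
  obtain ⟨h1, h2, h3⟩ := trace_of_smul_eq h
  have e : g.1 0 0 + g.1 1 1 = ⟨((v 0 + v 6 : ℤ) : ℝ), ((v 1 + v 7 : ℤ) : ℝ)⟩ := by
    rw [hv]; apply Complex.ext <;> simp [gaussMat]
  rw [e] at h1 h2 h3
  simp only at h1 h2 h3
  norm_cast at h1 h2 h3
  rw [abs_le] at h2
  apply h3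
  -- In the types `0`, `1`, `3` the real part of the trace is `2` modulo `4`, hence `± 2` as its
  -- absolute value is at most `2`. Type `2` forces the trace to be zero and must be excluded.
  have key : v 0 + v 6 = 2 ∨ v 0 + v 6 = -2 := by
    obtain ⟨⟨q0, q1, q2, q3⟩, hp⟩ := hp
    fin_cases τ <;> obtain ⟨p0, p1, p2, p3, p4, p5, p6⟩ := hp
    · omega
    · omega
    · exfalso
      have s0 : v 6 = -v 0 := by omega
      have s1 : v 7 = -v 1 := by omega
      obtain ⟨a, ha⟩ : ∃ a, v 0 = 1 + 2 * a := ⟨v 0 / 2, by omega⟩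
      obtain ⟨b, hb⟩ : ∃ b, v 1 = 2 * b := ⟨v 1 / 2, by omega⟩
      obtain ⟨f, hf⟩ : ∃ f, v 2 = 1 + 2 * f := ⟨v 2 / 2, by omega⟩
      obtain ⟨k, hk⟩ : ∃ k, v 3 = 1 + 2 * k := ⟨v 3 / 2, by omega⟩
      obtain ⟨m, hm⟩ : ∃ m, v 5 = -v 3 + 4 * m := ⟨(v 5 + v 3) / 4, by omega⟩
      obtain ⟨n, hn⟩ : ∃ n, v 4 = 2 - v 2 + 4 * n := ⟨(v 4 + v 2 - 2) / 4, by omega⟩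
      rw [s0, s1, hm, hn, ha, hb, hf, hk] at hre him
      -- The halved real and imaginary parts of the determinant equation give, modulo `2`, `1 + b +
      -- f + n + m` and `b + f + n + m` both even, a contradiction. Products of consecutive integers
      -- and squares are replaced by their parities, and the remaining products occur only doubled.
      have r1 : -1 - a * (a + 1) + b * b + f * f - n - 2 * (f * n) - k * (k + 1) + m +
        2 * (k * m) = 0 := by linarith
      have t1 := Int.even_mul_succ_self a
      have t2 := Int.even_mul_succ_self k
      have t3 := Int.even_mul_pred_self b
      have t4 := Int.even_mul_pred_self f
      obtain ⟨t1, u1⟩ := t1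
      obtain ⟨t2, u2⟩ := t2
      obtain ⟨t3, u3⟩ := t3
      obtain ⟨t4, u4⟩ := t4
      have u3' : b * b = b + (t3 + t3) := by linarith
      have u4' : f * f = f + (t4 + t4) := by linarith
      have r2' : b + m - f + n + 2 * (a * b - f * k + f * m + k * n) = 0 := by linarith
      rw [u1, u2, u3', u4'] at r1
      generalize a * b - f * k + f * m + k * n = X at r2'
      generalize f * n = Y at r1
      generalize k * m = Z at r1
      omega
    · omega
  rcases key with h | h <;> rw [h] <;> norm_num

/-- The centers of the two octahedra are not equivalent. -/
theorem smul_shift_origin_ne {g : SL(2, ℂ)} (hg : g ∈ Gam) : (g * shift) • origin ≠ origin := by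
  intro h
  obtain ⟨τ, v, hv, hp⟩ := exists_par hg
  obtain ⟨h1, h2⟩ := unitary_of_smul_origin h
  rw [Matrix.SpecialLinearGroup.coe_mul, hv, shift_val, gaussMat_mul] at h1 h2
  simp [gaussMat, gaussMul, Complex.ext_iff] at h1 h2
  obtain ⟨h1, h1'⟩ := h1
  obtain ⟨h2, h2'⟩ := h2
  norm_cast at h1 h1' h2 h2'
  obtain ⟨⟨q0, q1, q2, q3⟩, hp⟩ := hp
  fin_cases τ <;> obtain ⟨p0, p1, p2, p3, p4, p5, p6⟩ := hp <;> omega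

/-! ### The octahedra and their neighbours -/

/-- The sign of a vertex on an axis. -/
def sgn (b : Bool) : ℝ := if b then 1 else -1

theorem sgn_mul_self (b : Bool) : sgn b * sgn b = 1 := by cases b <;> simp [sgn]

theorem sgn_eq (b : Bool) : sgn b = 1 ∨ sgn b = -1 := by cases b <;> simp [sgn]

/-- The faces of the octahedron, in the order of the outer pairings. -/
def faceBool : Fin 8 → Fin 3 → Bool :=
  ![![false, true, true], ![true, true, true], ![false, true, false], ![true, true, false],
    ![false, false, true], ![true, false, true], ![false, false, false], ![true, false, false]]

/-- The signs of the coordinates on a face. -/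
def eps (i : Fin 8) (j : Fin 3) : ℝ := sgn (faceBool i j)

theorem faceBool_surjective : ∀ b : Fin 3 → Bool, ∃ i, faceBool i = b := by decide

theorem eps_mul_self (i : Fin 8) (j : Fin 3) : eps i j * eps i j = 1 := sgn_mul_self _

theorem eps_eq (i : Fin 8) (j : Fin 3) : eps i j = 1 ∨ eps i j = -1 := sgn_eq _

theorem exists_eps {e : Fin 3 → ℝ} (he : ∀ j, e j = 1 ∨ e j = -1) : ∃ i, eps i = e := by
  obtain ⟨i, hi⟩ := faceBool_surjective fun j => decide (e j = 1)
  refine ⟨i, funext fun j => ?_⟩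
  rw [eps, hi]
  rcases he j with h | h <;> simp [sgn, h]
  norm_num

theorem coord_smul {g : SL(2, ℂ)} {v : Fin 8 → ℤ} (hg : g.1 = gaussMat v) (X : H3) :
    ht (g • X) = ((v 0 ^ 2 + v 1 ^ 2 + v 4 ^ 2 + v 5 ^ 2) * (ht X + hz X) +
        (v 2 ^ 2 + v 3 ^ 2 + v 6 ^ 2 + v 7 ^ 2) * (ht X - hz X)) / 2 +
        (v 0 * v 2 + v 1 * v 3 + v 4 * v 6 + v 5 * v 7) * hx X +
        (v 0 * v 3 - v 1 * v 2 + v 4 * v 7 - v 5 * v 6) * hy X ∧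
    hx (g • X) = (v 0 * v 4 + v 1 * v 5) * (ht X + hz X) + (v 2 * v 6 + v 3 * v 7) * (ht X - hz X) +
        (v 0 * v 6 + v 1 * v 7 + v 2 * v 4 + v 3 * v 5) * hx X +
        (v 0 * v 7 - v 1 * v 6 - v 2 * v 5 + v 3 * v 4) * hy X ∧
    hy (g • X) = (v 1 * v 4 - v 0 * v 5) * (ht X + hz X) + (v 3 * v 6 - v 2 * v 7) * (ht X - hz X) +
        (v 1 * v 6 - v 0 * v 7 + v 3 * v 4 - v 2 * v 5) * hx X +
        (v 0 * v 6 + v 1 * v 7 - v 2 * v 4 - v 3 * v 5) * hy X ∧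
    hz (g • X) = ((v 0 ^ 2 + v 1 ^ 2 - v 4 ^ 2 - v 5 ^ 2) * (ht X + hz X) +
        (v 2 ^ 2 + v 3 ^ 2 - v 6 ^ 2 - v 7 ^ 2) * (ht X - hz X)) / 2 +
        (v 0 * v 2 + v 1 * v 3 - v 4 * v 6 - v 5 * v 7) * hx X +
        (v 0 * v 3 - v 1 * v 2 - v 4 * v 7 + v 5 * v 6) * hy X := by
  have e := smul_entry g X
  have e00 := e 0 0
  have e01 := e 0 1
  have e11 := e 1 1
  rw [hg] at e00 e01 e11
  have r00 := congrArg Complex.re e00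
  have r11 := congrArg Complex.re e11
  have r01 := congrArg Complex.re e01
  have i01 := congrArg Complex.im e01
  simp [gaussMat] at r00 r11 r01 i01
  refine ⟨?_, ?_, ?_, ?_⟩
  · rw [ht, r00, r11]; ring
  · rw [hx, r01]; ring
  · rw [hy, i01]; ring
  · rw [hz, r00, r11]; ring

/-- The Minkowski product of `X` with the image of the origin. -/
theorem ht_inv_smul (m : SL(2, ℂ)) (a : Bool) (X : H3) :
    ht (m⁻¹ • X) = ht (m • origin) * ht X - ∑ j, lab a (m • origin) j * lab a X j := by
  have e := smul_entry m origin
  have e00 := congrArg Complex.re (e 0 0)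
  have e11 := congrArg Complex.re (e 1 1)
  have e01 := congrArg Complex.re (e 0 1)
  have f01 := congrArg Complex.im (e 0 1)
  have h := smul_entry m⁻¹ X
  have h00 := congrArg Complex.re (h 0 0)
  have h11 := congrArg Complex.re (h 1 1)
  have hm : m⁻¹.1 = !![m.1 1 1, -m.1 0 1; -m.1 1 0, m.1 0 0] := by
    rw [Matrix.SpecialLinearGroup.coe_inv, Matrix.adjugate_fin_two]
  rw [hm] at h00 h11
  rw [ht_origin, hx_origin, hy_origin, hz_origin] at e00 e11 e01 f01
  simp at e00 e11 e01 f01 h00 h11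
  have hs : ∑ j, lab a (m • origin) j * lab a X j = hx (m • origin) * hx X +
      hy (m • origin) * hy X + hz (m • origin) * hz X := by
    cases a <;> simp [lab, Fin.sum_univ_three] <;> ring
  rw [hs]
  unfold ht hx hy hz at *
  rw [e00, e11, e01, f01, h00, h11]
  ring

/-- The position of an octahedron relative to the first octahedron. -/
def frame (a : Bool) : SL(2, ℂ) := if a then shift else 1

/-- The isometry from the first octahedron to its neighbour across a face. -/
def nbr (i : Fin 8) : SL(2, ℂ) := (outerMat i)⁻¹ * shift

theorem nbr_inv_val (i : Fin 8) :
    ((nbr i)⁻¹).1 = gaussMat (gaussMul ![1, 0, -1, -1, 0, 0, 1, 0] (outerInts i)) := by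
  have h : (nbr i)⁻¹ = shift⁻¹ * outerMat i := by rw [nbr, mul_inv_rev, inv_inv]
  rw [h, Matrix.SpecialLinearGroup.coe_mul, Matrix.SpecialLinearGroup.coe_inv, shift_val,
    gaussMat_adj, outerMat_val, gaussMat_mul]
  congr 2

/-- On the face `∑ ε n = t` the correction terms vanish, and what remains is the cyclic permutation
of the axes that preserves the signs of the face: the rotation used in `FaceGlue`. -/
theorem nbr_inv_coord (i : Fin 8) (X : H3) :
    ht ((nbr i)⁻¹ • X) = 2 * ht X - ∑ j, eps i j * lab false X j ∧
    ∀ j, lab true ((nbr i)⁻¹ • X) j = eps i j * eps i (j + 1) * lab false X (j + 1) +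
      eps i j * (ht X - ∑ j, eps i j * lab false X j) := by
  obtain ⟨h0, h1, h2, h3⟩ := coord_smul (nbr_inv_val i) X
  constructor
  · rw [h0]
    fin_cases i <;> simp [gaussMul, outerInts, eps, sgn, faceBool, lab, Fin.sum_univ_three] <;> ring
  · intro j
    fin_cases j <;> simp only [lab] <;> simp [h1, h2, h3] <;>
    fin_cases i <;> simp [gaussMul, outerInts, eps, sgn, faceBool, Fin.sum_univ_three] <;> ring

/-- The isometry from an octahedron of a given kind to its neighbour across a face. -/
def nbrOf (a : Bool) (i : Fin 8) : SL(2, ℂ) := if a then (nbr i)⁻¹ else nbr i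

theorem sum_eps_shift (i : Fin 8) (n : Fin 3 → ℝ) (c : ℝ) :
    ∑ j, eps i j * (eps i j * eps i (j + 1) * n (j + 1) + eps i j * c) =
      ∑ j, eps i j * n j + 3 * c := by
  have h : ∀ j, eps i j * (eps i j * eps i (j + 1) * n (j + 1) + eps i j * c) =
      eps i (j + 1) * n (j + 1) + c := fun j => by
    linear_combination (eps i (j + 1) * n (j + 1) + c) * eps_mul_self i j
  simp only [h, Fin.sum_univ_three]
  simp only [zero_add, Fin.reduceAdd]
  ring

theorem nbr_coord (i : Fin 8) (Y : H3) :
    ht (nbr i • Y) = 2 * ht Y - ∑ j, eps i j * lab true Y j ∧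
    ∀ j, lab false (nbr i • Y) (j + 1) = eps i j * eps i (j + 1) * lab true Y j +
      eps i (j + 1) * (ht Y - ∑ j, eps i j * lab true Y j) := by
  obtain ⟨h0, h1⟩ := nbr_inv_coord i (nbr i • Y)
  rw [inv_smul_smul] at h0 h1
  have h2 : ∑ j, eps i j * lab true Y j = 3 * ht (nbr i • Y) -
      2 * ∑ j, eps i j * lab false (nbr i • Y) j := by
    simp only [h1]
    rw [sum_eps_shift]; ring
  refine ⟨by linarith, fun j => ?_⟩
  have e : ht Y - ∑ j, eps i j * lab true Y j =
      -(ht (nbr i • Y) - ∑ j, eps i j * lab false (nbr i • Y) j) := by linarith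
  rw [e, h1 j]
  linear_combination (-lab false (nbr i • Y) (j + 1) * eps i (j + 1) ^ 2 - eps i (j + 1) *
    (ht (nbr i • Y) - ∑ j, eps i j * lab false (nbr i • Y) j)) * eps_mul_self i j -
    lab false (nbr i • Y) (j + 1) * eps_mul_self i (j + 1)

theorem lab_origin (a : Bool) : lab a origin = 0 := by
  ext j
  cases a <;> fin_cases j <;> simp [lab, hx_origin, hy_origin, hz_origin]

theorem nbrOf_origin (a : Bool) (i : Fin 8) :
    ht (nbrOf a i • origin) = 2 ∧ lab a (nbrOf a i • origin) = eps i := by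
  cases a
  · obtain ⟨h0, h1⟩ := nbr_coord i origin
    simp only [lab_origin, ht_origin, Pi.zero_apply, mul_zero, Finset.sum_const_zero, sub_zero,
      mul_one, zero_add] at h0 h1
    refine ⟨h0, funext fun j => ?_⟩
    have := h1 (j + 2)
    rwa [show j + 2 + 1 = j by fin_cases j <;> rfl] at this
  · obtain ⟨h0, h1⟩ := nbr_inv_coord i origin
    simp only [lab_origin, ht_origin, Pi.zero_apply, mul_zero, Finset.sum_const_zero, sub_zero,
      mul_one, zero_add] at h0 h1
    exact ⟨h0, funext h1⟩

/-- The points equally far from the center and from that of the neighbour satisfy `2 t - ∑ ε n = t`: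
the bisecting plane is the plane of the face. -/
theorem ht_nbrOf_inv (a : Bool) (i : Fin 8) (X : H3) :
    ht ((nbrOf a i)⁻¹ • X) = 2 * ht X - ∑ j, eps i j * lab a X j := by
  rw [ht_inv_smul _ a, (nbrOf_origin a i).1, (nbrOf_origin a i).2]

theorem mem_cell_iff (a : Bool) (X : H3) : X ∈ cell ↔ ∑ j, |lab a X j| ≤ ht X := by
  rw [sum_abs_lab]; rfl

theorem abs_eq_eps_mul {i : Fin 8} {n : Fin 3 → ℝ} {t : ℝ} (h : ∑ j, |n j| ≤ t)
    (hs : ∑ j, eps i j * n j = t) (j : Fin 3) : |n j| = eps i j * n j := by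
  have hle : ∀ j, eps i j * n j ≤ |n j| := fun j => by
    rcases eps_eq i j with e | e <;> rw [e]
    · rw [one_mul]; exact le_abs_self _
    · rw [neg_one_mul]; exact neg_le_abs _
  have := (Finset.sum_eq_sum_iff_of_le fun j _ => hle j).1
    (le_antisymm (Finset.sum_le_sum fun j _ => hle j) (by rw [hs]; exact h))
  exact (this j (Finset.mem_univ j)).symm

theorem abs_eps (i : Fin 8) (j : Fin 3) : |eps i j| = 1 := by
  rcases eps_eq i j with e | e <;> rw [e] <;> simp

/-- Corresponding points on a face of an octahedron of the first kind and the adjacent one. -/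
theorem faceGlue_of_face {i : Fin 8} {X : H3} (hX : X ∈ cell)
    (hs : ∑ j, eps i j * lab false X j = ht X) :
    (nbr i)⁻¹ • X ∈ cell ∧ FaceGlue (false, klein false X) (true, klein true ((nbr i)⁻¹ • X)) := by
  obtain ⟨h0, h1⟩ := nbr_inv_coord i X
  rw [hs] at h0 h1
  have h0 : ht ((nbr i)⁻¹ • X) = ht X := by rw [h0]; ring
  have ha := abs_eq_eps_mul ((mem_cell_iff false X).1 hX) hs
  simp only [sub_self, mul_zero, add_zero] at h1
  have hp := ht_pos X
  have hb : ∀ j, |klein false X j| = eps i j * klein false X j := fun j => by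
    rw [klein, abs_div, ha j, abs_of_pos hp, mul_div_assoc]
  refine ⟨?_, fun j => |klein false X j|, eps i, fun j => abs_nonneg _, ?_,
    fun j => (abs_klein_lt_one false X j).ne, eps_eq i, ?_, ?_⟩
  · rw [mem_cell_iff true, h0]
    have := (mem_cell_iff false X).1 hX
    simp only [h1, abs_mul, abs_eps, one_mul]
    rw [Fin.sum_univ_three] at this ⊢
    simp only [zero_add, Fin.reduceAdd]
    linarith
  · simp only [hb]
    simp only [klein, ← mul_div_assoc]
    rw [← Finset.sum_div, hs, div_self hp.ne']
  · congr 1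
    ext j
    simp only [hb]
    linear_combination -klein false X j * eps_mul_self i j
  · congr 1
    ext j
    simp only [hb]
    rw [klein, klein, h0, h1]
    ring

/-- The two octahedra along a face induce the same map on it. For the second kind the claim is that
for the first kind, applied to the transported point. -/
theorem theta_face (a : Bool) {i : Fin 8} {X : H3} (hX : X ∈ cell)
    (hs : ∑ j, eps i j * lab a X j = ht X) : (nbrOf a i)⁻¹ • X ∈ cell ∧
      theta (!a) (klein (!a) ((nbrOf a i)⁻¹ • X)) = theta a (klein a X) := by
  cases a
  · obtain ⟨h1, h2⟩ := faceGlue_of_face hX hs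
    exact ⟨h1, (theta_eq_of_faceGlue h2).symm⟩
  · have hi : (nbrOf true i)⁻¹ = nbr i := inv_inv _
    rw [hi]
    obtain ⟨h0, h1⟩ := nbr_coord i X
    rw [hs] at h0 h1
    have h0 : ht (nbr i • X) = ht X := by rw [h0]; ring
    simp only [sub_self, mul_zero, add_zero] at h1
    have hm : nbr i • X ∈ cell := by
      rw [mem_cell_iff false, h0]
      have := (mem_cell_iff true X).1 hX
      have e : ∀ j, |lab false (nbr i • X) (j + 1)| = |lab true X j| := fun j => by
        rw [h1, abs_mul, abs_mul, abs_eps, abs_eps, one_mul, one_mul]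
      have e0 := e 0
      have e1 := e 1
      have e2 := e 2
      simp only [zero_add, Fin.reduceAdd] at e0 e1 e2
      rw [Fin.sum_univ_three] at this ⊢
      linarith
    have hs' : ∑ j, eps i j * lab false (nbr i • X) j = ht (nbr i • X) := by
      have e : ∀ j, eps i (j + 1) * lab false (nbr i • X) (j + 1) = eps i j * lab true X j :=
        fun j => by
          rw [h1]; linear_combination eps i j * lab true X j * eps_mul_self i (j + 1)
      have e0 := e 0
      have e1 := e 1
      have e2 := e 2
      simp only [zero_add, Fin.reduceAdd] at e0 e1 e2
      rw [h0, ← hs, Fin.sum_univ_three, Fin.sum_univ_three]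
      linarith
    obtain ⟨_, h3⟩ := faceGlue_of_face hm hs'
    rw [inv_smul_smul] at h3
    exact ⟨hm, theta_eq_of_faceGlue h3⟩

theorem abs_le_of_hyperboloid {τ : ℤ} {α : Fin 3 → ℤ} (hτ : 0 < τ)
    (h : τ ^ 2 - ∑ j, α j ^ 2 = 1) (j : Fin 3) : |α j| ≤ τ - 1 := by
  have h1 : α j ^ 2 ≤ ∑ j, α j ^ 2 :=
    Finset.single_le_sum (f := fun j => α j ^ 2) (fun i _ => sq_nonneg _) (Finset.mem_univ j)
  have h2 : |α j| < τ := abs_lt_of_sq_lt_sq (by linarith) hτ.le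
  omega

theorem mul_le_of_hyperboloid {τ : ℤ} {α : Fin 3 → ℤ} (hτ : 0 < τ)
    (h : τ ^ 2 - ∑ j, α j ^ 2 = 1) (x : ℝ) (j : Fin 3) : (α j : ℝ) * x ≤ (τ - 1) * |x| := by
  have h1 : |(α j : ℝ)| ≤ τ - 1 := by exact_mod_cast abs_le_of_hyperboloid hτ h j
  calc (α j : ℝ) * x ≤ |(α j : ℝ) * x| := le_abs_self _
    _ = |(α j : ℝ)| * |x| := abs_mul _ _
    _ ≤ (τ - 1) * |x| := mul_le_mul_of_nonneg_right h1 (abs_nonneg _)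

/-- The octahedron lies in the Dirichlet domain of its center among integral points. -/
theorem sum_mul_le {n : Fin 3 → ℝ} {t : ℝ} (hn : ∑ j, |n j| ≤ t) {τ : ℤ} {α : Fin 3 → ℤ}
    (hτ : 0 < τ) (h : τ ^ 2 - ∑ j, α j ^ 2 = 1) : ∑ j, (α j : ℝ) * n j ≤ (τ - 1) * t := by
  have h1 : (0 : ℝ) ≤ τ - 1 := by
    have : (1 : ℝ) ≤ τ := by exact_mod_cast hτ
    linarith
  calc ∑ j, (α j : ℝ) * n j ≤ ∑ j, (τ - 1) * |n j| :=
        Finset.sum_le_sum fun j _ => mul_le_of_hyperboloid hτ h (n j) j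
    _ = (τ - 1) * ∑ j, |n j| := by rw [Finset.mul_sum]
    _ ≤ (τ - 1) * t := mul_le_mul_of_nonneg_left hn h1

/-- Integral points whose Dirichlet domain meets the octahedron. -/
theorem exists_sign_of_sum_mul_eq {n : Fin 3 → ℝ} {t : ℝ} (hn : ∑ j, |n j| ≤ t)
    (ht0 : t ^ 2 - ∑ j, n j ^ 2 = 1) {τ : ℤ} {α : Fin 3 → ℤ}
    (hτ : 2 ≤ τ) (h : τ ^ 2 - ∑ j, α j ^ 2 = 1) (heq : ∑ j, (α j : ℝ) * n j = (τ - 1) * t) :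
    ∃ e : Fin 3 → ℝ, (∀ j, e j = 1 ∨ e j = -1) ∧ ∑ j, e j * n j = t ∧
      ((τ = 2 ∧ ∀ j, (α j : ℝ) = e j) ∨ (τ = 3 ∧ ∑ j, e j * α j = 4)) := by
  have hτ0 : 0 < τ := by omega
  have h1 : (0 : ℝ) < τ - 1 := by
    have : (2 : ℝ) ≤ τ := by exact_mod_cast hτ
    linarith
  have hle := fun j => mul_le_of_hyperboloid hτ0 h (n j) j
  have hsum : ∑ j, |n j| = t := by
    refine le_antisymm hn (le_of_mul_le_mul_left ?_ h1)
    rw [← heq, Finset.mul_sum]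
    exact Finset.sum_le_sum fun j _ => hle j
  -- Equality of the sums forces equality in every summand, so `|α j| = τ - 1` wherever `n j ≠ 0`.
  have hj : ∀ j, (α j : ℝ) * n j = (τ - 1) * |n j| := by
    have := (Finset.sum_eq_sum_iff_of_le fun j (_ : j ∈ Finset.univ) => hle j).1
      (by rw [heq, ← hsum, Finset.mul_sum])
    exact fun j => this j (Finset.mem_univ j)
  have hex : ∀ j, ∃ e : ℝ, (e = 1 ∨ e = -1) ∧ e * n j = |n j| ∧ e * α j = |α j| ∧
      (n j ≠ 0 → |α j| = τ - 1) := by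
    intro j
    have hjj := hj j
    rcases lt_trichotomy (n j) 0 with hneg | hz | hpos
    · rw [abs_of_neg hneg] at hjj
      have : (α j : ℝ) = -(τ - 1) := by
        apply mul_right_cancel₀ hneg.ne; linarith
      have hα : α j = -(τ - 1) := by exact_mod_cast this
      have hab : |α j| = τ - 1 := by rw [hα, abs_neg, abs_of_pos]; omega
      refine ⟨-1, Or.inr rfl, by rw [abs_of_neg hneg]; ring, ?_, fun _ => hab⟩
      rw [hab, this]; push_cast; ring
    · rcases le_total 0 (α j) with h0 | h0
      · exact ⟨1, Or.inl rfl, by simp [hz], by rw [abs_of_nonneg h0]; simp, fun h => (h hz).elim⟩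
      · exact ⟨-1, Or.inr rfl, by simp [hz], by rw [abs_of_nonpos h0]; simp,
          fun h => (h hz).elim⟩
    · rw [abs_of_pos hpos] at hjj
      have : (α j : ℝ) = τ - 1 := mul_right_cancel₀ hpos.ne' hjj
      have hα : α j = τ - 1 := by exact_mod_cast this
      have hab : |α j| = τ - 1 := by rw [hα, abs_of_pos]; omega
      refine ⟨1, Or.inl rfl, by rw [abs_of_pos hpos]; ring, ?_, fun _ => hab⟩
      rw [hab, this]; push_cast; ring
  choose e he hen heα hne using hex
  refine ⟨e, he, by simp only [hen, hsum], ?_⟩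
  have hb : ∀ j, |α j| ≤ τ - 1 := abs_le_of_hyperboloid hτ0 h
  have hb0 : ∀ j, 0 ≤ |α j| := fun j => abs_nonneg _
  have hsq : |α 0| ^ 2 + |α 1| ^ 2 + |α 2| ^ 2 = τ ^ 2 - 1 := by
    rw [Fin.sum_univ_three] at h
    simp only [sq_abs]; linarith
  have hα : ∀ j, |α j| = 1 → (α j : ℝ) = e j := fun j h1 => by
    have h2 := heα j
    rw [h1] at h2
    push_cast at h2
    rcases he j with h | h <;> rw [h] at h2 ⊢ <;> linarith
  -- With at most one nonzero coordinate and `∑ |n j| = t` the point would be light-like, an ideal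
  -- vertex.
  have two : (n 0 ≠ 0 ∧ n 1 ≠ 0) ∨ (n 1 ≠ 0 ∧ n 2 ≠ 0) ∨ (n 0 ≠ 0 ∧ n 2 ≠ 0) := by
    rw [Fin.sum_univ_three] at ht0 hsum
    by_contra hcon
    have h3 : (n 0 = 0 ∧ n 1 = 0) ∨ (n 1 = 0 ∧ n 2 = 0) ∨ (n 0 = 0 ∧ n 2 = 0) := by tauto
    rcases h3 with ⟨h3, h4⟩ | ⟨h3, h4⟩ | ⟨h3, h4⟩ <;> simp [h3, h4] at ht0 hsum <;>
      rw [← hsum, sq_abs] at ht0 <;> simp at ht0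
  -- With two coordinates equal to `τ - 1` the third satisfies `z² = (τ - 1)(3 - τ)`, which leaves
  -- only `τ = 2` and `τ = 3`.
  have fin : ∀ x y z : ℤ, x = τ - 1 → y = τ - 1 → 0 ≤ z → x ^ 2 + y ^ 2 + z ^ 2 = τ ^ 2 - 1 →
      (τ = 2 ∧ x = 1 ∧ y = 1 ∧ z = 1) ∨ (τ = 3 ∧ x + y + z = 4) := by
    intro x y z hx hy hz hq
    rw [hx, hy] at hq
    have h3 : τ ≤ 3 := by nlinarith [sq_nonneg z]
    have : τ = 2 ∨ τ = 3 := by omega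
    rcases this with rfl | rfl
    · left
      have hz2 : z ^ 2 = 1 := by linarith
      have : z = 1 := by nlinarith
      omega
    · right
      have hz2 : z ^ 2 = 0 := by linarith
      have : z = 0 := pow_eq_zero_iff two_ne_zero |>.1 hz2
      omega
  have fin2 : (τ = 2 ∧ |α 0| = 1 ∧ |α 1| = 1 ∧ |α 2| = 1) ∨
      (τ = 3 ∧ |α 0| + |α 1| + |α 2| = 4) := by
    rcases two with ⟨h3, h4⟩ | ⟨h3, h4⟩ | ⟨h3, h4⟩
    · exact fin _ _ _ (hne 0 h3) (hne 1 h4) (hb0 2) hsq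
    · have := fin _ _ _ (hne 1 h3) (hne 2 h4) (hb0 0) (by linarith)
      omega
    · have := fin _ _ _ (hne 0 h3) (hne 2 h4) (hb0 1) (by linarith)
      omega
  rcases fin2 with ⟨h2, a0, a1, a2⟩ | ⟨h3, h4⟩
  · left
    refine ⟨h2, fun j => hα j ?_⟩
    fin_cases j <;> assumption
  · right
    refine ⟨h3, ?_⟩
    simp only [heα, Fin.sum_univ_three]
    exact_mod_cast h4

/-! ### The tessellation of hyperbolic space by octahedra -/

/-- The isometries that take the first octahedron to the octahedra of a given kind in the
tessellation of hyperbolic space. -/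
def IsTile (a : Bool) (k : SL(2, ℂ)) : Prop := ∃ γ ∈ Gam, k = γ * frame a

theorem isTile_frame (a : Bool) : IsTile a (frame a) := ⟨1, one_mem _, (one_mul _).symm⟩

theorem isTile_one : IsTile false 1 := isTile_frame false

theorem IsTile.smul {a : Bool} {k γ : SL(2, ℂ)} (hγ : γ ∈ Gam) (h : IsTile a k) :
    IsTile a (γ * k) := by
  obtain ⟨δ, hδ, rfl⟩ := h
  exact ⟨γ * δ, mul_mem hγ hδ, (mul_assoc _ _ _).symm⟩

theorem IsTile.nbr {a : Bool} {k : SL(2, ℂ)} (h : IsTile a k) (i : Fin 8) :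
    IsTile (!a) (k * nbrOf a i) := by
  obtain ⟨γ, hγ, rfl⟩ := h
  cases a
  · refine ⟨γ * (outerMat i)⁻¹, mul_mem hγ (inv_mem (outerMat_mem i)), ?_⟩
    simp [nbrOf, Borromean.nbr, frame, mul_assoc]
  · refine ⟨γ * outerMat i, mul_mem hγ (outerMat_mem i), ?_⟩
    simp [nbrOf, Borromean.nbr, frame, mul_assoc]

/-- Parity condition for Gaussian integer matrices. -/
def EvenInts (v : Fin 8 → ℤ) : Prop :=
  (v 0 + v 1 + v 6 + v 7) % 2 = 0 ∧ (v 2 + v 3 + v 4 + v 5) % 2 = 0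

theorem Par.evenInts {τ : Fin 4} {v : Fin 8 → ℤ} (h : Par τ v) : EvenInts v := by
  obtain ⟨⟨q0, q1, q2, q3⟩, -⟩ := h
  constructor <;> omega

theorem EvenInts.mul_shift {v : Fin 8 → ℤ} (h : EvenInts v) :
    EvenInts (gaussMul v ![1, 0, 1, 1, 0, 0, 1, 0]) := by
  obtain ⟨h0, h1⟩ := h
  constructor <;> simp only [gaussMul, Matrix.cons_val] <;> omega

theorem EvenInts.shift_inv_mul {v : Fin 8 → ℤ} (h : EvenInts v) :
    EvenInts (gaussMul (gaussAdj ![1, 0, 1, 1, 0, 0, 1, 0]) v) := by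
  obtain ⟨h0, h1⟩ := h
  constructor <;> simp only [gaussMul, gaussAdj, Matrix.cons_val] <;> omega

theorem exists_evenInts {a a' : Bool} {k k' : SL(2, ℂ)} (h : IsTile a k) (h' : IsTile a' k') :
    ∃ v, (k⁻¹ * k').1 = gaussMat v ∧ EvenInts v := by
  obtain ⟨γ, hγ, rfl⟩ := h
  obtain ⟨γ', hγ', rfl⟩ := h'
  obtain ⟨τ, v, hv, hp⟩ := exists_par (mul_mem (inv_mem hγ) hγ')
  have hr : ∃ w, (γ⁻¹ * γ' * frame a').1 = gaussMat w ∧ EvenInts w := by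
    cases a'
    · exact ⟨v, by simpa [frame] using hv, hp.evenInts⟩
    · exact ⟨_, by rw [Matrix.SpecialLinearGroup.coe_mul, hv, frame, if_pos rfl, shift_val,
        gaussMat_mul], hp.evenInts.mul_shift⟩
  obtain ⟨w, hw, hp⟩ := hr
  have e : (γ * frame a)⁻¹ * (γ' * frame a') = (frame a)⁻¹ * (γ⁻¹ * γ' * frame a') := by group
  rw [e]
  cases a
  · exact ⟨w, by simpa [frame] using hw, hp⟩
  · exact ⟨_, by rw [Matrix.SpecialLinearGroup.coe_mul, hw, frame, if_pos rfl,
      Matrix.SpecialLinearGroup.coe_inv, shift_val, gaussMat_adj, gaussMat_mul], hp.shift_inv_mul⟩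

/-- The first and last Minkowski coordinates are half sums of squares with signs; squares have the
parity of their entries, so the parity condition makes these integral. -/
theorem exists_int_coord {m : SL(2, ℂ)} {v : Fin 8 → ℤ} (hm : m.1 = gaussMat v) (hv : EvenInts v)
    (a : Bool) : ∃ (τ : ℤ) (α : Fin 3 → ℤ), ht (m • origin) = τ ∧
      ∀ j, lab a (m • origin) j = α j := by
  obtain ⟨e0, e1, e2, e3⟩ := coord_smul hm origin
  rw [ht_origin, hx_origin, hy_origin, hz_origin] at e0 e1 e2 e3
  have hsq : ∀ k, ∃ s, v k * v k = v k + 2 * s := fun k => by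
    obtain ⟨s, hs⟩ := Int.even_mul_pred_self (v k)
    exact ⟨s, by linarith⟩
  choose s hs using hsq
  obtain ⟨p, q⟩ := hv
  obtain ⟨T, hT⟩ : ∃ T, v 0 ^ 2 + v 1 ^ 2 + v 4 ^ 2 + v 5 ^ 2 +
      (v 2 ^ 2 + v 3 ^ 2 + v 6 ^ 2 + v 7 ^ 2) = 2 * T := by
    refine ⟨(v 0 + v 1 + v 6 + v 7) / 2 + (v 2 + v 3 + v 4 + v 5) / 2 + s 0 + s 1 + s 2 + s 3 +
      s 4 + s 5 + s 6 + s 7, ?_⟩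
    simp only [sq, hs]
    omega
  obtain ⟨Z, hZ⟩ : ∃ Z, v 0 ^ 2 + v 1 ^ 2 - v 4 ^ 2 - v 5 ^ 2 +
      (v 2 ^ 2 + v 3 ^ 2 - v 6 ^ 2 - v 7 ^ 2) = 2 * Z := by
    refine ⟨T - v 4 ^ 2 - v 5 ^ 2 - v 6 ^ 2 - v 7 ^ 2, ?_⟩
    linarith
  have hT' : (v 0 ^ 2 + v 1 ^ 2 + v 4 ^ 2 + v 5 ^ 2 +
      (v 2 ^ 2 + v 3 ^ 2 + v 6 ^ 2 + v 7 ^ 2) : ℝ) = 2 * T := by exact_mod_cast hT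
  have hZ' : (v 0 ^ 2 + v 1 ^ 2 - v 4 ^ 2 - v 5 ^ 2 +
      (v 2 ^ 2 + v 3 ^ 2 - v 6 ^ 2 - v 7 ^ 2) : ℝ) = 2 * Z := by exact_mod_cast hZ
  have f0 : ht (m • origin) = T := by rw [e0]; linarith
  have f3 : hz (m • origin) = Z := by rw [e3]; linarith
  have f1 : hx (m • origin) = (v 0 * v 4 + v 1 * v 5 + (v 2 * v 6 + v 3 * v 7) : ℤ) := by
    rw [e1]; push_cast; ring
  have f2 : hy (m • origin) = (v 1 * v 4 - v 0 * v 5 + (v 3 * v 6 - v 2 * v 7) : ℤ) := by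
    rw [e2]; push_cast; ring
  generalize v 0 * v 4 + v 1 * v 5 + (v 2 * v 6 + v 3 * v 7) = x at f1
  generalize v 1 * v 4 - v 0 * v 5 + (v 3 * v 6 - v 2 * v 7) = y at f2
  cases a
  · refine ⟨T, ![-Z, x, y], f0, fun j => ?_⟩
    fin_cases j <;> simp [lab, f1, f2, f3]
  · refine ⟨T, ![y, -x, Z], f0, fun j => ?_⟩
    fin_cases j <;> simp [lab, f1, f2, f3]

/-- The center of a second octahedron, seen from a first one, as an integral vector. -/
theorem exists_center {a a' : Bool} {k k' : SL(2, ℂ)} (h : IsTile a k) (h' : IsTile a' k') :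
    ∃ (τ : ℤ) (α : Fin 3 → ℤ), ht ((k⁻¹ * k') • origin) = τ ∧
      (∀ j, lab a ((k⁻¹ * k') • origin) j = α j) ∧ 0 < τ ∧ τ ^ 2 - ∑ j, α j ^ 2 = 1 := by
  obtain ⟨v, hv, hp⟩ := exists_evenInts h h'
  obtain ⟨τ, α, h0, h1⟩ := exists_int_coord hv hp a
  refine ⟨τ, α, h0, h1, ?_, ?_⟩
  · have := ht_pos ((k⁻¹ * k') • origin)
    rw [h0] at this
    exact_mod_cast this
  · have := sum_sq_lab a ((k⁻¹ * k') • origin)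
    simp only [h0, h1] at this
    have h2 : ∑ j, α j ^ 2 = τ ^ 2 - 1 := by exact_mod_cast this
    linarith

theorem ht_inv_smul_of_center {a : Bool} {k k' : SL(2, ℂ)} {τ : ℤ} {α : Fin 3 → ℤ}
    (h0 : ht ((k⁻¹ * k') • origin) = τ) (h1 : ∀ j, lab a ((k⁻¹ * k') • origin) j = α j) (X : H3) :
    ht (k'⁻¹ • X) = τ * ht (k⁻¹ • X) - ∑ j, (α j : ℝ) * lab a (k⁻¹ • X) j := by
  have e : k'⁻¹ • X = (k⁻¹ * k')⁻¹ • k⁻¹ • X := by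
    rw [smul_smul]; congr 1; group
  rw [e, ht_inv_smul _ a, h0]
  simp only [h1]

/-- Points of an octahedron are closer to its center than to the other centers. -/
theorem ht_le_of_mem_cell {a a' : Bool} {k k' : SL(2, ℂ)} (h : IsTile a k) (h' : IsTile a' k')
    {X : H3} (hX : k⁻¹ • X ∈ cell) : ht (k⁻¹ • X) ≤ ht (k'⁻¹ • X) := by
  obtain ⟨τ, α, h0, h1, hτ, hs⟩ := exists_center h h'
  rw [ht_inv_smul_of_center h0 h1]
  have := sum_mul_le ((mem_cell_iff a _).1 hX) hτ hs
  linarith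

/-- The kinds agree because the two centers are inequivalent, and the isometries agree up to sign
because the action is free. -/
theorem tile_eq_of_smul_origin {a a' : Bool} {k k' : SL(2, ℂ)} (h : IsTile a k)
    (h' : IsTile a' k') (he : k • origin = k' • origin) : a = a' ∧ (k' = k ∨ k' = -k) := by
  obtain ⟨γ, hγ, rfl⟩ := h
  obtain ⟨γ', hγ', rfl⟩ := h'
  have fix : ∀ a, (γ * frame a) • origin = (γ' * frame a) • origin →
      γ' * frame a = γ * frame a ∨ γ' * frame a = -(γ * frame a) := fun a h => by
    have h1 : (γ⁻¹ * γ') • (frame a • origin) = frame a • origin := by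
      rw [mul_smul, ← mul_smul γ', ← h, mul_smul, inv_smul_smul]
    rcases eq_one_or_neg_one_of_smul_eq (mul_mem (inv_mem hγ) hγ') h1 with h2 | h2
    · left; rw [← inv_mul_eq_one.1 h2]
    · right
      rw [inv_mul_eq_iff_eq_mul, mul_neg_one] at h2
      rw [h2, neg_mul]
  cases a <;> cases a'
  · exact ⟨rfl, fix false he⟩
  · exfalso
    refine smul_shift_origin_ne (mul_mem (inv_mem hγ) hγ') ?_
    have : γ • origin = (γ' * shift) • origin := by simpa [frame] using he
    rw [mul_assoc, mul_smul, ← this, inv_smul_smul]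
  · exfalso
    refine smul_shift_origin_ne (mul_mem (inv_mem hγ') hγ) ?_
    have : (γ * shift) • origin = γ' • origin := by simpa [frame] using he
    rw [mul_assoc, mul_smul, this, inv_smul_smul]
  · exact ⟨rfl, fix true he⟩

/-- The map to the complement of the rings on an octahedron of the tessellation. -/
def tileMap (a : Bool) (k : SL(2, ℂ)) (X : H3) : OnePoint Space3 := theta a (klein a (k⁻¹ • X))

theorem tileMap_eq_of_smul_origin {a a' : Bool} {k k' : SL(2, ℂ)} (h : IsTile a k)
    (h' : IsTile a' k') (he : k • origin = k' • origin) (X : H3) :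
    tileMap a k X = tileMap a' k' X := by
  obtain ⟨rfl, rfl | rfl⟩ := tile_eq_of_smul_origin h h' he
  · rfl
  · rw [tileMap, tileMap, inv_neg, neg_smul_H3]

theorem tileMap_nbr {a : Bool} {k : SL(2, ℂ)} {i : Fin 8} {X : H3} (hX : k⁻¹ • X ∈ cell)
    (hs : ∑ j, eps i j * lab a (k⁻¹ • X) j = ht (k⁻¹ • X)) :
    (k * nbrOf a i)⁻¹ • X ∈ cell ∧ tileMap (!a) (k * nbrOf a i) X = tileMap a k X := by
  rw [tileMap, tileMap, mul_inv_rev, mul_smul]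
  exact theta_face a hX hs

/-- A common point is equally far from both centers. At `τ = 1` the octahedra coincide; at `τ = 2`
they are neighbours across a face; the case `τ = 3` is reduced to `τ = 2` by crossing a face that
contains the point. -/
theorem tile_dichotomy {a a' : Bool} {k k' : SL(2, ℂ)} (h : IsTile a k) (h' : IsTile a' k')
    {X : H3} (hX : k⁻¹ • X ∈ cell) (hX' : k'⁻¹ • X ∈ cell) :
    tileMap a k X = tileMap a' k' X ∨ ht (k⁻¹ • k' • origin) = 3 ∧
      ∃ i, ht ((k * nbrOf a i)⁻¹ • k' • origin) = 2 ∧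
      (k * nbrOf a i)⁻¹ • X ∈ cell ∧ tileMap (!a) (k * nbrOf a i) X = tileMap a k X := by
  obtain ⟨τ, α, h0, h1, hτ, hs⟩ := exists_center h h'
  have e0 : k • (k⁻¹ * k') • origin = k' • origin := by rw [smul_smul, mul_inv_cancel_left]
  by_cases hτ1 : τ = 1
  · left
    refine tileMap_eq_of_smul_origin h h' ?_ X
    rw [← e0]
    congr 1
    have hz : ∀ j, α j = 0 := fun j => by
      have := abs_le_of_hyperboloid hτ hs j
      rw [hτ1] at this
      simpa using this
    refine coord_of_lab (a := a) (by rw [h0, hτ1, ht_origin]; simp) ?_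
    ext j
    rw [h1, hz, lab_origin]; simp
  · have heq := le_antisymm (ht_le_of_mem_cell h h' hX) (ht_le_of_mem_cell h' h hX')
    rw [ht_inv_smul_of_center h0 h1] at heq
    obtain ⟨e, he, hen, hc⟩ := exists_sign_of_sum_mul_eq ((mem_cell_iff a _).1 hX)
      (by rw [sum_sq_lab]; ring) (by omega) hs (by linarith)
    obtain ⟨i, rfl⟩ := exists_eps he
    obtain ⟨hm, hv⟩ := tileMap_nbr hX hen
    rcases hc with ⟨hτ2, hα⟩ | ⟨hτ3, hα⟩
    · left
      rw [← hv]
      refine tileMap_eq_of_smul_origin (h.nbr i) h' ?_ X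
      rw [← e0, mul_smul]
      congr 1
      obtain ⟨n0, n1⟩ := nbrOf_origin a i
      refine coord_of_lab (a := a) (by rw [n0, h0, hτ2]; simp) ?_
      ext j
      rw [n1, h1, hα]
    · right
      refine ⟨by rw [smul_smul, h0, hτ3]; norm_num, i, ?_, hm, hv⟩
      -- Seen from the neighbour, the time coordinate of the center is `2 · 3 - 4 = 2`.
      rw [mul_inv_rev, mul_smul, smul_smul k⁻¹, ht_nbrOf_inv, h0, hτ3]
      simp only [h1, hα]
      norm_num

/-- The maps on the octahedra of the tessellation agree on their intersections. -/
theorem tileMap_eq {a a' : Bool} {k k' : SL(2, ℂ)} (h : IsTile a k) (h' : IsTile a' k')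
    {X : H3} (hX : k⁻¹ • X ∈ cell) (hX' : k'⁻¹ • X ∈ cell) : tileMap a k X = tileMap a' k' X := by
  rcases tile_dichotomy h h' hX hX' with e | ⟨-, i, h2, hm, hv⟩
  · exact e
  · rw [← hv]
    rcases tile_dichotomy (h.nbr i) h' hm hX' with e | ⟨h3, -⟩
    · exact e
    -- After crossing the face the time coordinate is `2`, so the alternative with `3` cannot occur
    -- again.
    · rw [h2] at h3; norm_num at h3

/-! ### The covering -/

/-- A matrix `X` of determinant one satisfies `2 t X = X² + 1` by Cayley–Hamilton, so for a row `ρ`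
the difference of the two sides is the squared norm of `ρ X`. -/
theorem sq_row_le (X : H3) (a b c d : ℝ) : a ^ 2 + b ^ 2 + c ^ 2 + d ^ 2 ≤
    2 * ht X * ((a ^ 2 + b ^ 2) * (ht X + hz X) + (c ^ 2 + d ^ 2) * (ht X - hz X) +
      2 * ((a * c + b * d) * hx X + (a * d - b * c) * hy X)) := by
  have h := X.det_eq
  set t := ht X
  set x := hx X
  set y := hy X
  set z := hz X
  have e : 2 * t * ((a ^ 2 + b ^ 2) * (t + z) + (c ^ 2 + d ^ 2) * (t - z) +
      2 * ((a * c + b * d) * x + (a * d - b * c) * y)) - (a ^ 2 + b ^ 2 + c ^ 2 + d ^ 2) =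
      (a * (t + z) + c * x + d * y) ^ 2 + (b * (t + z) + d * x - c * y) ^ 2 +
      (a * x - b * y + c * (t - z)) ^ 2 + (a * y + b * x + d * (t - z)) ^ 2 := by
    linear_combination (a ^ 2 + b ^ 2 + c ^ 2 + d ^ 2) * h
  have : 0 ≤ (a * (t + z) + c * x + d * y) ^ 2 + (b * (t + z) + d * x - c * y) ^ 2 +
      (a * x - b * y + c * (t - z)) ^ 2 + (a * y + b * x + d * (t - z)) ^ 2 := by positivity
  linarith

/-- The entries of an integral matrix are bounded in terms of its displacement. -/
theorem sq_entry_le {g : SL(2, ℂ)} {v : Fin 8 → ℤ} (hg : g.1 = gaussMat v) (X : H3) (k : Fin 8) :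
    (v k : ℝ) ^ 2 ≤ 4 * ht X * ht (g • X) := by
  have h1 := sq_row_le X (v 0) (v 1) (v 2) (v 3)
  have h2 := sq_row_le X (v 4) (v 5) (v 6) (v 7)
  have h3 : ∑ k, (v k : ℝ) ^ 2 ≤ 4 * ht X * ht (g • X) := by
    rw [(coord_smul hg X).1]
    simp only [Fin.sum_univ_eight]
    linarith
  exact (Finset.single_le_sum (f := fun k => (v k : ℝ) ^ 2) (fun i _ => sq_nonneg _)
    (Finset.mem_univ k)).trans h3

/-- Bounded displacement bounds the integral entries of `k⁻¹`; this is the discreteness of the set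
of tiles. -/
theorem finite_tiles (R : ℝ) :
    {k : SL(2, ℂ) | (∃ a, IsTile a k) ∧ ∃ X, ht X ≤ R ∧ ht (k⁻¹ • X) ≤ R}.Finite := by
  let N : ℤ := ⌈4 * R * R⌉ + 1
  have hf : {v : Fin 8 → ℤ | ∀ k, v k ∈ Set.Icc (-N) N}.Finite := by
    have := Set.Finite.pi (fun _ : Fin 8 => Set.finite_Icc (-N) N)
    refine this.subset fun v hv => ?_
    exact fun k _ => hv k
  have hinj : Function.Injective fun k : SL(2, ℂ) => (k⁻¹).1 := fun k k' h =>
    inv_injective (Subtype.ext h)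
  refine ((hf.image gaussMat).preimage hinj.injOn).subset ?_
  rintro k ⟨⟨a, hk⟩, X, h1, h2⟩
  obtain ⟨v, hv, -⟩ := exists_evenInts hk isTile_one
  rw [mul_one] at hv
  refine ⟨v, fun j => ?_, hv.symm⟩
  have h3 := sq_entry_le hv X j
  have hp := ht_pos X
  have hp' := ht_pos (k⁻¹ • X)
  have h4 : (v j : ℝ) ^ 2 ≤ 4 * R * R := by nlinarith
  have h5 : v j ^ 2 ≤ ⌈4 * R * R⌉ := by
    have : ((v j ^ 2 : ℤ) : ℝ) ≤ ⌈4 * R * R⌉ := by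
      push_cast; exact h4.trans (Int.le_ceil _)
    exact_mod_cast this
  constructor <;> simp only [N] <;> nlinarith

/-- Among the finitely many centers at least as close as the first one there is a nearest. Comparing
it with the neighbour across the face whose signs are those of the point gives `∑ |n j| ≤ t`. -/
theorem exists_tile (X : H3) : ∃ a k, IsTile a k ∧ k⁻¹ • X ∈ cell := by
  let S := {k : SL(2, ℂ) | (∃ a, IsTile a k) ∧ ht (k⁻¹ • X) ≤ ht X}
  have hS : S.Finite := (finite_tiles (ht X)).subset fun k hk => ⟨hk.1, X, le_rfl, hk.2⟩
  obtain ⟨k, ⟨⟨a, hk⟩, hkX⟩, hmin⟩ := Set.exists_min_image S (fun k => ht (k⁻¹ • X)) hS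
    ⟨1, ⟨false, isTile_one⟩, by simp⟩
  refine ⟨a, k, hk, ?_⟩
  have hex : ∀ j, ∃ e : ℝ, (e = 1 ∨ e = -1) ∧ e * lab a (k⁻¹ • X) j = |lab a (k⁻¹ • X) j| :=
    fun j => by
      rcases le_total 0 (lab a (k⁻¹ • X) j) with h | h
      · exact ⟨1, Or.inl rfl, by rw [abs_of_nonneg h, one_mul]⟩
      · exact ⟨-1, Or.inr rfl, by rw [abs_of_nonpos h, neg_one_mul]⟩
  choose e he hen using hex
  obtain ⟨i, rfl⟩ := exists_eps he
  rw [mem_cell_iff a]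
  simp only [← hen]
  have h1 := ht_nbrOf_inv a i (k⁻¹ • X)
  rw [smul_smul, ← mul_inv_rev] at h1
  have h2 : ht (k⁻¹ • X) ≤ ht ((k * nbrOf a i)⁻¹ • X) := by
    by_cases h : ht ((k * nbrOf a i)⁻¹ • X) ≤ ht X
    · exact hmin _ ⟨⟨_, hk.nbr i⟩, h⟩
    · exact hkX.trans (not_le.1 h).le
  linarith

theorem tileMap_mem {a : Bool} {k : SL(2, ℂ)} {X : H3} (hX : k⁻¹ • X ∈ cell) :
    tileMap a k X ∈ ringCompl := theta_mem (klein_mem_octa.2 hX)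

/-- The covering of the complement of the Borromean rings by hyperbolic space. -/
def proj (X : H3) : BorromeanComplement :=
  ⟨tileMap (exists_tile X).choose (exists_tile X).choose_spec.choose X,
    tileMap_mem (exists_tile X).choose_spec.choose_spec.2⟩

theorem proj_val {a : Bool} {k : SL(2, ℂ)} (h : IsTile a k) {X : H3} (hX : k⁻¹ • X ∈ cell) :
    (proj X).1 = tileMap a k X :=
  tileMap_eq (exists_tile X).choose_spec.choose_spec.1 h (exists_tile X).choose_spec.choose_spec.2 hX

theorem proj_smul {g : SL(2, ℂ)} (hg : g ∈ Gam) (X : H3) : proj (g • X) = proj X := by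
  obtain ⟨a, k, hk, hX⟩ := exists_tile X
  have e : (g * k)⁻¹ • g • X = k⁻¹ • X := by rw [smul_smul]; congr 1; group
  apply Subtype.ext
  rw [proj_val hk hX, proj_val (hk.smul hg) (by rw [e]; exact hX), tileMap, tileMap, e]

theorem isClosed_tile (k : SL(2, ℂ)) : IsClosed {X | k⁻¹ • X ∈ cell} :=
  isClosed_cell.preimage (continuous_smul_H3 _)

/-- The tiles are closed and locally finite: a point of a tile is at most as far from the center of
this tile as from the origin, so only finitely many tiles come near a given point. -/
theorem continuous_proj : Continuous proj := by
  let ι := {q : Bool × SL(2, ℂ) // IsTile q.1 q.2}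
  let f : ι → Set H3 := fun q => {X | q.1.2⁻¹ • X ∈ cell}
  have hlf : LocallyFinite f := by
    intro X
    refine ⟨{Y | ht Y < ht X + 1}, (isOpen_lt continuous_ht continuous_const).mem_nhds
      (by simp), ?_⟩
    have hfin := (Set.finite_univ (α := Bool)).prod (finite_tiles (ht X + 1))
    refine (hfin.preimage Subtype.val_injective.injOn).subset ?_
    rintro ⟨⟨a, k⟩, hk⟩ ⟨Y, hY, hlt⟩
    refine ⟨trivial, ⟨a, hk⟩, Y, le_of_lt hlt, ?_⟩
    have := ht_le_of_mem_cell hk isTile_one hY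
    rw [inv_one, one_smul] at this
    exact this.trans (le_of_lt hlt)
  refine hlf.continuous ?_ (fun q => isClosed_tile q.1.2) fun q => ?_
  · refine Set.eq_univ_of_forall fun X => ?_
    obtain ⟨a, k, hk, hX⟩ := exists_tile X
    exact Set.mem_iUnion.2 ⟨⟨(a, k), hk⟩, hX⟩
  · refine IsInducing.subtypeVal.continuousOn_iff.2 ?_
    have : ContinuousOn (tileMap q.1.1 q.1.2) (f q) :=
      (continuousOn_theta q.1.1).comp
        ((continuous_klein _).comp (continuous_smul_H3 _)).continuousOn
        fun X hX => klein_mem_octa.2 hX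
    exact this.congr fun X hX => proj_val q.2 hX

/-- The orbits of the points with given coordinates in one of the two octahedra. -/
def orbitOf (p : Bool × (Fin 3 → ℝ)) : Set H3 :=
  {X | ∃ k, IsTile p.1 k ∧ k⁻¹ • X ∈ cell ∧ klein p.1 (k⁻¹ • X) = p.2}

theorem exists_smul_eq_of_mem_orbitOf {p : Bool × (Fin 3 → ℝ)} {X Y : H3} (hX : X ∈ orbitOf p)
    (hY : Y ∈ orbitOf p) : ∃ g ∈ Gam, g • X = Y := by
  obtain ⟨_, ⟨γ, hγ, rfl⟩, -, h1⟩ := hX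
  obtain ⟨_, ⟨γ', hγ', rfl⟩, -, h2⟩ := hY
  have h3 := klein_injective _ (h1.trans h2.symm)
  refine ⟨γ' * γ⁻¹, mul_mem hγ' (inv_mem hγ), ?_⟩
  rw [mul_inv_rev, mul_inv_rev, mul_smul, mul_smul, smul_left_cancel_iff, ← eq_inv_smul_iff] at h3
  rw [mul_smul, h3, inv_inv, inv_smul_smul, smul_inv_smul]

theorem smul_mem_orbitOf {p : Bool × (Fin 3 → ℝ)} {X : H3} (hX : X ∈ orbitOf p) {g : SL(2, ℂ)}
    (hg : g ∈ Gam) : g • X ∈ orbitOf p := by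
  obtain ⟨k, hk, h1, h2⟩ := hX
  have e : (g * k)⁻¹ • g • X = k⁻¹ • X := by rw [smul_smul]; congr 1; group
  exact ⟨g * k, hk.smul hg, by rwa [e], by rwa [e]⟩

theorem orbitOf_eq_of_mem {p q : Bool × (Fin 3 → ℝ)} {X : H3} (hp : X ∈ orbitOf p)
    (hq : X ∈ orbitOf q) : orbitOf p = orbitOf q := by
  ext Y
  constructor <;> intro hY
  · obtain ⟨g, hg, rfl⟩ := exists_smul_eq_of_mem_orbitOf hp hY
    exact smul_mem_orbitOf hq hg
  · obtain ⟨g, hg, rfl⟩ := exists_smul_eq_of_mem_orbitOf hq hY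
    exact smul_mem_orbitOf hp hg

/-- Representatives of a pair of corresponding points of faces. -/
theorem FaceGlue.exists_point {p q : Bool × (Fin 3 → ℝ)} (h : FaceGlue p q) :
    ∃ i, ∃ X ∈ cell, ∑ j, eps i j * lab false X j = ht X ∧ p = (false, klein false X) ∧
      q = (true, klein true ((nbr i)⁻¹ • X)) := by
  obtain ⟨b, e, hb, hsum, hb1, he, rfl, rfl⟩ := h
  obtain ⟨i, rfl⟩ := exists_eps he
  have habs : ∀ j, |eps i j * b j| = b j := fun j => by
    rw [abs_mul, abs_eps, one_mul, abs_of_nonneg (hb j)]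
  obtain ⟨X, hX, hk⟩ := exists_klein_of_mem_octa false (v := fun j => eps i j * b j)
    ⟨by simp only [habs, hsum]; exact le_rfl, fun j => by rw [habs]; exact hb1 j⟩
  have hl : ∀ j, lab false X j = ht X * (eps i j * b j) := fun j => by rw [lab_eq_klein, hk]
  have hs : ∑ j, eps i j * lab false X j = ht X := by
    have : ∀ j, eps i j * lab false X j = ht X * b j := fun j => by
      rw [hl]; linear_combination ht X * b j * eps_mul_self i j
    simp only [this]
    rw [← Finset.mul_sum, hsum, mul_one]
  refine ⟨i, X, hX, hs, by rw [hk], ?_⟩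
  obtain ⟨h0, h1⟩ := nbr_inv_coord i X
  rw [hs] at h0 h1
  have hp := (ht_pos X).ne'
  congr 1
  ext j
  rw [klein, h0, h1, hl]
  field_simp
  linear_combination -eps i j * b (j + 1) * eps_mul_self i (j + 1)

/-- Paired face points are represented by one point of hyperbolic space in two adjacent tiles. -/
theorem orbitOf_eq_of_faceGlue {p q : Bool × (Fin 3 → ℝ)} (h : FaceGlue p q) :
    orbitOf p = orbitOf q := by
  obtain ⟨i, X, hX, hs, rfl, rfl⟩ := h.exists_point
  have e : (1 : SL(2, ℂ))⁻¹ • X = X := by rw [inv_one, one_smul]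
  refine orbitOf_eq_of_mem (X := X) ⟨1, isTile_one, by rwa [e], by rw [e]⟩
    ⟨nbr i, ?_, (faceGlue_of_face hX hs).1, rfl⟩
  have := isTile_one.nbr i
  rwa [one_mul] at this

/-- Equal images are joined by a chain of face identifications, and each link of the chain preserves
the orbit. -/
theorem proj_eq_iff {X Y : H3} : proj X = proj Y ↔ ∃ g ∈ Gam, g • X = Y := by
  constructor
  · intro h
    obtain ⟨a, k, hk, hX⟩ := exists_tile X
    obtain ⟨a', k', hk', hY⟩ := exists_tile Y
    have h1 : theta a (klein a (k⁻¹ • X)) = theta a' (klein a' (k'⁻¹ • Y)) := by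
      have := congrArg Subtype.val h
      rwa [proj_val hk hX, proj_val hk' hY] at this
    have h2 := eqvGen_of_theta_eq (klein_mem_octa.2 hX) (klein_mem_octa.2 hY) h1
    have h3 : orbitOf (a, klein a (k⁻¹ • X)) = orbitOf (a', klein a' (k'⁻¹ • Y)) := by
      generalize (a, klein a (k⁻¹ • X)) = p at h2 ⊢
      generalize (a', klein a' (k'⁻¹ • Y)) = q at h2 ⊢
      induction h2 with
      | rel _ _ h => exact orbitOf_eq_of_faceGlue h
      | refl => rfl
      | symm _ _ _ ih => exact ih.symm
      | trans _ _ _ _ _ ih ih' => exact ih.trans ih'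
    exact exists_smul_eq_of_mem_orbitOf (p := (a, klein a (k⁻¹ • X))) ⟨k, hk, hX, rfl⟩
      (h3 ▸ ⟨k', hk', hY, rfl⟩)
  · rintro ⟨g, hg, rfl⟩
    exact (proj_smul hg X).symm

theorem exists_mem_frame (p : BorromeanComplement) :
    ∃ a X, (frame a)⁻¹ • X ∈ cell ∧ proj X = p := by
  obtain ⟨a, v, hv, h⟩ := theta_surj p.2
  obtain ⟨Y, hY, rfl⟩ := exists_klein_of_mem_octa a hv
  have e : (frame a)⁻¹ • frame a • Y = Y := inv_smul_smul _ _
  refine ⟨a, frame a • Y, by rwa [e], Subtype.ext ?_⟩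
  rw [proj_val (isTile_frame a) (by rwa [e]), tileMap, e, h]

/-- The images of closed subsets of the two octahedra are closed. -/
theorem isClosed_proj_image (a : Bool) {S : Set H3} (hS : IsClosed S)
    (hc : ∀ X ∈ S, (frame a)⁻¹ • X ∈ cell) : IsClosed (proj '' S) := by
  have hS' : IsClosed ((fun Y : H3 => frame a • Y) ⁻¹' S) := hS.preimage (continuous_smul_H3 _)
  obtain ⟨C, hC, hCS⟩ := (isInducing_klein a).isClosed_iff.1 hS'
  obtain ⟨D, hD, hDC⟩ := theta_image_closed a hC
  have : proj '' S = Subtype.val ⁻¹' D := by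
    ext p
    constructor
    · rintro ⟨X, hX, rfl⟩
      have h1 : theta a (klein a ((frame a)⁻¹ • X)) ∈ theta a '' (C ∩ octa) := by
        refine ⟨_, ⟨?_, klein_mem_octa.2 (hc X hX)⟩, rfl⟩
        have : (frame a)⁻¹ • X ∈ klein a ⁻¹' C := by
          rw [hCS, Set.mem_preimage, smul_inv_smul]; exact hX
        exact this
      rw [hDC] at h1
      rw [Set.mem_preimage, proj_val (isTile_frame a) (hc X hX)]
      exact h1.1
    · intro hp
      have h1 : p.1 ∈ D ∩ ringCompl := ⟨hp, p.2⟩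
      rw [← hDC] at h1
      obtain ⟨v, ⟨hvC, hv⟩, hvp⟩ := h1
      obtain ⟨Y, hY, rfl⟩ := exists_klein_of_mem_octa a hv
      have h2 : Y ∈ klein a ⁻¹' C := hvC
      rw [hCS] at h2
      have e : (frame a)⁻¹ • frame a • Y = Y := inv_smul_smul _ _
      refine ⟨frame a • Y, h2, Subtype.ext ?_⟩
      rw [proj_val (isTile_frame a) (hc _ h2), tileMap, e, hvp]
  rw [this]
  exact hD.preimage continuous_subtype_val

/-- The two octahedra already cover the target, and on each of them closed sets have closed images.
-/
theorem isQuotientMap_proj : IsQuotientMap proj := by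
  rw [isQuotientMap_iff_isClosed]
  refine ⟨fun p => ?_, fun s => ⟨fun h => h.preimage continuous_proj, fun h => ?_⟩⟩
  · obtain ⟨a, X, -, h⟩ := exists_mem_frame p
    exact ⟨X, h⟩
  · have : s = proj '' (proj ⁻¹' s ∩ {X | (frame false)⁻¹ • X ∈ cell}) ∪
        proj '' (proj ⁻¹' s ∩ {X | (frame true)⁻¹ • X ∈ cell}) := by
      ext p
      constructor
      · intro hp
        obtain ⟨a, X, hX, rfl⟩ := exists_mem_frame p
        cases a
        · exact Or.inl ⟨X, ⟨hp, hX⟩, rfl⟩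
        · exact Or.inr ⟨X, ⟨hp, hX⟩, rfl⟩
      · rintro (⟨X, ⟨hX, -⟩, rfl⟩ | ⟨X, ⟨hX, -⟩, rfl⟩) <;> exact hX
    rw [this]
    exact (isClosed_proj_image false (h.inter (isClosed_tile _)) fun X hX => hX.2).union
      (isClosed_proj_image true (h.inter (isClosed_tile _)) fun X hX => hX.2)

/-! ### Proper discontinuity and the covering property. -/

instance : T2Space H3 :=
  inferInstanceAs (T2Space {X : Matrix (Fin 2) (Fin 2) ℂ // X.PosDef ∧ X.det = 1})

/-- The group of the face pairings as a group of transformations of hyperbolic space. -/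
def deckGroup : Subgroup (Equiv.Perm H3) := Gam.map (MulAction.toPermHom SL(2, ℂ) H3)

/-- Only finitely many elements can return a small neighbourhood to itself. Those that move the
point are excluded by shrinking it, and the others are `± 1` by freeness. -/
theorem exists_nhds_disjoint (X : H3) : ∃ U ∈ 𝓝 X, ∀ g ∈ Gam, ∀ Y ∈ U, g • Y ∈ U →
    g = 1 ∨ g = -1 := by
  let F := {g : SL(2, ℂ) | g ∈ Gam ∧ g • X ≠ X ∧ ∃ Y, ht Y ≤ ht X + 1 ∧ ht (g⁻¹ • Y) ≤ ht X + 1}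
  have hF : F.Finite := (finite_tiles (ht X + 1)).subset fun g hg =>
    ⟨⟨false, g, hg.1, by simp [frame]⟩, hg.2.2⟩
  have hV : ∀ g : SL(2, ℂ), ∃ V ∈ 𝓝 X, g • X ≠ X → ∀ Y ∈ V, g • Y ∉ V := fun g => by
    by_cases h : g • X = X
    · exact ⟨Set.univ, Filter.univ_mem, fun h' => (h' h).elim⟩
    · obtain ⟨A, B, hA, hB, hXA, hXB, hd⟩ := t2_separation h
      refine ⟨(fun Y => g • Y) ⁻¹' A ∩ B, Filter.inter_mem
        ((hA.preimage (continuous_smul_H3 g)).mem_nhds hXA) (hB.mem_nhds hXB), fun _ Y hY hY' => ?_⟩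
      exact Set.disjoint_left.1 hd hY.1 hY'.2
  choose V hVn hV using hV
  refine ⟨{Y | ht Y < ht X + 1} ∩ ⋂ g ∈ F, V g, Filter.inter_mem
    ((isOpen_lt continuous_ht continuous_const).mem_nhds (by simp))
    ((Filter.biInter_mem hF).2 fun g _ => hVn g), fun g hg Y hY hgY => ?_⟩
  by_cases h : g • X = X
  · exact eq_one_or_neg_one_of_smul_eq hg h
  · have hgF : g ∈ F := ⟨hg, h, g • Y, le_of_lt hgY.1, by rw [inv_smul_smul]; exact le_of_lt hY.1⟩
    exact (hV g h Y (Set.mem_iInter₂.1 hY.2 g hgF) (Set.mem_iInter₂.1 hgY.2 g hgF)).elim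

theorem isCoveringMap_proj : IsCoveringMap proj := by
  -- The group is replaced by its image in the permutations, where `1` and `-1` coincide and the
  -- action becomes free.
  have h : IsQuotientCoveringMap proj deckGroup :=
    { isQuotientMap_proj with
      continuous_const_smul := by
        rintro ⟨g', hg'⟩
        obtain ⟨g, hg, rfl⟩ := hg'
        exact continuous_smul_H3 g
      apply_eq_iff_mem_orbit := by
        intro X Y
        rw [eq_comm, proj_eq_iff]
        constructor
        · rintro ⟨g, hg, rfl⟩
          exact ⟨⟨_, g, hg, rfl⟩, rfl⟩
        · rintro ⟨⟨_, g, hg, rfl⟩, rfl⟩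
          exact ⟨g, hg, rfl⟩
      disjoint := by
        intro X
        obtain ⟨U, hU, h⟩ := exists_nhds_disjoint X
        refine ⟨U, hU, ?_⟩
        rintro ⟨_, g, hg, rfl⟩ ⟨_, ⟨Y, hY, rfl⟩, hY'⟩
        apply Subtype.ext
        ext1 Z
        rcases h g hg Y hY hY' with rfl | rfl
        · exact one_smul SL(2, ℂ) Z
        · change (-1 : SL(2, ℂ)) • Z = Z
          rw [neg_smul_H3, one_smul] }
  exact h.isCoveringMap

/-! ### The tetrahedra in the octahedra -/

/-- The Hermitian matrix with given coordinates along the axes of an octahedron. -/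
def hermMat (a : Bool) (t : ℝ) (n : Fin 3 → ℝ) : Matrix (Fin 2) (Fin 2) ℂ :=
  if a then !![((t + n 2 : ℝ) : ℂ), ⟨-n 1, n 0⟩; ⟨-n 1, -n 0⟩, ((t - n 2 : ℝ) : ℂ)]
  else !![((t - n 0 : ℝ) : ℂ), ⟨n 1, n 2⟩; ⟨n 1, -n 2⟩, ((t + n 0 : ℝ) : ℂ)]

theorem val_eq_hermMat (a : Bool) (X : H3) : X.1 = hermMat a (ht X) (lab a X) := by
  rw [X.val_eq]
  cases a <;> simp [hermMat, lab, sub_eq_add_neg]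

theorem hermMat_inj {a : Bool} {t t' : ℝ} {n n' : Fin 3 → ℝ}
    (h : hermMat a t n = hermMat a t' n') : t = t' ∧ n = n' := by
  have e := fun i j => congrFun (congrFun h i) j
  have e00 := congrArg Complex.re (e 0 0)
  have e11 := congrArg Complex.re (e 1 1)
  have r01 := congrArg Complex.re (e 0 1)
  have i01 := congrArg Complex.im (e 0 1)
  cases a
  · simp [hermMat] at e00 e11 r01 i01
    refine ⟨by linarith, funext fun j => ?_⟩
    fin_cases j
    · change n 0 = n' 0; linarith
    · exact r01
    · exact i01
  · simp [hermMat] at e00 e11 r01 i01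
    refine ⟨by linarith, funext fun j => ?_⟩
    fin_cases j
    · exact i01
    · exact r01
    · change n 2 = n' 2; linarith

theorem sum_smul_hermMat {k : ℕ} (a : Bool) (c : Fin k → ℝ) (n : Fin k → Fin 3 → ℝ) :
    ∑ i, (c i : ℂ) • hermMat a 1 (n i) = hermMat a (∑ i, c i) (fun j => ∑ i, c i * n i j) := by
  ext i j
  rw [Matrix.sum_apply]
  cases a <;> fin_cases i <;> fin_cases j <;> apply Complex.ext <;>
    simp [hermMat, mul_add, mul_sub, Finset.sum_add_distrib]

/-- The direction of a vertex of the octahedron. -/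
def vertexDir (l : OctVertex) (j : Fin 3) : ℝ := if l.1 = j then sgn l.2 else 0

/-- The scale of the representatives of the ideal vertices. -/
def vertexScale (a : Bool) (l : OctVertex) : ℝ := if l.1 = (if a then 2 else 0) then 1 / 2 else 1

theorem vertexScale_pos (a : Bool) (l : OctVertex) : 0 < vertexScale a l := by
  unfold vertexScale; split_ifs <;> norm_num

theorem frame_val (a : Bool) :
    (frame a).1 = gaussMat (if a then ![1, 0, 1, 1, 0, 0, 1, 0] else ![1, 0, 0, 0, 0, 0, 1, 0]) := by
  cases a
  · simpa [frame] using gaussMat_one.symm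
  · simp [frame, shift_val]

theorem idealRay_octPoint (a : Bool) (l : OctVertex) : idealRay (octPoint a l) =
    (vertexScale a l : ℂ) • ((frame a).1 * hermMat a 1 (vertexDir l) * (frame a).1ᴴ) := by
  obtain ⟨j, b⟩ := l
  rw [frame_val]
  ext p q
  simp only [Matrix.smul_apply, Matrix.mul_apply, Fin.sum_univ_two, Matrix.conjTranspose_apply,
    idealRay, Matrix.vecMulVec_apply]
  cases a <;> cases b <;> fin_cases j <;> fin_cases p <;> fin_cases q <;> apply Complex.ext <;>
    simp [octPoint, idealVector_fin, idealVector_infty, vertexScale, hermMat, vertexDir, sgn,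
      gaussMat] <;>
    norm_num

/-- The representatives of the ideal points differ from the vectors `(1, ± e j)` by the frame and by
positive scalars, which the nonnegative coefficients absorb. -/
theorem mem_idealHull_iff_coord {k : ℕ} (a : Bool) (l : Fin k → OctVertex) (X : H3) :
    X ∈ idealHull (fun i => octPoint a (l i)) ↔ ∃ c : Fin k → ℝ, (∀ i, 0 ≤ c i) ∧
      ht ((frame a)⁻¹ • X) = ∑ i, c i ∧
      ∀ j, lab a ((frame a)⁻¹ • X) j = ∑ i, c i * vertexDir (l i) j := by
  have hF : (frame a).1 * ((frame a)⁻¹).1 = 1 := by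
    rw [← Matrix.SpecialLinearGroup.coe_mul, mul_inv_cancel]; rfl
  have hF' : ((frame a)⁻¹).1 * (frame a).1 = 1 := by
    rw [← Matrix.SpecialLinearGroup.coe_mul, inv_mul_cancel]; rfl
  have conj : ∀ A B : Matrix (Fin 2) (Fin 2) ℂ, A = (frame a).1 * B * (frame a).1ᴴ ↔
      ((frame a)⁻¹).1 * A * ((frame a)⁻¹).1ᴴ = B := fun A B => by
    have e1 : (frame a).1ᴴ * ((frame a)⁻¹).1ᴴ = 1 := by
      rw [← Matrix.conjTranspose_mul, hF', Matrix.conjTranspose_one]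
    have e2 : ((frame a)⁻¹).1ᴴ * (frame a).1ᴴ = 1 := by
      rw [← Matrix.conjTranspose_mul, hF, Matrix.conjTranspose_one]
    constructor
    · rintro rfl
      calc _ = (((frame a)⁻¹).1 * (frame a).1) * B * ((frame a).1ᴴ * ((frame a)⁻¹).1ᴴ) := by
            simp only [Matrix.mul_assoc]
        _ = B := by rw [hF', e1, one_mul, mul_one]
    · rintro rfl
      calc A = ((frame a).1 * ((frame a)⁻¹).1) * A * (((frame a)⁻¹).1ᴴ * (frame a).1ᴴ) := by
            rw [hF, e2, one_mul, mul_one]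
        _ = _ := by simp only [Matrix.mul_assoc]
  have key : ∀ c : Fin k → ℝ, X.1 = ∑ i, (c i : ℂ) • idealRay (octPoint a (l i)) ↔
      (ht ((frame a)⁻¹ • X) = ∑ i, c i * vertexScale a (l i) ∧
      ∀ j, lab a ((frame a)⁻¹ • X) j = ∑ i, c i * vertexScale a (l i) * vertexDir (l i) j) := by
    intro c
    have e : ∑ i, (c i : ℂ) • idealRay (octPoint a (l i)) = (frame a).1 *
        hermMat a (∑ i, c i * vertexScale a (l i))
          (fun j => ∑ i, c i * vertexScale a (l i) * vertexDir (l i) j) * (frame a).1ᴴ := by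
      rw [← sum_smul_hermMat, Matrix.mul_sum, Matrix.sum_mul]
      refine Finset.sum_congr rfl fun i _ => ?_
      rw [idealRay_octPoint, smul_smul, Matrix.mul_smul, Matrix.smul_mul]
      push_cast
      rfl
    rw [e, conj, ← smul_val, val_eq_hermMat a]
    constructor
    · intro h
      obtain ⟨h0, h1⟩ := hermMat_inj h
      exact ⟨h0, fun j => congrFun h1 j⟩
    · rintro ⟨h0, h1⟩
      rw [h0, funext h1]
  constructor
  · rintro ⟨c, hc, h⟩
    obtain ⟨h0, h1⟩ := (key c).1 h
    exact ⟨fun i => c i * vertexScale a (l i), fun i => mul_nonneg (hc i) (vertexScale_pos a _).le,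
      h0, h1⟩
  · rintro ⟨c, hc, h0, h1⟩
    have e : ∀ i, c i / vertexScale a (l i) * vertexScale a (l i) = c i := fun i =>
      div_mul_cancel₀ _ (vertexScale_pos a _).ne'
    refine ⟨fun i => c i / vertexScale a (l i), fun i => div_nonneg (hc i) (vertexScale_pos a _).le,
      (key _).2 ⟨?_, ?_⟩⟩
    · simp only [e, h0]
    · simp only [e]; exact h1

/-- Membership in the hull of some of the vertices of an octahedron. -/
theorem mem_idealHull_iff {k : ℕ} (a : Bool) {l : Fin k → OctVertex} (hl : Function.Injective l)
    (X : H3) : X ∈ idealHull (fun i => octPoint a (l i)) ↔ ∃ d : OctVertex → ℝ, (∀ p, 0 ≤ d p) ∧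
      (∀ p, p ∉ Finset.univ.image l → d p = 0) ∧ ht ((frame a)⁻¹ • X) = ∑ p, d p ∧
      ∀ j, lab a ((frame a)⁻¹ • X) j = d (j, true) - d (j, false) := by
  have hsum : ∀ (d : OctVertex → ℝ), (∀ p, p ∉ Finset.univ.image l → d p = 0) →
      ∑ p, d p = ∑ i, d (l i) := fun d hd => by
    rw [← Finset.sum_subset (Finset.subset_univ (Finset.univ.image l)) fun p _ hp => hd p hp,
      Finset.sum_image fun _ _ _ _ h => hl h]
  have hdir : ∀ (d : OctVertex → ℝ) (j : Fin 3), ∑ p, d p * vertexDir p j =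
      d (j, true) - d (j, false) := fun d j => by
    rw [Fintype.sum_prod_type, Finset.sum_eq_single j]
    · simp [vertexDir, sgn]; ring
    · intro b _ hb
      simp [vertexDir, hb]
    · simp
  rw [mem_idealHull_iff_coord]
  constructor
  · rintro ⟨c, hc, h0, h1⟩
    let d : OctVertex → ℝ := fun p => ∑ i, if l i = p then c i else 0
    have hd : ∀ i, d (l i) = c i := fun i => by
      simp only [d, hl.eq_iff]
      simp
    have hd0 : ∀ p, p ∉ Finset.univ.image l → d p = 0 := fun p hp => by
      refine Finset.sum_eq_zero fun i _ => if_neg fun h => hp ?_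
      exact Finset.mem_image.2 ⟨i, Finset.mem_univ i, h⟩
    refine ⟨d, fun p => Finset.sum_nonneg fun i _ => ?_, hd0, ?_, fun j => ?_⟩
    · split_ifs
      · exact hc i
      · exact le_rfl
    · rw [hsum d hd0, h0]
      simp only [hd]
    · rw [← hdir, hsum (fun p => d p * vertexDir p j) fun p hp => by rw [hd0 p hp, zero_mul], h1]
      simp only [hd]
  · rintro ⟨d, hd, hd0, h0, h1⟩
    refine ⟨fun i => d (l i), fun i => hd _, by rw [h0, hsum d hd0], fun j => ?_⟩
    rw [h1, ← hdir, hsum (fun p => d p * vertexDir p j) fun p hp => by rw [hd0 p hp, zero_mul]]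

/-- The coefficients of a point of the octahedron in the tetrahedra around the axis `0`. -/
theorem mem_idealHull_of_signs {k : ℕ} (a : Bool) {l : Fin k → OctVertex}
    (hl : Function.Injective l) {X : H3} (hX : (frame a)⁻¹ • X ∈ cell) (b c : Bool)
    (h0 : ∀ e, (0, e) ∈ Finset.univ.image l)
    (h1 : 0 ≤ sgn b * lab a ((frame a)⁻¹ • X) 1) (h2 : 0 ≤ sgn c * lab a ((frame a)⁻¹ • X) 2)
    (h1' : (1, b) ∈ Finset.univ.image l ∨ lab a ((frame a)⁻¹ • X) 1 = 0)
    (h2' : (2, c) ∈ Finset.univ.image l ∨ lab a ((frame a)⁻¹ • X) 2 = 0) :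
    X ∈ idealHull (fun i => octPoint a (l i)) := by
  rw [mem_idealHull_iff a hl]
  rw [mem_cell_iff a, Fin.sum_univ_three] at hX
  set n := lab a ((frame a)⁻¹ • X) with hn
  set t := ht ((frame a)⁻¹ • X)
  have a1 : |n 1| = sgn b * n 1 := by
    rcases sgn_eq b with e | e <;> rw [e] at h1 ⊢
    · rw [abs_of_nonneg (by linarith), one_mul]
    · rw [abs_of_nonpos (by linarith), neg_one_mul]
  have a2 : |n 2| = sgn c * n 2 := by
    rcases sgn_eq c with e | e <;> rw [e] at h2 ⊢
    · rw [abs_of_nonneg (by linarith), one_mul]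
    · rw [abs_of_nonpos (by linarith), neg_one_mul]
  have b0 := le_abs_self (n 0)
  have b0' := neg_le_abs (n 0)
  -- The coordinates on the axes `1` and `2` fix the weights of the two side vertices; the rest of
  -- `t` is distributed over the ends of the axis `0` so as to give `n 0`, nonnegatively because the
  -- point is in the octahedron.
  let d : OctVertex → ℝ := fun p =>
    if p.1 = 0 then (t - |n 1| - |n 2| + sgn p.2 * n 0) / 2
    else if p.1 = 1 then (if p.2 = b then |n 1| else 0) else (if p.2 = c then |n 2| else 0)
  have d0 : ∀ e, d (0, e) = (t - |n 1| - |n 2| + sgn e * n 0) / 2 := fun e => by simp [d]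
  have d1 : ∀ e, d (1, e) = if e = b then |n 1| else 0 := fun e => by simp [d]
  have d2 : ∀ e, d (2, e) = if e = c then |n 2| else 0 := fun e => by simp [d]
  refine ⟨d, ?_, ?_, ?_, ?_⟩
  · rintro ⟨j, e⟩
    fin_cases j
    · change 0 ≤ d (0, e)
      rw [d0]; cases e <;> simp [sgn] <;> linarith
    · change 0 ≤ d (1, e)
      rw [d1]; split_ifs; exacts [abs_nonneg _, le_rfl]
    · change 0 ≤ d (2, e)
      rw [d2]; split_ifs; exacts [abs_nonneg _, le_rfl]
  · rintro ⟨j, e⟩ hp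
    fin_cases j
    · exact (hp (h0 e)).elim
    · change d (1, e) = 0
      rw [d1]
      split_ifs with he
      · subst he
        rcases h1' with h | h
        · exact (hp h).elim
        · rw [h, abs_zero]
      · rfl
    · change d (2, e) = 0
      rw [d2]
      split_ifs with he
      · subst he
        rcases h2' with h | h
        · exact (hp h).elim
        · rw [h, abs_zero]
      · rfl
  · rw [Fintype.sum_prod_type, Fin.sum_univ_three]
    simp only [Fintype.sum_bool, d0, d1, d2]
    cases b <;> cases c <;> simp [sgn] <;> ring
  · intro j
    fin_cases j
    · change n 0 = d (0, true) - d (0, false)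
      rw [d0, d0]; simp [sgn]; ring
    · change n 1 = d (1, true) - d (1, false)
      rw [d1, d1, a1]; cases b <;> simp [sgn]
    · change n 2 = d (2, true) - d (2, false)
      rw [d2, d2, a2]; cases c <;> simp [sgn]

theorem mem_cell_of_mem_idealHull {k : ℕ} {a : Bool} {l : Fin k → OctVertex}
    (hl : Function.Injective l) {X : H3} (h : X ∈ idealHull (fun i => octPoint a (l i))) :
    (frame a)⁻¹ • X ∈ cell ∧ ∀ j b, (j, !b) ∉ Finset.univ.image l →
      0 ≤ sgn b * lab a ((frame a)⁻¹ • X) j := by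
  obtain ⟨d, hd, hd0, h0, h1⟩ := (mem_idealHull_iff a hl X).1 h
  constructor
  · rw [mem_cell_iff a, h0, Fintype.sum_prod_type]
    refine Finset.sum_le_sum fun j _ => ?_
    rw [h1, Fintype.sum_bool, abs_le]
    constructor <;> linarith [hd (j, true), hd (j, false)]
  · intro j b hb
    have := hd0 _ hb
    have h2 := hd (j, b)
    rw [h1]
    cases b
    · simp at this; simp [sgn, this]; exact h2
    · simp at this; simp [sgn, this]; exact h2

/-! ### The glued space -/

/-- The signs of the vertices of the tetrahedra on the axes `1` and `2`. -/
def axisBool : Fin 8 → Fin 3 → Bool :=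
  ![![true, true, false], ![true, false, true], ![true, false, false], ![true, true, true],
    ![true, true, true], ![true, true, false], ![true, false, true], ![true, false, false]]

theorem octLabel_injective : ∀ t, Function.Injective (octLabel t) := by decide

theorem image_octLabel : ∀ t, Finset.univ.image (octLabel t) =
    {(0, true), (0, false), (1, axisBool t 1), (2, axisBool t 2)} := by decide

theorem exists_tetra : ∀ a b c, ∃ t, side t = a ∧ axisBool t 1 = b ∧ axisBool t 2 = c := by decide

theorem tetra_ext : ∀ t t', side t = side t' → axisBool t 1 = axisBool t' 1 →
    axisBool t 2 = axisBool t' 2 → t = t' := by decide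

theorem vertexTable_eq' (t : Fin 8) : vertexTable t = fun i => octPoint (side t) (octLabel t i) :=
  funext (vertexTable_eq t)

/-- The tetrahedra in terms of the coordinates of the octahedra. -/
theorem mem_tetra_iff (t : Fin 8) (X : H3) : X ∈ idealHull (vertexTable t) ↔
    (frame (side t))⁻¹ • X ∈ cell ∧
      0 ≤ sgn (axisBool t 1) * lab (side t) ((frame (side t))⁻¹ • X) 1 ∧
      0 ≤ sgn (axisBool t 2) * lab (side t) ((frame (side t))⁻¹ • X) 2 := by
  rw [vertexTable_eq']
  constructor
  · intro h
    obtain ⟨h1, h2⟩ := mem_cell_of_mem_idealHull (octLabel_injective t) h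
    exact ⟨h1, h2 1 _ (by rw [image_octLabel]; simp), h2 2 _ (by rw [image_octLabel]; simp)⟩
  · rintro ⟨h0, h1, h2⟩
    exact mem_idealHull_of_signs _ (octLabel_injective t) h0 (axisBool t 1) (axisBool t 2)
      (by intro e; rw [image_octLabel]; cases e <;> simp) h1 h2
      (Or.inl (by rw [image_octLabel]; simp)) (Or.inl (by rw [image_octLabel]; simp))

theorem isClosed_tetra (t : Fin 8) : IsClosed (idealHull (vertexTable t)) := by
  have hc : ∀ j, Continuous fun X : H3 => lab (side t) ((frame (side t))⁻¹ • X) j := fun j =>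
    (continuous_apply j).comp ((continuous_lab _).comp (continuous_smul_H3 _))
  have : idealHull (vertexTable t) = {X | (frame (side t))⁻¹ • X ∈ cell} ∩
      ({X | 0 ≤ sgn (axisBool t 1) * lab (side t) ((frame (side t))⁻¹ • X) 1} ∩
      {X | 0 ≤ sgn (axisBool t 2) * lab (side t) ((frame (side t))⁻¹ • X) 2}) := by
    ext X; exact mem_tetra_iff t X
  rw [this]
  exact (isClosed_tile _).inter ((isClosed_le continuous_const (continuous_const.mul (hc 1))).inter
    (isClosed_le continuous_const (continuous_const.mul (hc 2))))

/-- The image of a point in the glued space. -/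
abbrev gpt (t : Fin 8) (X : H3) (hX : X ∈ idealHull (vertexTable t)) :
    GluedSpace pairings vertexTable := gluedPoint pairings vertexTable t ⟨X, hX⟩

theorem gpt_eq_of_inner {P : FacePairing 8} (hP : P ∈ innerPairings) {X : H3}
    (h : X ∈ idealHull (vertexTable P.src)) (h' : X ∈ idealHull (vertexTable P.tgt))
    (hf : X ∈ idealHull (fun k => octPoint (side P.src) (octLabel P.src (P.srcFace k)))) :
    gpt P.src X h = gpt P.tgt X h' := by
  refine Quot.sound ⟨P, List.mem_append_left _ hP, 1, one_realizes hP, rfl, rfl, ?_, ?_⟩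
  · simp only [vertexTable_eq]
    exact hf
  · exact (one_smul _ _).symm

theorem exists_inner_first : ∀ t t', side t = side t' → axisBool t 1 = axisBool t' 1 → t ≠ t' →
    ∃ P ∈ innerPairings, ((P.src = t ∧ P.tgt = t') ∨ (P.src = t' ∧ P.tgt = t)) ∧
      Function.Injective (fun k => octLabel P.src (P.srcFace k)) ∧
      Finset.univ.image (fun k => octLabel P.src (P.srcFace k)) =
        {(0, true), (0, false), (1, axisBool t 1)} := by decide

theorem exists_inner_second : ∀ t t', side t = side t' → axisBool t 2 = axisBool t' 2 → t ≠ t' →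
    ∃ P ∈ innerPairings, ((P.src = t ∧ P.tgt = t') ∨ (P.src = t' ∧ P.tgt = t)) ∧
      Function.Injective (fun k => octLabel P.src (P.srcFace k)) ∧
      Finset.univ.image (fun k => octLabel P.src (P.srcFace k)) =
        {(0, true), (0, false), (2, axisBool t 2)} := by decide

theorem eq_zero_of_signs {b c : Bool} {x : ℝ} (h : b ≠ c) (hb : 0 ≤ sgn b * x)
    (hc : 0 ≤ sgn c * x) : x = 0 := by
  cases b <;> cases c <;> simp [sgn] at * <;> linarith

/-- Distinct tetrahedra of one octahedron with the same sign on the axis `1` have opposite signs on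
the axis `2`; hence a common point lies on the face where this coordinate vanishes, and an inner
pairing glues it there. -/
theorem gpt_eq_of_first {t t' : Fin 8} (hs : side t = side t') (hb : axisBool t 1 = axisBool t' 1)
    {X : H3} (h : X ∈ idealHull (vertexTable t)) (h' : X ∈ idealHull (vertexTable t')) :
    gpt t X h = gpt t' X h' := by
  by_cases htt : t = t'
  · subst htt; rfl
  obtain ⟨P, hP, hst, hinj, him⟩ := exists_inner_first t t' hs hb htt
  have hc : axisBool t 2 ≠ axisBool t' 2 := fun e => htt (tetra_ext t t' hs hb e)
  have hside : side P.src = side t := by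
    rcases hst with ⟨e, -⟩ | ⟨e, -⟩ <;> rw [e]
    exact hs.symm
  have m := (mem_tetra_iff t X).1 h
  have m' := (mem_tetra_iff t' X).1 h'
  rw [← hs] at m'
  have hz := eq_zero_of_signs hc m.2.2 m'.2.2
  have hf : X ∈ idealHull (fun k => octPoint (side P.src) (octLabel P.src (P.srcFace k))) := by
    rw [hside]
    exact mem_idealHull_of_signs _ hinj m.1 (axisBool t 1) true
      (by intro e; rw [him]; cases e <;> simp) m.2.1 (by rw [hz]; simp)
      (Or.inl (by rw [him]; simp)) (Or.inr hz)
  rcases hst with ⟨rfl, rfl⟩ | ⟨rfl, rfl⟩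
  · exact gpt_eq_of_inner hP h h' hf
  · exact (gpt_eq_of_inner hP h' h hf).symm

theorem gpt_eq_of_second {t t' : Fin 8} (hs : side t = side t') (hb : axisBool t 2 = axisBool t' 2)
    {X : H3} (h : X ∈ idealHull (vertexTable t)) (h' : X ∈ idealHull (vertexTable t')) :
    gpt t X h = gpt t' X h' := by
  by_cases htt : t = t'
  · subst htt; rfl
  obtain ⟨P, hP, hst, hinj, him⟩ := exists_inner_second t t' hs hb htt
  have hc : axisBool t 1 ≠ axisBool t' 1 := fun e => htt (tetra_ext t t' hs e hb)
  have hside : side P.src = side t := by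
    rcases hst with ⟨e, -⟩ | ⟨e, -⟩ <;> rw [e]
    exact hs.symm
  have m := (mem_tetra_iff t X).1 h
  have m' := (mem_tetra_iff t' X).1 h'
  rw [← hs] at m'
  have hz := eq_zero_of_signs hc m.2.1 m'.2.1
  have hf : X ∈ idealHull (fun k => octPoint (side P.src) (octLabel P.src (P.srcFace k))) := by
    rw [hside]
    exact mem_idealHull_of_signs _ hinj m.1 true (axisBool t 2)
      (by intro e; rw [him]; cases e <;> simp) (by rw [hz]; simp) m.2.2
      (Or.inr hz) (Or.inl (by rw [him]; simp))
  rcases hst with ⟨rfl, rfl⟩ | ⟨rfl, rfl⟩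
  · exact gpt_eq_of_inner hP h h' hf
  · exact (gpt_eq_of_inner hP h' h hf).symm

/-- The tetrahedra of an octahedron are glued along their intersections. -/
theorem gpt_eq_of_side {t t' : Fin 8} (hs : side t = side t') {X : H3}
    (h : X ∈ idealHull (vertexTable t)) (h' : X ∈ idealHull (vertexTable t')) :
    gpt t X h = gpt t' X h' := by
  -- Tetrahedra on opposite sides of the axis are joined through one that shares a sign with each.
  obtain ⟨u, hu, hu1, hu2⟩ := exists_tetra (side t) (axisBool t 1) (axisBool t' 2)
  have hX : X ∈ idealHull (vertexTable u) := by
    have m := (mem_tetra_iff t X).1 h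
    have m' := (mem_tetra_iff t' X).1 h'
    rw [← hs] at m'
    rw [mem_tetra_iff, hu, hu1, hu2]
    exact ⟨m.1, m.2.1, m'.2.2⟩
  rw [gpt_eq_of_first hu.symm hu1.symm h hX, gpt_eq_of_second (hu.trans hs) hu2 hX h']

/-- The points of the glued space with given coordinates in one of the octahedra. -/
def gluedClass (p : Bool × (Fin 3 → ℝ)) : Set (GluedSpace pairings vertexTable) :=
  {q | ∃ t X, ∃ hX : X ∈ idealHull (vertexTable t), side t = p.1 ∧
    klein p.1 ((frame p.1)⁻¹ • X) = p.2 ∧ q = gpt t X hX}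

theorem gluedClass_subsingleton (p : Bool × (Fin 3 → ℝ)) : (gluedClass p).Subsingleton := by
  rintro _ ⟨t, X, hX, hs, hk, rfl⟩ _ ⟨t', X', hX', hs', hk', rfl⟩
  have h := klein_injective _ (hk.trans hk'.symm)
  rw [smul_left_cancel_iff] at h
  subst h
  exact gpt_eq_of_side (hs.trans hs'.symm) hX hX'

theorem outer_data : ∀ i : Fin 8,
    side (outerPairings.get (i.cast rfl)).src = false ∧
    side (outerPairings.get (i.cast rfl)).tgt = true ∧
    axisBool (outerPairings.get (i.cast rfl)).src 1 = faceBool i 1 ∧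
    axisBool (outerPairings.get (i.cast rfl)).src 2 = faceBool i 2 ∧
    axisBool (outerPairings.get (i.cast rfl)).tgt 1 = faceBool i 1 ∧
    axisBool (outerPairings.get (i.cast rfl)).tgt 2 = faceBool i 2 ∧
    Function.Injective (fun k => octLabel (outerPairings.get (i.cast rfl)).src
      ((outerPairings.get (i.cast rfl)).srcFace k)) ∧
    Finset.univ.image (fun k => octLabel (outerPairings.get (i.cast rfl)).src
      ((outerPairings.get (i.cast rfl)).srcFace k)) =
        {(0, faceBool i 0), (1, faceBool i 1), (2, faceBool i 2)} := by decide

theorem mem_outer_face {i : Fin 8} {k : ℕ} {l : Fin k → OctVertex} (hl : Function.Injective l)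
    (him : Finset.univ.image l = {(0, faceBool i 0), (1, faceBool i 1), (2, faceBool i 2)})
    {X : H3} (hX : X ∈ cell) (hs : ∑ j, eps i j * lab false X j = ht X) :
    X ∈ idealHull (fun k => octPoint false (l k)) := by
  have ha := abs_eq_eps_mul ((mem_cell_iff false X).1 hX) hs
  have e : (frame false)⁻¹ • X = X := by simp [frame]
  rw [mem_idealHull_iff false hl, e]
  refine ⟨fun p => if p.2 = faceBool i p.1 then |lab false X p.1| else 0, fun p => ?_, ?_, ?_, ?_⟩
  · dsimp only; split_ifs; exacts [abs_nonneg _, le_rfl]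
  · rintro ⟨j, b⟩ hp
    refine if_neg fun h => hp ?_
    rw [him]
    simp only at h
    subst h
    fin_cases j <;> simp
  · rw [Fintype.sum_prod_type, ← hs]
    refine Finset.sum_congr rfl fun j _ => ?_
    rw [Fintype.sum_bool, ← ha]
    cases faceBool i j <;> simp
  · intro j
    simp only [ha, eps]
    have := sgn_mul_self (faceBool i j)
    cases h : faceBool i j <;> simp [sgn]

/-- The face with the signs `ε` belongs to a single outer pairing, and its isometry takes the point
to the partner that `FaceGlue` prescribes; the classes have at most one element and so coincide. -/
theorem gluedClass_eq_of_faceGlue {p q : Bool × (Fin 3 → ℝ)} (h : FaceGlue p q) :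
    gluedClass p = gluedClass q := by
  obtain ⟨i, X, hX, hs, rfl, rfl⟩ := h.exists_point
  obtain ⟨d0, d1, d2, d3, d4, d5, d6, d7⟩ := outer_data i
  set P := outerPairings.get (i.cast rfl) with hP
  have hPm : P ∈ pairings := List.mem_append_right _ (List.get_mem _ _)
  have hr : Realizes vertexTable P (outerMat i) := outerMat_realizes i
  have e : (frame false)⁻¹ • X = X := by simp [frame]
  have e' : (frame true)⁻¹ • outerMat i • X = (nbr i)⁻¹ • X := by
    rw [smul_smul]; simp [frame, nbr]
  have ha := abs_eq_eps_mul ((mem_cell_iff false X).1 hX) hs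
  have hX1 : X ∈ idealHull (vertexTable P.src) := by
    rw [mem_tetra_iff, d0, d2, d3, e]
    exact ⟨hX, (ha 1).symm ▸ abs_nonneg _, (ha 2).symm ▸ abs_nonneg _⟩
  obtain ⟨n0, n1⟩ := nbr_inv_coord i X
  rw [hs] at n0 n1
  have hsgn : ∀ j, 0 ≤ eps i j * lab true ((nbr i)⁻¹ • X) j := fun j => by
    have e1 : eps i j * lab true ((nbr i)⁻¹ • X) j = eps i (j + 1) * lab false X (j + 1) := by
      rw [n1]; linear_combination eps i (j + 1) * lab false X (j + 1) * eps_mul_self i j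
    rw [e1, ← ha]
    exact abs_nonneg _
  have hX2 : outerMat i • X ∈ idealHull (vertexTable P.tgt) := by
    rw [mem_tetra_iff, d1, d4, d5, e']
    exact ⟨(faceGlue_of_face hX hs).1, hsgn 1, hsgn 2⟩
  have hglue : gpt P.src X hX1 = gpt P.tgt (outerMat i • X) hX2 := by
    refine Quot.sound ⟨P, hPm, outerMat i, hr, rfl, rfl, ?_, rfl⟩
    simp only [vertexTable_eq]
    rw [d0]
    exact mem_outer_face d6 d7 hX hs
  have m1 : gpt P.src X hX1 ∈ gluedClass (false, klein false X) :=
    ⟨P.src, X, hX1, d0, by rw [e], rfl⟩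
  have m2 : gpt P.src X hX1 ∈ gluedClass (true, klein true ((nbr i)⁻¹ • X)) :=
    ⟨P.tgt, outerMat i • X, hX2, d1, by rw [e'], hglue⟩
  rw [(gluedClass_subsingleton _).eq_singleton_of_mem m1,
    (gluedClass_subsingleton _).eq_singleton_of_mem m2]

theorem proj_val_of_mem_tetra {t : Fin 8} {X : H3} (hX : X ∈ idealHull (vertexTable t)) :
    (proj X).1 = theta (side t) (klein (side t) ((frame (side t))⁻¹ • X)) :=
  proj_val (isTile_frame _) ((mem_tetra_iff t X).1 hX).1

/-- The map from the glued space to the complement of the Borromean rings. -/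
def gluedMap : GluedSpace pairings vertexTable → BorromeanComplement :=
  Quot.lift (fun a => proj a.2.1) (by
    rintro ⟨t, X⟩ ⟨t', X'⟩ ⟨P, hP, g, hg, -, -, -, h⟩
    simp only at h
    rw [h, proj_smul (realizes_mem_Gam hP hg)])

/-- Equal images are joined by face identifications of the octahedra, each of which is already made
in the glued space. -/
theorem gluedMap_injective : Function.Injective gluedMap := by
  rintro ⟨t, X, hX⟩ ⟨t', X', hX'⟩ h
  have h1 : proj X = proj X' := h
  have h2 := congrArg Subtype.val h1
  rw [proj_val_of_mem_tetra hX, proj_val_of_mem_tetra hX'] at h2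
  have h3 := eqvGen_of_theta_eq (klein_mem_octa.2 ((mem_tetra_iff t X).1 hX).1)
    (klein_mem_octa.2 ((mem_tetra_iff t' X').1 hX').1) h2
  have m1 : gpt t X hX ∈ gluedClass (side t, klein (side t) ((frame (side t))⁻¹ • X)) :=
    ⟨t, X, hX, rfl, rfl, rfl⟩
  have m2 : gpt t' X' hX' ∈ gluedClass (side t', klein (side t') ((frame (side t'))⁻¹ • X')) :=
    ⟨t', X', hX', rfl, rfl, rfl⟩
  have h4 : gluedClass (side t, klein (side t) ((frame (side t))⁻¹ • X)) =
      gluedClass (side t', klein (side t') ((frame (side t'))⁻¹ • X')) := by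
    generalize (side t, klein (side t) ((frame (side t))⁻¹ • X)) = p at h3 ⊢
    generalize (side t', klein (side t') ((frame (side t'))⁻¹ • X')) = q at h3 ⊢
    induction h3 with
    | rel _ _ h => exact gluedClass_eq_of_faceGlue h
    | refl => rfl
    | symm _ _ _ ih => exact ih.symm
    | trans _ _ _ _ _ ih ih' => exact ih.trans ih'
  rw [← h4] at m2
  exact gluedClass_subsingleton _ m1 m2

theorem gluedMap_surjective : Function.Surjective gluedMap := by
  intro p
  obtain ⟨a, X, hX, rfl⟩ := exists_mem_frame p
  have hex : ∀ x : ℝ, ∃ b, 0 ≤ sgn b * x := fun x => by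
    rcases le_total 0 x with h | h
    · exact ⟨true, by simpa [sgn] using h⟩
    · exact ⟨false, by simpa [sgn] using h⟩
  obtain ⟨b, hb⟩ := hex (lab a ((frame a)⁻¹ • X) 1)
  obtain ⟨c, hc⟩ := hex (lab a ((frame a)⁻¹ • X) 2)
  obtain ⟨t, rfl, rfl, rfl⟩ := exists_tetra a b c
  exact ⟨gpt t X ((mem_tetra_iff t X).2 ⟨hX, hb, hc⟩), rfl⟩

theorem continuous_gluedMap : Continuous gluedMap :=
  continuous_quot_lift _ (continuous_sigma fun _ => continuous_proj.comp continuous_subtype_val)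

theorem isClosedMap_gluedMap : IsClosedMap gluedMap := by
  intro C hC
  have hC' : ∀ t, IsClosed ((gluedPoint pairings vertexTable t) ⁻¹' C) := fun t =>
    hC.preimage (continuous_quot_mk.comp continuous_sigmaMk)
  have : gluedMap '' C =
      ⋃ t, proj '' (Subtype.val '' ((gluedPoint pairings vertexTable t) ⁻¹' C)) := by
    ext p
    simp only [Set.mem_iUnion]
    constructor
    · rintro ⟨⟨t, X⟩, hX, rfl⟩
      exact ⟨t, X.1, ⟨X, hX, rfl⟩, rfl⟩
    · rintro ⟨t, _, ⟨X, hX, rfl⟩, rfl⟩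
      exact ⟨_, hX, rfl⟩
  rw [this]
  refine isClosed_iUnion_of_finite fun t => isClosed_proj_image (side t)
    ((isClosed_tetra t).isClosedMap_subtype_val _ (hC' t)) ?_
  rintro _ ⟨X, -, rfl⟩
  exact ((mem_tetra_iff t X.1).1 X.2).1

/-- The glued space is the complement of the Borromean rings. -/
def gluedHomeo : GluedSpace pairings vertexTable ≃ₜ BorromeanComplement :=
  (Equiv.ofBijective gluedMap ⟨gluedMap_injective, gluedMap_surjective⟩).toHomeomorphOfContinuousClosed
    continuous_gluedMap isClosedMap_gluedMap

theorem gluedHomeo_gluedPoint (t : Fin 8) (X : idealHull (vertexTable t)) :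
    gluedHomeo (gluedPoint pairings vertexTable t X) = proj X.1 := rfl

/-! ### The hyperbolic structure -/

theorem isLocalHomeomorph_proj : IsLocalHomeomorph proj := isCoveringMap_proj.isLocalHomeomorph

theorem surjective_proj : Function.Surjective proj := isQuotientMap_proj.surjective

/-- A local inverse of the covering is locally an element of the group of the face pairings. -/
theorem eventually_symm_proj {e : OpenPartialHomeomorph H3 BorromeanComplement} (he : proj = e)
    {X : H3} (hX : proj X ∈ e.target) :
    ∃ g : SL(2, ℂ), ∀ᶠ Y in 𝓝 X, e.symm (proj Y) = g • Y := by
  have h1 : proj (e.symm (proj X)) = proj X :=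
    (congrFun he _).trans (e.right_inv hX)
  obtain ⟨g, hg, hgX⟩ := proj_eq_iff.1 h1.symm
  refine ⟨g, ?_⟩
  have h2 : ∀ᶠ Y in 𝓝 X, g • Y ∈ e.source := by
    refine (continuous_smul_H3 g).continuousAt.eventually_mem (e.open_source.mem_nhds ?_)
    rw [hgX]
    exact e.map_target hX
  filter_upwards [h2] with Y hY
  rw [← proj_smul hg Y]
  conv_lhs => rw [he]
  exact e.left_inv hY

/-- The charts are the local inverses of the covering. -/
@[reducible]
def chartedSpaceComplement : ChartedSpace H3 BorromeanComplement where
  atlas := {f | ∃ e : OpenPartialHomeomorph H3 BorromeanComplement, proj = e ∧ f = e.symm}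
  chartAt p := (isLocalHomeomorph_proj (surjective_proj p).choose).choose.symm
  mem_chart_source p := by
    have h := (isLocalHomeomorph_proj (surjective_proj p).choose).choose_spec
    have hp := (surjective_proj p).choose_spec
    set X := (surjective_proj p).choose
    set e := (isLocalHomeomorph_proj X).choose
    have := e.map_source h.1
    rw [← h.2, hp] at this
    exact this
  chart_mem_atlas p := ⟨_, (isLocalHomeomorph_proj (surjective_proj p).choose).choose_spec.2, rfl⟩

/-- A transition map is a local inverse of the covering composed with the covering, hence locally an
element of the group. -/
theorem hasGroupoid_complement :
    @HasGroupoid H3 _ BorromeanComplement _ chartedSpaceComplement hyperbolicGroupoid := by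
  let := chartedSpaceComplement
  refine hasGroupoid_of_pregroupoid hyperbolicPregroupoid ?_
  rintro _ _ ⟨e, he, rfl⟩ ⟨e', he', rfl⟩ X hX
  rw [OpenPartialHomeomorph.symm_symm] at hX ⊢
  have h2 : proj X ∈ e'.target := by
    have := hX.2
    rw [he]
    exact this
  obtain ⟨g, hg⟩ := eventually_symm_proj he' h2
  refine ⟨g, nhdsWithin_le_nhds ?_⟩
  filter_upwards [hg] with Y hY
  rw [he] at hY
  exact hY

theorem isHyperbolicUniversalCover_proj :
    @IsHyperbolicUniversalCover BorromeanComplement _ chartedSpaceComplement proj := by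
  let := chartedSpaceComplement
  refine ⟨isCoveringMap_proj, surjective_proj, ?_⟩
  rintro X _ ⟨e, he, rfl⟩ hX
  exact eventually_symm_proj he hX

/-! ### The gluing and completeness equations -/

theorem isOctahedralDecomposition : IsOctahedralDecomposition := by
  refine ⟨?_, by decide, by decide⟩
  unfold ExistsUnique
  decide

/-- The second dihedral angles. -/
theorem vAngle_shape : (fun t => vAngle (shape t)) =
    ![1 + Complex.I, Complex.I, Complex.I, (1 + Complex.I) / 2, Complex.I, 1 + Complex.I,
      (1 + Complex.I) / 2, 1 + Complex.I] := by
  have h1 : (1 - Complex.I) * (1 + Complex.I) = 2 := by linear_combination -Complex.I_mul_I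
  have h2 : 1 - Complex.I ≠ 0 := left_ne_zero_of_mul (h1 ▸ two_ne_zero)
  have e1 : vAngle ((1 + Complex.I) / 2) = 1 + Complex.I := by
    have e : 1 - (1 + Complex.I) / 2 = (1 - Complex.I) / 2 := by ring
    rw [vAngle, e, div_eq_iff (div_ne_zero h2 two_ne_zero)]
    linear_combination -(1 / 2 : ℂ) * h1
  have e2 : vAngle (1 + Complex.I) = Complex.I := by
    rw [vAngle, sub_add_cancel_left, div_eq_iff (neg_ne_zero.2 Complex.I_ne_zero)]
    linear_combination Complex.I_mul_I
  have e3 : vAngle Complex.I = (1 + Complex.I) / 2 := by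
    rw [vAngle, div_eq_iff h2]
    linear_combination -(1 / 2 : ℂ) * h1
  funext t
  fin_cases t
  exacts [e1, e2, e2, e3, e2, e1, e3, e1]

/-- The third dihedral angles. -/
theorem wAngle_shape : (fun t => wAngle (shape t)) =
    ![Complex.I, (1 + Complex.I) / 2, (1 + Complex.I) / 2, 1 + Complex.I, (1 + Complex.I) / 2,
      Complex.I, 1 + Complex.I, Complex.I] := by
  have h1 : (1 - Complex.I) * (1 + Complex.I) = 2 := by linear_combination -Complex.I_mul_I
  have h2 : 1 + Complex.I ≠ 0 := right_ne_zero_of_mul (h1 ▸ two_ne_zero)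
  have e1 : wAngle ((1 + Complex.I) / 2) = Complex.I := by
    rw [wAngle, div_eq_iff (div_ne_zero h2 two_ne_zero)]
    linear_combination (-1 / 2 : ℂ) * Complex.I_mul_I
  have e2 : wAngle (1 + Complex.I) = (1 + Complex.I) / 2 := by
    rw [wAngle, div_eq_iff h2]
    linear_combination (-1 / 2 : ℂ) * Complex.I_mul_I
  have e3 : wAngle Complex.I = 1 + Complex.I := by
    rw [wAngle, div_eq_iff Complex.I_ne_zero]
    linear_combination -Complex.I_mul_I
  funext t
  fin_cases t
  exacts [e1, e2, e2, e3, e2, e1, e3, e1]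

theorem arg_one_add_I : (1 + Complex.I).arg = Real.pi / 4 := by
  have h : (1 + Complex.I) = (√2 : ℝ) * (Real.cos (Real.pi / 4) + Real.sin (Real.pi / 4) * Complex.I) := by
    have h2 : (√2 : ℝ) * (√2 / 2) = 1 := by
      rw [← mul_div_assoc, Real.mul_self_sqrt zero_le_two]; norm_num
    rw [Real.cos_pi_div_four, Real.sin_pi_div_four]
    apply Complex.ext <;> simp <;> linarith
  rw [h, Complex.ofReal_cos, Complex.ofReal_sin]
  exact Complex.arg_mul_cos_add_sin_mul_I (by positivity)
    ⟨by linarith [Real.pi_pos], by linarith [Real.pi_pos]⟩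

theorem arg_one_add_I_div_two : ((1 + Complex.I) / 2).arg = Real.pi / 4 := by
  have h : (1 + Complex.I) / 2 = ((1 / 2 : ℝ) : ℂ) * (1 + Complex.I) := by push_cast; ring
  rw [h, Complex.arg_real_mul _ (by norm_num), arg_one_add_I]

theorem explicitEdgeEquations :
    ExplicitEdgeEquations shape (fun t => vAngle (shape t)) (fun t => wAngle (shape t)) := by
  rw [vAngle_shape, wAngle_shape, ExplicitEdgeEquations]
  simp only [List.forall_mem_cons, List.not_mem_nil, false_imp_iff, implies_true, and_true]
  refine ⟨⟨?_, ?_⟩, ⟨?_, ?_⟩, ⟨?_, ?_⟩, ⟨?_, ?_⟩, ⟨?_, ?_⟩, ⟨?_, ?_⟩, ⟨?_, ?_⟩, ⟨?_, ?_⟩⟩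
  all_goals
    simp only [shape, Matrix.cons_val, List.prod_cons, List.prod_nil, List.map_cons, List.map_nil,
      List.sum_cons, List.sum_nil, arg_one_add_I, arg_one_add_I_div_two, Complex.arg_I]
    first
    | ring1
    | apply Complex.ext <;> norm_num

theorem explicitCuspEquations :
    ExplicitCuspEquations shape (fun t => vAngle (shape t)) (fun t => wAngle (shape t)) := by
  have h1 : (1 - Complex.I) * (1 + Complex.I) = 2 := by linear_combination -Complex.I_mul_I
  have h2 : 1 + Complex.I ≠ 0 := right_ne_zero_of_mul (h1 ▸ two_ne_zero)
  have hI := Complex.I_ne_zero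
  rw [vAngle_shape, wAngle_shape, ExplicitCuspEquations]
  refine ⟨⟨?_, ?_, ?_, ?_⟩, ⟨?_, ?_⟩, ?_, ?_⟩ <;> simp only [shape, Matrix.cons_val] <;>
    rw [div_eq_one_iff_eq (by simp [h2])] <;> apply Complex.ext <;> norm_num

/-! ### Determination of the edge classes. -/

/-- The edge classes: cycles of edges, each adjacent to the next one. -/
def edgeCycles : List (List (Fin 8 × Sym2 (Fin 4))) :=
  [
   [(0, s(2, 3)), (5, s(0, 1)), (7, s(0, 2)), (2, s(2, 3)), (1, s(0, 3)), (6, s(0, 2)),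
    (4, s(2, 3)), (3, s(0, 3))],
   [(4, s(1, 3)), (6, s(0, 1)), (7, s(1, 2)), (5, s(1, 2))],
   [(0, s(1, 2)), (2, s(1, 3)), (1, s(1, 3)), (3, s(0, 1))],
   [(0, s(1, 3)), (5, s(0, 2)), (7, s(0, 1)), (2, s(1, 2)), (1, s(0, 1)), (6, s(1, 2)),
    (4, s(1, 2)), (3, s(1, 3))],
   [(1, s(0, 2)), (6, s(1, 3)), (7, s(1, 3)), (2, s(0, 2)), (7, s(2, 3)), (6, s(0, 3))],
   [(0, s(0, 3)), (5, s(2, 3)), (4, s(0, 1)), (3, s(2, 3)), (4, s(0, 3)), (5, s(1, 3))],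
   [(0, s(0, 1)), (5, s(0, 3)), (0, s(0, 2)), (2, s(0, 3)), (7, s(0, 3)), (2, s(0, 1))],
   [(1, s(2, 3)), (6, s(2, 3)), (1, s(1, 2)), (3, s(1, 2)), (4, s(0, 2)), (3, s(0, 2))]]

theorem edgeCycles_cover : ∀ e : Fin 8 × Sym2 (Fin 4), ¬ e.2.IsDiag → ∃ l ∈ edgeCycles, e ∈ l := by
  decide +kernel

theorem edgeCycles_nodup : ∀ l ∈ edgeCycles, l.Nodup := by
  decide +kernel

theorem edgeCycles_invariant : ∀ l ∈ edgeCycles, ∀ P ∈ pairings, ∀ a b : Fin 3, a ≠ b →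
    ((P.src, s(P.srcFace a, P.srcFace b)) ∈ l ↔ (P.tgt, s(P.tgtFace a, P.tgtFace b)) ∈ l) := by
  decide +kernel

theorem edgeCycles_chain : ∀ l ∈ edgeCycles, l.IsChain fun e e' => ∃ P ∈ pairings,
    ∃ a b : Fin 3, a ≠ b ∧
    ((e = (P.src, s(P.srcFace a, P.srcFace b)) ∧ e' = (P.tgt, s(P.tgtFace a, P.tgtFace b))) ∨
     (e' = (P.src, s(P.srcFace a, P.srcFace b)) ∧ e = (P.tgt, s(P.tgtFace a, P.tgtFace b)))) := by
  decide +kernel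

theorem eqvGen_of_isChain {α : Type*} {R S : α → α → Prop}
    (hS : ∀ x y, S x y → Relation.EqvGen R x y) {l : List α} (hl : l.IsChain S) :
    ∀ x ∈ l, ∀ y ∈ l, Relation.EqvGen R x y := by
  induction l with
  | nil => simp
  | cons a l ih =>
    have ha : ∀ y ∈ l, Relation.EqvGen R a y := by
      cases l with
      | nil => simp
      | cons b l =>
        rw [List.isChain_cons_cons] at hl
        exact fun y hy => (hS a b hl.1).trans _ _ _ (ih hl.2 b List.mem_cons_self y hy)
    have hl' : l.IsChain S := hl.tail
    intro x hx y hy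
    rcases List.mem_cons.1 hx with hxa | hxl <;> rcases List.mem_cons.1 hy with hya | hyl
    · rw [hxa, hya]
      exact Relation.EqvGen.refl _
    · exact hxa ▸ ha y hyl
    · exact hya ▸ (ha x hxl).symm
    · exact ih hl' x hxl y hyl

/-- Invariance under the pairings shows that a class is not larger than its list; adjacency of
consecutive edges shows that it is not smaller. -/
theorem edgeClass_eq {l : List (Fin 8 × Sym2 (Fin 4))} (hl : l ∈ edgeCycles)
    {e : Fin 8 × Sym2 (Fin 4)} (he : e ∈ l) : edgeClass pairings e = l.toFinset := by
  ext e'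
  simp only [edgeClass, Finset.mem_filter, Finset.mem_univ, true_and, List.mem_toFinset]
  constructor
  · intro h
    have : e ∈ l ↔ e' ∈ l := by
      clear he
      induction h with
      | rel x y h =>
        obtain ⟨P, hP, a, b, hab, rfl, rfl⟩ := h
        exact edgeCycles_invariant l hl P hP a b hab
      | refl => exact Iff.rfl
      | symm _ _ _ ih => exact ih.symm
      | trans _ _ _ _ _ ih ih' => exact ih.trans ih'
    exact this.1 he
  · refine eqvGen_of_isChain ?_ (edgeCycles_chain l hl) e he e'
    rintro x y ⟨P, hP, a, b, hab, ⟨h1, h2⟩ | ⟨h1, h2⟩⟩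
    · exact Relation.EqvGen.rel _ _ ⟨P, hP, a, b, hab, h1, h2⟩
    · exact (Relation.EqvGen.rel _ _ ⟨P, hP, a, b, hab, h1, h2⟩).symm

theorem edgeAngle_shape (t : Fin 8) (s : Sym2 (Fin 4)) : edgeAngle shape (t, s) =
    if s = s(0, 1) ∨ s = s(2, 3) then shape t
    else if s = s(0, 2) ∨ s = s(1, 3) then (fun t => vAngle (shape t)) t
    else (fun t => wAngle (shape t)) t := rfl

theorem edgeCycles_equations : ∀ l ∈ edgeCycles, (l.map (edgeAngle shape)).prod = 1 ∧
    (l.map fun e => (edgeAngle shape e).arg).sum = 2 * Real.pi := by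
  have z01 : ∀ t, edgeAngle shape (t, s(0, 1)) = shape t := fun t => rfl
  have z23 : ∀ t, edgeAngle shape (t, s(2, 3)) = shape t := fun t => by simp [edgeAngle]
  have v02 : ∀ t, edgeAngle shape (t, s(0, 2)) = (fun t => vAngle (shape t)) t := fun t => by
    simp [edgeAngle]
  have v13 : ∀ t, edgeAngle shape (t, s(1, 3)) = (fun t => vAngle (shape t)) t := fun t => by
    simp [edgeAngle]
  have w03 : ∀ t, edgeAngle shape (t, s(0, 3)) = (fun t => wAngle (shape t)) t := fun t => by
    simp [edgeAngle]
  have w12 : ∀ t, edgeAngle shape (t, s(1, 2)) = (fun t => wAngle (shape t)) t := fun t => by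
    simp [edgeAngle]
  rw [vAngle_shape] at v02 v13
  rw [wAngle_shape] at w03 w12
  simp only [edgeCycles, List.forall_mem_cons, List.not_mem_nil, false_imp_iff, implies_true,
    and_true]
  refine ⟨⟨?_, ?_⟩, ⟨?_, ?_⟩, ⟨?_, ?_⟩, ⟨?_, ?_⟩, ⟨?_, ?_⟩, ⟨?_, ?_⟩, ⟨?_, ?_⟩, ⟨?_, ?_⟩⟩
  all_goals
    simp only [List.map_cons, List.map_nil, z01, z23, v02, v13, w03, w12]
    simp only [shape, Matrix.cons_val, List.prod_cons, List.prod_nil, List.sum_cons, List.sum_nil,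
      arg_one_add_I, arg_one_add_I_div_two, Complex.arg_I]
    first
    | ring1
    | apply Complex.ext <;> norm_num

theorem edgeGluingEquations : EdgeGluingEquations pairings shape := by
  intro e he
  obtain ⟨l, hl, hel⟩ := edgeCycles_cover e he
  rw [edgeClass_eq hl hel, List.prod_toFinset _ (edgeCycles_nodup l hl),
    List.sum_toFinset _ (edgeCycles_nodup l hl)]
  exact edgeCycles_equations l hl

/-! ### Holonomy of the cusps. -/

/-- The numbers `i ^ m * (1 + i) ^ n`. -/
def codeVal (c : ZMod 4 × ℤ) : ℂ := Complex.I ^ c.1.val * (1 + Complex.I) ^ c.2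

theorem one_add_I_ne_zero : 1 + Complex.I ≠ 0 := fun h => by
  have := congrArg Complex.im h
  simp at this

theorem codeVal_ne_zero (c : ZMod 4 × ℤ) : codeVal c ≠ 0 :=
  mul_ne_zero (pow_ne_zero _ Complex.I_ne_zero) (zpow_ne_zero _ one_add_I_ne_zero)

/-- The exponent of `i` lives modulo `4`. This turns the multiplicative holonomy equations into
additive ones in `ZMod 4 × ℤ`, which are decidable. -/
theorem codeVal_add (c d : ZMod 4 × ℤ) : codeVal (c + d) = codeVal c * codeVal d := by
  have h : Complex.I ^ (c.1 + d.1).val = Complex.I ^ c.1.val * Complex.I ^ d.1.val := by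
    rw [ZMod.val_add, ← pow_add]
    conv_rhs => rw [← Nat.mod_add_div (c.1.val + d.1.val) 4, pow_add, pow_mul, Complex.I_pow_four,
      one_pow, mul_one]
  simp only [codeVal, Prod.fst_add, Prod.snd_add, h, zpow_add₀ one_add_I_ne_zero]
  ring

theorem codeVal_zero : codeVal 0 = 1 := by simp [codeVal]

theorem codeVal_neg (c : ZMod 4 × ℤ) : codeVal (-c) = (codeVal c)⁻¹ := by
  refine eq_inv_of_mul_eq_one_left ?_
  rw [← codeVal_add, neg_add_cancel, codeVal_zero]

/-- The dihedral angles as powers of `i` and `1 + i`. -/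
def angleCode (t : Fin 8) (s : Sym2 (Fin 4)) : ZMod 4 × ℤ :=
  if s = s(0, 1) ∨ s = s(2, 3) then
    ![(1, -1), (0, 1), (0, 1), (1, 0), (0, 1), (1, -1), (1, 0), (1, -1)] t
  else if s = s(0, 2) ∨ s = s(1, 3) then
    ![(0, 1), (1, 0), (1, 0), (1, -1), (1, 0), (0, 1), (1, -1), (0, 1)] t
  else ![(1, 0), (1, -1), (1, -1), (0, 1), (1, -1), (1, 0), (0, 1), (1, 0)] t

theorem edgeAngle_eq_codeVal (t : Fin 8) (s : Sym2 (Fin 4)) :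
    edgeAngle shape (t, s) = codeVal (angleCode t s) := by
  have h1 : codeVal (1, 0) = Complex.I := by
    rw [codeVal, show (1 : ZMod 4).val = 1 from rfl]; simp
  have h2 : codeVal (0, 1) = 1 + Complex.I := by simp [codeVal]
  have h3 : codeVal (1, -1) = (1 + Complex.I) / 2 := by
    rw [codeVal, show (1 : ZMod 4).val = 1 from rfl, pow_one, zpow_neg_one, ← div_eq_mul_inv,
      div_eq_iff one_add_I_ne_zero]
    linear_combination (-1 / 2 : ℂ) * Complex.I_mul_I
  rw [edgeAngle_shape, vAngle_shape, wAngle_shape, angleCode]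
  split_ifs
  · fin_cases t
    exacts [h3.symm, h2.symm, h2.symm, h1.symm, h2.symm, h3.symm, h1.symm, h3.symm]
  · fin_cases t
    exacts [h2.symm, h1.symm, h1.symm, h3.symm, h1.symm, h2.symm, h3.symm, h2.symm]
  · fin_cases t
    exacts [h1.symm, h3.symm, h3.symm, h2.symm, h3.symm, h1.symm, h2.symm, h1.symm]

/-- The directions of the sides of the triangles of the cusps: the entry `(t, v, f)` belongs to the
side in the face opposite to `f` of the link of the vertex `v` of the tetrahedron `t`, for a path
that leaves the triangle. -/
def sideCode : Fin 8 → Fin 4 → Fin 4 → ZMod 4 × ℤ :=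
  ![
    ![![(0, 0), (0, 0), (1, 0), (2, 1)], ![(0, 0), (0, 0), (2, 1), (1, 0)],
      ![(2, 0), (3, 1), (0, 0), (1, 0)], ![(0, 0), (3, -1), (2, -1), (0, 0)]],
    ![![(0, 0), (1, -1), (2, 0), (0, -1)], ![(3, 0), (0, 0), (2, 0), (0, 1)],
      ![(2, 1), (0, 0), (0, 0), (1, 0)], ![(3, 0), (1, 1), (0, 0), (0, 0)]],
    ![![(0, 0), (3, 0), (0, 1), (2, 0)], ![(0, 0), (0, 0), (3, 0), (1, 1)],
      ![(0, 0), (2, -1), (0, 0), (3, -1)], ![(2, 0), (0, 1), (3, 0), (0, 0)]],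
    ![![(0, 0), (2, 1), (0, 0), (1, 0)], ![(3, 1), (0, 0), (2, 0), (1, 0)],
      ![(2, 0), (3, 0), (0, 0), (0, 1)], ![(1, -1), (0, -1), (2, 0), (0, 0)]],
    ![![(0, 0), (1, 0), (2, 1), (0, 0)], ![(2, -2), (0, 0), (1, -2), (3, -1)],
      ![(2, 2), (0, 1), (0, 0), (1, 1)], ![(0, -2), (2, -1), (1, -2), (0, 0)]],
    ![![(0, 0), (0, 1), (1, 1), (2, 2)], ![(3, -2), (0, 0), (1, -1), (0, -2)],
      ![(3, -2), (0, -1), (0, 0), (2, -2)], ![(0, 1), (3, 0), (2, 0), (0, 0)]],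
    ![![(0, 0), (3, -1), (1, -2), (2, -2)], ![(2, -1), (0, 0), (1, -2), (0, -2)],
      ![(2, 1), (3, 1), (0, 0), (0, 2)], ![(3, 0), (2, 0), (0, 1), (0, 0)]],
    ![![(0, 0), (2, 1), (3, 1), (0, 2)], ![(3, -2), (0, 0), (1, -1), (0, -2)],
      ![(3, -2), (0, -1), (0, 0), (2, -2)], ![(2, 1), (1, 0), (0, 0), (0, 0)]]]

/-- The factors of the holonomy in terms of the directions of sides. -/
def factorCode (a : CuspStep 8) : ZMod 4 × ℤ :=
  if Equiv.Perm.sign a.2 = 1 then -angleCode a.1 s(a.2 0, a.2 3) else angleCode a.1 s(a.2 0, a.2 3)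

theorem cuspFactor_eq_codeVal (a : CuspStep 8) : cuspFactor shape a = codeVal (factorCode a) := by
  rw [cuspFactor, edgeAngle_eq_codeVal, factorCode]
  rcases Int.units_eq_one_or (Equiv.Perm.sign a.2) with h | h
  · simp [h, codeVal_neg]
  · simp [h]

/-- In a triangle the complex angle at a corner is the ratio of the two sides as complex numbers;
`(2, 0)` is the code of `-1` and reverses the side through which the path enters. -/
theorem factorCode_eq : ∀ a : CuspStep 8, factorCode a =
    sideCode a.1 (a.2 0) (a.2 2) + (2, 0) - sideCode a.1 (a.2 0) (a.2 1) := by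
  decide +kernel

/-- Glued sides have opposite directions, so the potential passes consistently from one triangle to
the next. That this holds across all pairings at once is the completeness of the cusps. -/
theorem sideCode_glue : ∀ P ∈ pairings, ∀ k : Fin 3, ∀ f f' : Fin 4, (∀ k, P.srcFace k ≠ f) →
    (∀ k, P.tgtFace k ≠ f') → sideCode P.src (P.srcFace k) f =
      sideCode P.tgt (P.tgtFace k) f' + (2, 0) := by
  decide +kernel

theorem sideCode_follows {a b : CuspStep 8} (h : CuspFollows pairings a b) :
    sideCode a.1 (a.2 0) (a.2 2) = sideCode b.1 (b.2 0) (b.2 1) + (2, 0) := by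
  obtain ⟨P, hP, hsrc, htgt, hs, ht, k, hk, hk'⟩ := h
  rw [← hsrc, ← htgt, ← hk, ← hk']
  rcases hP with hP | hP
  · exact sideCode_glue P hP k _ _ hs ht
  · have h1 := sideCode_glue P.reverse hP k _ _ ht hs
    have h2 : ((2, 0) + (2, 0) : ZMod 4 × ℤ) = 0 := by decide
    change sideCode P.tgt (P.tgtFace k) _ = sideCode P.src (P.srcFace k) _ + (2, 0) at h1
    rw [h1, add_assoc, h2, add_zero]

theorem cuspHolonomyEquations : CuspHolonomyEquations pairings shape := by
  intro m α hα
  let f : Fin (m + 1) → ℂ := fun k => codeVal (sideCode (α k).1 ((α k).2 0) ((α k).2 1))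
  have h : ∀ k, cuspFactor shape (α k) = f (k + 1) / f k := fun k => by
    have h2 : ((2, 0) + (2, 0) : ZMod 4 × ℤ) = 0 := by decide
    rw [cuspFactor_eq_codeVal, factorCode_eq, sideCode_follows (hα k), add_assoc, h2, add_zero,
      sub_eq_add_neg, codeVal_add, codeVal_neg, div_eq_mul_inv]
  simp only [h]
  rw [Finset.prod_div_distrib, div_eq_one_iff_eq (Finset.prod_ne_zero_iff.2 fun k _ =>
    codeVal_ne_zero _)]
  -- The path is closed, so the cyclic shift of indices permutes the factors and the quotients
  -- cancel.
  exact Equiv.prod_comp (Equiv.addRight 1) f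

theorem vertexTable_coincide : ∀ P ∈ innerPairings ++ [⟨3, ![1, 2, 3], 4, ![2, 0, 1]⟩], ∀ k,
    vertexTable P.src (P.srcFace k) = vertexTable P.tgt (P.tgtFace k) := by
  intro P hP k
  rcases List.mem_append.1 hP with h | h
  · exact innerPairings_vertex h k
  · rw [List.mem_singleton] at h
    subst h
    fin_cases k <;> rfl

end Borromean

end

open Borromean in
theorem mainTheorem1 :
    -- the triangulation comes from the octahedral decomposition
    IsOctahedralDecomposition ∧
    -- the shapes are those of positively oriented tetrahedra, and solve the equations
    (∀ t, 0 < (shape t).im) ∧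
    EdgeGluingEquations pairings shape ∧
    CuspHolonomyEquations pairings shape ∧
    ExplicitEdgeEquations shape (fun t => vAngle (shape t)) (fun t => wAngle (shape t)) ∧
    ExplicitCuspEquations shape (fun t => vAngle (shape t)) (fun t => wAngle (shape t)) ∧
    -- the tetrahedra with the vertices of the table have these shapes, and are placed side by side
    (∀ t, HasShape (vertexTable t) (shape t)) ∧
    (∀ P ∈ innerPairings ++ [⟨3, ![1, 2, 3], 4, ![2, 0, 1]⟩], ∀ k,
      vertexTable P.src (P.srcFace k) = vertexTable P.tgt (P.tgtFace k)) ∧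
    -- they glue up to the complement of the Borromean rings, with a complete hyperbolic structure
    ∃ (h : GluedSpace pairings vertexTable ≃ₜ BorromeanComplement)
      (_ : ChartedSpace H3 BorromeanComplement) (p : H3 → BorromeanComplement),
      HasGroupoid BorromeanComplement hyperbolicGroupoid ∧
      IsHyperbolicUniversalCover p ∧
      (∀ (t : Fin 8) (x : idealHull (vertexTable t)),
        p x.1 = h (gluedPoint pairings vertexTable t x)) ∧
      (∀ x y : H3, p x = p y ↔ ∃ g ∈ facePairingGroup pairings vertexTable, g • x = y) :=
  ⟨isOctahedralDecomposition, shape_im_pos, edgeGluingEquations, cuspHolonomyEquations,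
    explicitEdgeEquations, explicitCuspEquations, hasShape_vertexTable, vertexTable_coincide,
    gluedHomeo, chartedSpaceComplement, proj, hasGroupoid_complement,
    isHyperbolicUniversalCover_proj, fun t x => (gluedHomeo_gluedPoint t x).symm,
    fun _ _ => proj_eq_iff⟩
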